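/- For $f:\mathbb R^3\to\mathbb C$ let $\hat f(\xi)=\int_{\mathbb R^3}e^{-ix\cdot\xi}f(x)\,dx$ (in the sense of Plancherel for $f\in L^2$, and in the sense of tempered distributions in general). For $\varepsilon>0$ and $u,v\in L^2(\mathbb R^3)$ let $$W^\varepsilon(u,v)(x,\xi)=\frac1{(2\pi)^3}\int_{\mathbb R^3}e^{-iy\cdot\xi}\,u\big(x+\tfrac\varepsilon2y\big)\,\overline{v\big(x-\tfrac\varepsilon2y\big)}\,dy ,\qquad \langle W,\psi\rangle=\int_{\mathbb R^6}W(x,\xi)\,\psi(x,\xi)\,dx\,d\xi .$$ Let $C(-1)$ be the unit ball of $\mathbb R^3$ and $C(j)=\{2^j\le|x|<2^{j+1}\}$ for $j\ge0$, and let $B$, $B^*$ be the spaces of measurable functions with finite norm $$\|f\|_B=\sum_{j\ge-1}\Big(2^{j+1}\int_{C(j)}|f|^2\Big)^{1/2},\qquad \|u\|_{B^*}=\sup_{j\ge-1}\Big(2^{-j}\int_{C(j)}|u|^2\Big)^{1/2}.$$ Let $q_1\in\mathbb R^3\setminus\{0\}$. Let $\alpha_\varepsilon>0$ for $\varepsilon>0$,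 with $\alpha_\varepsilon\to0$ as $\varepsilon\to0^+$ and, for some $\gamma>0$, $\alpha_\varepsilon\ge\varepsilon^\gamma$ for all small $\varepsilon$. Let $S_0,S_1\in B$ satisfy $\langle x\rangle^NS_0,\ \langle x\rangle^NS_1\in L^2(\mathbb R^3)$ for some $N>\frac12+\frac{3\gamma}{\gamma+1}$, where $\langle x\rangle=(1+|x|^2)^{1/2}$. Put $$S_0^\varepsilon(x)=\varepsilon^{-3}S_0(x/\varepsilon),\qquad S_1^\varepsilon(x)=\varepsilon^{-3}S_1\big((x-q_1)/\varepsilon\big),$$ and for each $\varepsilon>0$ let $u^\varepsilon\in L^2(\mathbb R^3)$ be the solution of $$-i\frac{\alpha_\varepsilon}\varepsilon u^\varepsilon+\Delta u^\varepsilon+\frac1{\varepsilon^2}u^\varepsilon=S_0^\varepsilon+S_1^\varepsilon .$$ Let $w_j\in B^*$ ($j=0,1$) be the outgoing solution of $\Delta w_j+w_j=S_j$, that is, the solution with $$\widehat{w_j}(\xi)=\frac{-\widehat{S_j}(\xi)}{|\xi|^2-1+i0}:=\lim_{\delta\to0^+}\frac{-\widehat{S_j}(\xi)}{|\xi|^2-1+i\delta}\quad\text{in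 }\mathcal S'(\mathbb R^3).$$ **Proposition 4.3.** The families $\big(\varepsilon W^\varepsilon(S_0^\varepsilon,u^\varepsilon)\big)_{\varepsilon>0}$ and $\big(\varepsilon W^\varepsilon(S_1^\varepsilon,u^\varepsilon)\big)_{\varepsilon>0}$ are bounded in $\mathcal S'(\mathbb R^6)$: each of them is bounded, uniformly in $\varepsilon$, by one continuous seminorm of $\mathcal S(\mathbb R^6)$. The outgoing solutions $w_0,w_1\in B^*$ exist, and for every $\psi\in\mathcal S(\mathbb R^6)$, $$\lim_{\varepsilon\to0^+}\varepsilon\langle W^\varepsilon(S_0^\varepsilon,u^\varepsilon),\psi\rangle=\frac1{(2\pi)^3}\int_{\mathbb R^3}\overline{\widehat{w_0}(\xi)}\,\widehat{S_0}(\xi)\,\psi(0,\xi)\,d\xi,$$ $$\lim_{\varepsilon\to0^+}\varepsilon\langle W^\varepsilon(S_1^\varepsilon,u^\varepsilon),\psi\rangle=\frac1{(2\pi)^3}\int_{\mathbb R^3}\overline{\widehat{w_1}(\xi)}\,\widehat{S_1}(\xi)\,\psi(q_1,\xi)\,d\xi .$$ Here the integrals on the right are duality brackets: for $g(\xi)=\widehat{S_j}(\xi)\psi(q,\xi)$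 (with $q=0$ for $j=0$ and $q=q_1$ for $j=1$), the inverse Fourier transform $\check g(x)=(2\pi)^{-3}\int e^{ix\cdot\xi}g(\xi)\,d\xi$ belongs to $B$, and $$\int\overline{\widehat{w_j}}\,g\,d\xi:=(2\pi)^3\int\overline{w_j(x)}\,\check g(x)\,dx=\lim_{\delta\to0^+}\int\overline{\Big(\frac{-\widehat{S_j}(\xi)}{|\xi|^2-1+i\delta}\Big)}\,g(\xi)\,d\xi .$$ -/

import Mathlib

open MeasureTheory Filter Topology
open scoped ENNReal SchwartzMap FourierTransform Laplacian ComplexConjugate RealInnerProductSpace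

noncomputable section

namespace HelmholtzTwoSources

/-- Euclidean space `ℝ³`. The phase space `ℝ⁶` is `E3 × E3`, with points `(x, ξ)`. -/
abbrev E3 : Type := EuclideanSpace ℝ (Fin 3)

/-- The Japanese bracket `⟨x⟩ = (1 + |x|²)^{1/2}`. -/
def japanese (x : E3) : ℝ := Real.sqrt (1 + ‖x‖ ^ 2)

/-! ### The Agmon–Hörmander spaces -/

/-- The rings `C(k - 1)`: the unit ball for `k = 0`, and `{2^(k-1) ≤ |x| < 2^k}` for `k ≥ 1`. -/
def annulus : ℕ → Set E3
  | 0 => Metric.ball 0 1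
  | k + 1 => {x | 2 ^ k ≤ ‖x‖ ∧ ‖x‖ < 2 ^ (k + 1)}

/-- `‖f‖_B = ∑_{j ≥ -1} (2^{j+1} ∫_{C(j)} |f|²)^{1/2}`, written with `k = j + 1`. -/
def normB (f : E3 → ℂ) : ℝ≥0∞ :=
  ∑' k : ℕ, (2 ^ k * ∫⁻ x in annulus k, ‖f x‖ₑ ^ 2) ^ (1 / 2 : ℝ)

/-- `‖u‖_{B*} = sup_{j ≥ -1} (2^{-j} ∫_{C(j)} |u|²)^{1/2}`, written with `k = j + 1`. -/
def normBStar (u : E3 → ℂ) : ℝ≥0∞ :=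
  ⨆ k : ℕ, (2 / 2 ^ k * ∫⁻ x in annulus k, ‖u x‖ₑ ^ 2) ^ (1 / 2 : ℝ)

/-- Membership in the space `B`. -/
def MemB (f : E3 → ℂ) : Prop := AEStronglyMeasurable f volume ∧ normB f < ∞

/-- Membership in the space `B*`. -/
def MemBStar (u : E3 → ℂ) : Prop := AEStronglyMeasurable u volume ∧ normBStar u < ∞

/-! ### Fourier transforms -/

open Classical in
/-- The Fourier transform `f̂(ξ) = ∫ e^{-i x·ξ} f(x) dx` of `f ∈ L²(ℝ³)`, in the sense of
Plancherel. Mathlib's transform has the kernel `e^{-2πi x·η}`, hence the substitution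
`η = ξ / 2π`. -/
def hatL2 (f : E3 → ℂ) (ξ : E3) : ℂ :=
  if hf : MemLp f 2 volume then (𝓕 (hf.toLp f) : Lp (α := E3) ℂ 2 volume) ((2 * Real.pi)⁻¹ • ξ) else 0

/-- The Fourier transform `φ̂(x) = ∫ e^{-i x·ξ} φ(ξ) dξ` of an integrable function. -/
def hat (φ : E3 → ℂ) (x : E3) : ℂ :=
  ∫ ξ : E3, Complex.exp (-Complex.I * (⟪x, ξ⟫ : ℝ)) * φ ξ

/-- The inverse transform `(2π)^{-3} ∫ e^{i x·ξ} g(ξ) dξ` of an integrable function. -/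
def invHat (g : E3 → ℂ) (x : E3) : ℂ :=
  (2 * Real.pi : ℂ)⁻¹ ^ 3 * ∫ ξ : E3, Complex.exp (Complex.I * (⟪x, ξ⟫ : ℝ)) * g ξ

/-! ### Helmholtz equations -/

/-- `-i a v + Δ v + b v = f` in the sense of tempered distributions. -/
def IsWeakHelmholtz (a b : ℝ) (f v : E3 → ℂ) : Prop :=
  ∀ φ : 𝓢(E3, ℂ),
    ∫ x, v x * (-Complex.I * a * φ x + (Δ φ) x + b * φ x) = ∫ x, f x * φ x

/-- The rescaled source `ε^{-3} S((x - q) / ε)`, concentrating at `q`. -/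
def scaledSource (ε : ℝ) (S : E3 → ℂ) (q x : E3) : ℂ :=
  (ε⁻¹ ^ 3 : ℝ) * S (ε⁻¹ • (x - q))

/-- `-Ŝ(ξ) / (|ξ|² - 1 + i δ)`; its limit as `δ → 0⁺` is `-Ŝ(ξ) / (|ξ|² - 1 + i0)`. -/
def regularizedHat (S : E3 → ℂ) (δ : ℝ) (ξ : E3) : ℂ :=
  -hatL2 S ξ / (((‖ξ‖ ^ 2 - 1 : ℝ) : ℂ) + Complex.I * δ)

/-- `w ∈ B*` is the outgoing solution to `Δ w + w = S`: it solves this equation, and its Fourier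
transform, as a tempered distribution, is `ŵ = -Ŝ / (|ξ|² - 1 + i0)`. -/
def IsOutgoingSolution (S w : E3 → ℂ) : Prop :=
  MemBStar w ∧ IsWeakHelmholtz 0 1 S w ∧
    ∀ φ : 𝓢(E3, ℂ),
      Tendsto (fun δ : ℝ => ∫ ξ, regularizedHat S δ ξ * φ ξ) (𝓝[>] 0)
        (𝓝 (∫ x, w x * hat φ x))

/-- `I` is the value of `∫ conj(ŵ(ξ)) g(ξ) dξ`, where `w` is the outgoing solution to
`Δ w + w = S`. Since `ŵ` is in general not a function, this is a duality bracket: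
the inverse Fourier transform of `g` lies in `B`, and `I` is its pairing with `w ∈ B*`
(Parseval's formula); it is also the value obtained from the formula
`ŵ = -Ŝ / (|ξ|² - 1 + i0)`. -/
def IsFourierIntegral (S w g : E3 → ℂ) (I : ℂ) : Prop :=
  MemB (invHat g) ∧
  I = (2 * Real.pi : ℂ) ^ 3 * ∫ x, conj (w x) * invHat g x ∧
  Tendsto (fun δ : ℝ => ∫ ξ, conj (regularizedHat S δ ξ) * g ξ) (𝓝[>] 0) (𝓝 I)

/-! ### Wigner transforms -/

/-- The Wigner transform
`W^ε(u, v)(x, ξ) = (2π)^{-3} ∫ e^{-i y·ξ} u(x + ε y / 2) conj(v(x - ε y / 2)) dy`.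
For `u, v ∈ L²` the integral converges absolutely at every `(x, ξ)`. -/
def wigner (ε : ℝ) (u v : E3 → ℂ) (x ξ : E3) : ℂ :=
  (2 * Real.pi : ℂ)⁻¹ ^ 3 *
    ∫ y : E3, Complex.exp (-Complex.I * (⟪y, ξ⟫ : ℝ)) *
      (u (x + (ε / 2) • y) * conj (v (x - (ε / 2) • y)))

/-- The (bilinear) bracket `⟨W, ψ⟩` of a function on `ℝ⁶` with a Schwartz function. -/
def bracket (W : E3 → E3 → ℂ) (ψ : 𝓢(E3 × E3, ℂ)) : ℂ :=
  ∫ p : E3 × E3, W p.1 p.2 * ψ p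

/-- The family `(F ε)_{ε > 0}` of functions on `ℝ⁶` is a bounded family of tempered distributions:
every `F ε` defines one by integration, and their values at `ψ` are bounded, uniformly
in `ε`, by one continuous seminorm of `ψ`. -/
def BoundedTempered (F : ℝ → E3 → E3 → ℂ) : Prop :=
  (∀ ε : ℝ, 0 < ε → ∀ ψ : 𝓢(E3 × E3, ℂ),
    Integrable (fun p : E3 × E3 => F ε p.1 p.2 * ψ p) volume) ∧
  ∃ (s : Finset (ℕ × ℕ)) (C : ℝ), ∀ ε : ℝ, 0 < ε → ∀ ψ : 𝓢(E3 × E3, ℂ),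
    ‖bracket (F ε) ψ‖ ≤ C * (s.sup (schwartzSeminormFamily ℂ (E3 × E3) ℂ)) ψ

end HelmholtzTwoSources

end

open MeasureTheory Filter Topology
open scoped ENNReal SchwartzMap FourierTransform Laplacian ComplexConjugate RealInnerProductSpace
noncomputable section
namespace HelmholtzTwoSources

/-! ### The `L²` norm of a function -/

/-! Zoom in on one source, at `q`, the other being at `q'`. The rescaled solution `y ↦ ε u^ε(q + ε
y)` has Fourier transform `-(Ŝ + e^{-i a·ξ} T̂) / (|ξ|² - 1 + iδ)`, where `δ = ε α_ε → 0⁺` and `a =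
(q' - q)/ε → ∞` (`hatL2_rescaled`). Fubini and a change of variables turn `ε⟨W^ε(S^ε, u^ε), ψ⟩` into
the pairing of this function with `smear`, the image of `S` under the kernel `ψ̂(q + ε(z + x)/2, z -
x)`, with `ψ̂` the partial transform in `ξ` (`mul_bracket_wigner_scaledSource`). By Parseval
everything rests on the forms `multForm (resMult δ a) f g = ∫ e^{-i a·ξ} f̂ conj(ĝ) / (|ξ|² - 1 +
iδ)`.

Uniform bound (`norm_multForm_resMult_le`). Up to bounded multipliers, the resolvent is a sum over
the three coordinate directions `e` of one-dimensional resolvents in `⟪e, ξ⟫`, whose kernels in the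
conjugate variable are bounded uniformly in `δ`. A multiplier in the orthogonal frequencies does not
move supports in the direction `e`, so a bounded kernel acts from `ℓ¹(L²)` over unit strips to its
dual. The `ℓ¹(L²)` norm is controlled by `‖⟨x⟩^s f‖` for every `s > 1/2`, and by `√R ‖g‖` for `g`
supported in a ball of radius `R`.

Convergence. On `L¹ ∩ L²`, the resolvent is the time integral of the Schrödinger group, which decays
like `τ^{-3/2}` uniformly in `a`. Dominated convergence gives a limit as `δ → 0⁺` for `a = 0`
(`exists_tendsto_resForm`), and the limit `0` when `a → ∞`, by the Riemann–Lebesgue lemma at each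
`τ` (`tendsto_resForm_cocompact`). The uniform bound extends both to weighted `L²` by truncation to
balls.

The outgoing solution is the weak limit of the solutions with absorption (`exists_absorptionLimit`);
testing it on its own restriction to a ring puts it in `B*`. Finally `smear` is bounded in the
weighted space and converges there as `ε → 0` to `(2π)³` times the inverse transform of `Ŝ ψ(q, ·)`.
The term with `a = 0` gives the limit and the interaction with the distant source disappears
(`tendsto_wigner_source`). -/

/-- The `L²` norm as a real number. -/
def nrm (f : E3 → ℂ) : ℝ := (eLpNorm f 2 volume).toReal

lemma nrm_nonneg (f : E3 → ℂ) : 0 ≤ nrm f := ENNReal.toReal_nonneg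

lemma memLp_conj {f : E3 → ℂ} (hf : MemLp f 2 volume) :
    MemLp (fun x => conj (f x)) 2 volume := hf.star

lemma nrm_conj (f : E3 → ℂ) : nrm (fun x => conj (f x)) = nrm f := by
  unfold nrm
  congr 1
  exact eLpNorm_congr_norm_ae (by simp)

lemma nrm_mono {f g : E3 → ℂ} (hg : MemLp g 2 volume) (h : ∀ᵐ x, ‖f x‖ ≤ ‖g x‖) :
    nrm f ≤ nrm g :=
  ENNReal.toReal_mono hg.2.ne (eLpNorm_mono_ae h)

lemma nrm_add_le {f g : E3 → ℂ} (hf : MemLp f 2 volume) (hg : MemLp g 2 volume) :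
    nrm (fun x => f x + g x) ≤ nrm f + nrm g := by
  unfold nrm
  rw [← ENNReal.toReal_add hf.2.ne hg.2.ne]
  exact ENNReal.toReal_mono (ENNReal.add_ne_top.2 ⟨hf.2.ne, hg.2.ne⟩)
    (eLpNorm_add_le hf.1 hg.1 (by norm_num))

lemma integrable_mul_of_memLp {f g : E3 → ℂ} (hf : MemLp f 2 volume) (hg : MemLp g 2 volume) :
    Integrable (fun x => f x * g x) volume := hf.integrable_mul hg

lemma integral_norm_mul_le {f g : E3 → ℂ} (hf : MemLp f 2 volume) (hg : MemLp g 2 volume) :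
    ∫ x, ‖f x * g x‖ ≤ nrm f * nrm g := by
  have h := eLpNorm_smul_le_mul_eLpNorm (p := 2) (q := 2) (r := 1) hg.1 hf.1
  rw [integral_norm_eq_lintegral_enorm (f := fun x => f x * g x) (hf.1.mul hg.1),
    nrm, nrm, ← ENNReal.toReal_mul]
  refine ENNReal.toReal_mono (ENNReal.mul_ne_top hf.2.ne hg.2.ne) ?_
  rwa [eLpNorm_one_eq_lintegral_enorm] at h

lemma integral_norm_sq_eq {f : E3 → ℂ} (hf : MemLp f 2 volume) :
    ∫ x, ‖f x‖ ^ 2 = nrm f ^ 2 := by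
  have h := hf.eLpNorm_eq_integral_rpow_norm (by norm_num) (by norm_num)
  have h0 : 0 ≤ ∫ x, ‖f x‖ ^ 2 := integral_nonneg fun x => by positivity
  rw [nrm, h, ENNReal.toReal_ofReal (by positivity)]
  simp only [ENNReal.toReal_ofNat, Real.rpow_ofNat]
  rw [← Real.rpow_natCast, ← Real.rpow_mul h0]
  norm_num

/-! ### The Fourier transform on `L²` -/

lemma two_pi_inv_ne : (2 * Real.pi)⁻¹ ≠ 0 := by positivity

lemma hatL2_eq {f : E3 → ℂ} (hf : MemLp f 2 volume) :
    hatL2 f = fun ξ => (𝓕 (hf.toLp f) : Lp (α := E3) ℂ 2 volume) ((2 * Real.pi)⁻¹ • ξ) := by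
  ext ξ; simp [hatL2, hf]

lemma quasiMeasurePreserving_smul {c : ℝ} (hc : c ≠ 0) :
    Measure.QuasiMeasurePreserving (fun x : E3 => c • x) volume volume := by
  refine ⟨measurable_const_smul c, ?_⟩
  rw [Measure.map_addHaar_smul _ hc]
  exact Measure.smul_absolutelyContinuous

lemma ae_comp_smul {p : E3 → Prop} (h : ∀ᵐ x, p x) {c : ℝ} (hc : c ≠ 0) :
    ∀ᵐ x : E3, p (c • x) := (quasiMeasurePreserving_smul hc).ae h

lemma memLp_comp_smul {f : E3 → ℂ} (hf : MemLp f 2 volume) {c : ℝ} (hc : c ≠ 0) :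
    MemLp (fun x => f (c • x)) 2 volume := by
  have h : MemLp f 2 (Measure.map (fun x : E3 => c • x) volume) := by
    rw [Measure.map_addHaar_smul _ hc]
    exact hf.smul_measure (by simp)
  exact h.comp_of_map (measurable_const_smul c).aemeasurable

lemma memLp_comp_add {f : E3 → ℂ} (hf : MemLp f 2 volume) (b : E3) :
    MemLp (fun x => f (x + b)) 2 volume :=
  hf.comp_measurePreserving (measurePreserving_add_right volume b)

lemma memLp_hatL2 (f : E3 → ℂ) : MemLp (hatL2 f) 2 volume := by
  by_cases hf : MemLp f 2 volume
  · rw [hatL2_eq hf]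
    exact memLp_comp_smul (Lp.memLp _) two_pi_inv_ne
  · have : hatL2 f = 0 := by ext ξ; simp [hatL2, hf]
    rw [this]; exact MemLp.zero

lemma hatL2_congr {f g : E3 → ℂ} (hf : MemLp f 2 volume) (h : f =ᵐ[volume] g) :
    hatL2 f = hatL2 g := by
  have hg : MemLp g 2 volume := hf.ae_eq h
  rw [hatL2_eq hf, hatL2_eq hg, (MemLp.toLp_eq_toLp_iff hf hg).2 h]

lemma hatL2_add {f g : E3 → ℂ} (hf : MemLp f 2 volume) (hg : MemLp g 2 volume) :
    hatL2 (fun x => f x + g x) =ᵐ[volume] fun ξ => hatL2 f ξ + hatL2 g ξ := by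
  have e : (fun x => f x + g x) = f + g := rfl
  rw [e, hatL2_eq (hf.add hg), hatL2_eq hf, hatL2_eq hg]
  have h2 : 𝓕 ((hf.add hg).toLp (f + g)) = 𝓕 (hf.toLp f) + 𝓕 (hg.toLp g) := by
    rw [← FourierTransform.fourier_add]; rfl
  rw [h2]
  exact ae_comp_smul (Lp.coeFn_add _ _) two_pi_inv_ne

lemma hatL2_const_mul {f : E3 → ℂ} (c : ℂ) (hf : MemLp f 2 volume) :
    hatL2 (fun x => c * f x) =ᵐ[volume] fun ξ => c * hatL2 f ξ := by
  have hc : MemLp (c • f) 2 volume := hf.const_smul c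
  have e : (fun x => c * f x) = c • f := rfl
  rw [e, hatL2_eq hc, hatL2_eq hf]
  have h2 : 𝓕 (hc.toLp (c • f)) = c • 𝓕 (hf.toLp f) := by
    rw [← FourierTransform.fourier_smul]; rfl
  rw [h2]
  exact ae_comp_smul (Lp.coeFn_smul _ _) two_pi_inv_ne

lemma integral_comp_two_pi_inv_smul (F : E3 → ℂ) :
    ∫ ξ : E3, F ((2 * Real.pi)⁻¹ • ξ) = (2 * Real.pi : ℂ) ^ 3 * ∫ ξ, F ξ := by
  rw [Measure.integral_comp_smul]
  simp only [finrank_euclideanSpace, Fintype.card_fin]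
  rw [abs_of_pos (by positivity)]
  rw [Complex.real_smul]
  congr 1
  push_cast
  rw [inv_pow, inv_inv]

/-- Parseval's identity. -/
lemma integral_hatL2_mul_conj {f g : E3 → ℂ} (hf : MemLp f 2 volume) (hg : MemLp g 2 volume) :
    ∫ ξ, hatL2 f ξ * conj (hatL2 g ξ) = (2 * Real.pi : ℂ) ^ 3 * ∫ x, f x * conj (g x) := by
  rw [hatL2_eq hf, hatL2_eq hg]
  rw [integral_comp_two_pi_inv_smul (fun η => (𝓕 (hf.toLp f) : Lp (α := E3) ℂ 2 volume) η *
    conj ((𝓕 (hg.toLp g) : Lp (α := E3) ℂ 2 volume) η))]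
  congr 1
  have h := Lp.inner_fourier_eq (hg.toLp g) (hf.toLp f)
  rw [L2.inner_def, L2.inner_def] at h
  simp only [RCLike.inner_apply] at h
  rw [h]
  refine integral_congr_ae ?_
  filter_upwards [hf.coeFn_toLp, hg.coeFn_toLp] with x h1 h2
  rw [h1, h2]

lemma nrm_sq_hatL2 {f : E3 → ℂ} (hf : MemLp f 2 volume) :
    nrm (hatL2 f) ^ 2 = (2 * Real.pi) ^ 3 * nrm f ^ 2 := by
  have h := integral_hatL2_mul_conj hf hf
  simp only [Complex.mul_conj, Complex.normSq_eq_norm_sq] at h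
  rw [integral_complex_ofReal, integral_complex_ofReal, integral_norm_sq_eq (memLp_hatL2 f),
    integral_norm_sq_eq hf] at h
  exact_mod_cast h

lemma exists_hatL2_eq {h : E3 → ℂ} (hh : MemLp h 2 volume) :
    ∃ f : E3 → ℂ, MemLp f 2 volume ∧ hatL2 f =ᵐ[volume] h := by
  have h2 : MemLp (fun ξ => h ((2 * Real.pi) • ξ)) 2 volume := memLp_comp_smul hh (by positivity)
  refine ⟨(𝓕⁻ (h2.toLp _) : Lp (α := E3) ℂ 2 volume), Lp.memLp _, ?_⟩
  rw [hatL2_eq (Lp.memLp _), Lp.toLp_coeFn, FourierTransform.fourier_fourierInv_eq]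
  filter_upwards [ae_comp_smul h2.coeFn_toLp two_pi_inv_ne] with ξ hξ
  rw [hξ, smul_smul, mul_inv_cancel₀ (by positivity), one_smul]

/-- Smooth compactly supported functions are Schwartz, so equality as tempered distributions
suffices. The Plancherel transforms below are identified in this way. -/
lemma ae_eq_of_forall_schwartz {f g : E3 → ℂ} (hf : LocallyIntegrable f volume)
    (hg : LocallyIntegrable g volume) (h : ∀ φ : 𝓢(E3, ℂ), ∫ x, f x * φ x = ∫ x, g x * φ x) :
    f =ᵐ[volume] g := by
  refine ae_eq_of_integral_contDiff_smul_eq hf hg fun χ hχ hc => ?_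
  have hc' : HasCompactSupport (fun x => (χ x : ℂ)) := hc.comp_left (g := fun r : ℝ => (r : ℂ)) (by simp)
  have hs : ContDiff ℝ ((⊤ : ℕ∞) : WithTop ℕ∞) (fun x => (χ x : ℂ)) := Complex.ofRealCLM.contDiff.comp hχ
  have := h (hc'.toSchwartzMap hs)
  simpa [mul_comm, Complex.real_smul] using this

lemma hat_eq_fourier (φ : E3 → ℂ) (ξ : E3) : hat φ ξ = 𝓕 φ ((2 * Real.pi)⁻¹ • ξ) := by
  rw [Real.fourier_eq, hat]
  refine integral_congr_ae (Eventually.of_forall fun x => ?_)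
  simp only [Circle.smul_def, Real.fourierChar_apply, smul_eq_mul]
  congr 2
  rw [inner_smul_right, real_inner_comm]
  push_cast
  have : (Real.pi : ℂ) ≠ 0 := by exact_mod_cast Real.pi_ne_zero
  field_simp

lemma continuous_integral_mul_Lp {f : E3 → ℂ} (hf : MemLp f 2 volume) :
    Continuous fun g : Lp (α := E3) ℂ 2 volume => ∫ x, f x * g x := by
  have : (fun g : Lp (α := E3) ℂ 2 volume => ∫ x, f x * g x) =
      fun g => inner ℂ ((memLp_conj hf).toLp _) g := by
    ext g
    rw [L2.inner_def]
    refine integral_congr_ae ?_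
    filter_upwards [(memLp_conj hf).coeFn_toLp] with x hx
    rw [RCLike.inner_apply, hx, Complex.conj_conj, mul_comm]
  rw [this]
  exact (innerSL ℂ _).continuous

lemma integral_fourier_mul_schwartz (f : Lp (α := E3) ℂ 2 volume) (φ : 𝓢(E3, ℂ)) :
    ∫ ξ, (𝓕 f : Lp (α := E3) ℂ 2 volume) ξ * φ ξ = ∫ x, f x * (𝓕 φ) x := by
  have h := congrArg (fun T => T φ) (Lp.fourier_toTemperedDistribution_eq f)
  simp only [TemperedDistribution.fourier_apply, Lp.toTemperedDistribution_apply,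
    smul_eq_mul] at h
  simp_rw [mul_comm _ (φ _), mul_comm _ ((𝓕 φ) _)]
  exact h.symm

lemma fourier_comp_smul (φ : E3 → ℂ) {c : ℝ} (hc : 0 < c) (x : E3) :
    𝓕 (fun ξ => φ (c • ξ)) x = (c : ℂ)⁻¹ ^ 3 * 𝓕 φ (c⁻¹ • x) := by
  rw [Real.fourier_eq, Real.fourier_eq]
  have h := Measure.integral_comp_smul volume
    (fun v : E3 => Real.fourierChar (-⟪v, c⁻¹ • x⟫) • φ v) c
  simp only [finrank_euclideanSpace, Fintype.card_fin] at h
  rw [abs_of_pos (by positivity), Complex.real_smul] at h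
  push_cast at h
  rw [inv_pow, ← h]
  refine integral_congr_ae (Eventually.of_forall fun ξ => ?_)
  simp only
  rw [inner_smul_left, inner_smul_right]
  simp [hc.ne']

/-- For `f ∈ L²` and a Schwartz function `φ`, `∫ f̂ φ = ∫ f φ̂`. -/
lemma integral_hatL2_mul_schwartz {f : E3 → ℂ} (hf : MemLp f 2 volume) (φ : 𝓢(E3, ℂ)) :
    ∫ ξ, hatL2 f ξ * φ ξ = ∫ x, f x * hat φ x := by
  -- The dilation by `2π` converts the kernel `e^{-2πi x·η}` into `e^{-i x·ξ}`.
  let L : E3 ≃L[ℝ] E3 :=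
    ContinuousLinearEquiv.smulLeft (Units.mk0 (2 * Real.pi : ℝ) (by positivity))
  let φ2 : 𝓢(E3, ℂ) := SchwartzMap.compCLMOfContinuousLinearEquiv ℂ L φ
  have hφ2 : ∀ x, φ2 x = φ ((2 * Real.pi) • x) := fun x => rfl
  have hF : ∀ x, (𝓕 φ2) x = (2 * Real.pi : ℂ)⁻¹ ^ 3 * hat φ x := by
    intro x
    rw [hat_eq_fourier, SchwartzMap.fourier_coe]
    have := fourier_comp_smul φ (c := 2 * Real.pi) (by positivity) x
    push_cast at this
    exact this
  have h3 := integral_fourier_mul_schwartz (hf.toLp f) φ2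
  have e1 : ∫ ξ, hatL2 f ξ * φ ξ = (2 * Real.pi : ℂ) ^ 3 *
      ∫ η, (𝓕 (hf.toLp f) : Lp (α := E3) ℂ 2 volume) η * φ2 η := by
    rw [← integral_comp_two_pi_inv_smul, hatL2_eq hf]
    refine integral_congr_ae (Eventually.of_forall fun ξ => ?_)
    simp only [hφ2]
    rw [smul_smul, mul_inv_cancel₀ (by positivity), one_smul]
  rw [e1, h3, ← integral_const_mul]
  refine integral_congr_ae ?_
  filter_upwards [hf.coeFn_toLp] with x hx
  rw [hx, hF, inv_pow]
  have : (2 * Real.pi : ℂ) ^ 3 ≠ 0 := by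
    exact_mod_cast (by positivity : (2 * Real.pi) ^ 3 ≠ 0)
  field_simp

lemma continuous_hat {f : E3 → ℂ} (hf : Integrable f volume) : Continuous (hat f) := by
  have : hat f = fun ξ => 𝓕 f ((2 * Real.pi)⁻¹ • ξ) := by ext ξ; exact hat_eq_fourier f ξ
  rw [this]
  exact (VectorFourier.fourierIntegral_continuous Real.continuous_fourierChar
    (by exact continuous_inner) hf).comp (continuous_const_smul _)

lemma norm_hat_le (f : E3 → ℂ) (ξ : E3) : ‖hat f ξ‖ ≤ ∫ x, ‖f x‖ := by
  refine (norm_integral_le_integral_norm _).trans (le_of_eq ?_)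
  refine integral_congr_ae (Eventually.of_forall fun x => ?_)
  have : -Complex.I * (⟪ξ, x⟫ : ℝ) = ((-⟪ξ, x⟫ : ℝ) : ℂ) * Complex.I := by push_cast; ring
  simp only [norm_mul, this, Complex.norm_exp_ofReal_mul_I, one_mul]

lemma integral_hat_mul {f g : E3 → ℂ} (hf : Integrable f volume) (hg : Integrable g volume) :
    ∫ ξ, hat f ξ * g ξ = ∫ x, f x * hat g x := by
  have hint : Integrable (Function.uncurry fun ξ x : E3 =>
      Complex.exp (-Complex.I * (⟪ξ, x⟫ : ℝ)) * f x * g ξ) (volume.prod volume) := by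
    refine (hg.mul_prod hf).mono ?_ (Eventually.of_forall fun p => ?_)
    · refine AEStronglyMeasurable.mul (AEStronglyMeasurable.mul ?_ hf.1.comp_snd) hg.1.comp_fst
      exact (by fun_prop : Continuous fun p : E3 × E3 =>
        Complex.exp (-Complex.I * (⟪p.1, p.2⟫ : ℝ))).aestronglyMeasurable
    · have : -Complex.I * (⟪p.1, p.2⟫ : ℝ) = ((-⟪p.1, p.2⟫ : ℝ) : ℂ) * Complex.I := by
        push_cast; ring
      simp only [Function.uncurry, norm_mul, this, Complex.norm_exp_ofReal_mul_I, one_mul]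
      rw [mul_comm]
  have h := integral_integral_swap hint
  simp only [hat, ← integral_mul_const, ← integral_const_mul]
  rw [h]
  refine integral_congr_ae (Eventually.of_forall fun x => ?_)
  refine integral_congr_ae (Eventually.of_forall fun ξ => ?_)
  simp only [real_inner_comm ξ x]
  ring

/-- On `L¹ ∩ L²` the Plancherel transform is given by the Fourier integral. -/
lemma hatL2_eq_hat {f : E3 → ℂ} (hf : MemLp f 2 volume) (hf1 : Integrable f volume) :
    hatL2 f =ᵐ[volume] hat f := by
  refine ae_eq_of_forall_schwartz ((memLp_hatL2 f).locallyIntegrable (by norm_num))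
    (continuous_hat hf1).locallyIntegrable fun φ => ?_
  rw [integral_hatL2_mul_schwartz hf, integral_hat_mul hf1 φ.integrable]

/-- The Fourier transform is symmetric for the bilinear pairing. -/
lemma integral_hatL2_mul {f g : E3 → ℂ} (hf : MemLp f 2 volume) (hg : MemLp g 2 volume) :
    ∫ ξ, hatL2 f ξ * g ξ = ∫ x, f x * hatL2 g x := by
  have hfs : MemLp (fun x => f ((2 * Real.pi) • x)) 2 volume := memLp_comp_smul hf (by positivity)
  have h1 := continuous_integral_mul_Lp (memLp_hatL2 f)
  have h2 := ((continuous_integral_mul_Lp hfs).comp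
    (Lp.fourierTransformₗᵢ E3 ℂ).continuous).const_mul ((2 * Real.pi : ℂ) ^ 3)
  have e : ∀ u : Lp (α := E3) ℂ 2 volume, ∫ x, f x * hatL2 u x = (2 * Real.pi : ℂ) ^ 3 *
      ∫ x, f ((2 * Real.pi) • x) * (𝓕 u : Lp (α := E3) ℂ 2 volume) x := by
    intro u
    rw [← integral_comp_two_pi_inv_smul, hatL2_eq (Lp.memLp u), Lp.toLp_coeFn]
    refine integral_congr_ae (Eventually.of_forall fun ξ => ?_)
    simp only
    rw [smul_smul, mul_inv_cancel₀ (by positivity), one_smul]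
  have key : ∀ u : Lp (α := E3) ℂ 2 volume, ∫ ξ, hatL2 f ξ * u ξ = ∫ x, f x * hatL2 u x := by
    intro u
    rw [e]
    -- Both sides are continuous in `u` for the `L²` norm; on the right this is seen after the
    -- dilation that replaces `hatL2` by the isometry `𝓕`. Schwartz functions are dense.
    refine DenseRange.induction_on (p := fun u : Lp (α := E3) ℂ 2 volume =>
      ∫ ξ, hatL2 f ξ * u ξ = (2 * Real.pi : ℂ) ^ 3 *
        ∫ x, f ((2 * Real.pi) • x) * (𝓕 u : Lp (α := E3) ℂ 2 volume) x)
      (SchwartzMap.denseRange_toLpCLM (p := 2) (F := ℂ) ENNReal.ofNat_ne_top) u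
      (isClosed_eq h1 h2) fun φ => ?_
    rw [← e, SchwartzMap.toLpCLM_apply]
    have a1 : hatL2 (φ.toLp 2) =ᵐ[volume] hat φ := by
      rw [← hatL2_congr (φ.memLp 2) (φ.coeFn_toLp 2).symm]
      exact hatL2_eq_hat (φ.memLp 2) φ.integrable
    have a2 : ∫ x, f x * hatL2 (φ.toLp 2) x = ∫ x, f x * hat φ x :=
      integral_congr_ae (a1.mono fun x hx => by simp only [hx])
    rw [a2, ← integral_hatL2_mul_schwartz hf]
    refine integral_congr_ae ?_
    filter_upwards [φ.coeFn_toLp 2] with x hx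
    rw [hx]
  have := key (hg.toLp g)
  rw [← hatL2_congr hg hg.coeFn_toLp.symm] at this
  rw [← this]
  refine integral_congr_ae ?_
  filter_upwards [hg.coeFn_toLp] with x hx
  rw [hx]

lemma integral_hatL2_mul_integrable {f g : E3 → ℂ} (hf : MemLp f 2 volume)
    (hg : MemLp g 2 volume) (hg1 : Integrable g volume) :
    ∫ ξ, hatL2 f ξ * g ξ = ∫ x, f x * hat g x := by
  rw [integral_hatL2_mul hf hg]
  refine integral_congr_ae ?_
  filter_upwards [hatL2_eq_hat hg hg1] with x hx
  rw [hx]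

lemma norm_exp_neg_I_mul (t : ℝ) : ‖Complex.exp (-Complex.I * (t : ℂ))‖ = 1 := by
  have : -Complex.I * (t : ℂ) = ((-t : ℝ) : ℂ) * Complex.I := by push_cast; ring
  rw [this, Complex.norm_exp_ofReal_mul_I]

lemma norm_exp_I_mul (t : ℝ) : ‖Complex.exp (Complex.I * (t : ℂ))‖ = 1 := by
  rw [mul_comm, Complex.norm_exp_ofReal_mul_I]

lemma integral_comp_smul_E3 (F : E3 → ℂ) {c : ℝ} (hc : 0 < c) :
    ∫ ξ : E3, F (c • ξ) = (c : ℂ)⁻¹ ^ 3 * ∫ ξ, F ξ := by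
  rw [Measure.integral_comp_smul]
  simp only [finrank_euclideanSpace, Fintype.card_fin]
  rw [abs_of_pos (by positivity), Complex.real_smul]
  push_cast
  rw [inv_pow]

lemma integrable_comp_smul {f : E3 → ℂ} (hf : Integrable f volume) {c : ℝ} (hc : c ≠ 0) :
    Integrable (fun x => f (c • x)) volume := hf.comp_smul hc

/-- The Plancherel transform of `x ↦ f (c x + b)`. -/
lemma hatL2_comp_affine {f : E3 → ℂ} (hf : MemLp f 2 volume) {c : ℝ} (hc : 0 < c) (b : E3) :
    hatL2 (fun x => f (c • x + b)) =ᵐ[volume] fun ξ =>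
      (c : ℂ)⁻¹ ^ 3 * Complex.exp (Complex.I * (⟪b, c⁻¹ • ξ⟫ : ℝ)) * hatL2 f (c⁻¹ • ξ) := by
  have hF : MemLp (fun x => f (c • x + b)) 2 volume := memLp_comp_smul (memLp_comp_add hf b) hc.ne'
  have hcC : (c : ℂ) ≠ 0 := by exact_mod_cast hc.ne'
  have hmeas : AEStronglyMeasurable (fun ξ : E3 => Complex.exp (Complex.I * (⟪b, ξ⟫ : ℝ))) volume :=
    (by fun_prop : Continuous _).aestronglyMeasurable
  have hR1 : MemLp (fun ξ => Complex.exp (Complex.I * (⟪b, ξ⟫ : ℝ)) * hatL2 f ξ) 2 volume := by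
    refine (memLp_hatL2 f).of_le (hmeas.mul (memLp_hatL2 f).1) (Eventually.of_forall fun ξ => ?_)
    rw [norm_mul, norm_exp_I_mul, one_mul]
  have hR : MemLp (fun ξ =>
      (c : ℂ)⁻¹ ^ 3 * Complex.exp (Complex.I * (⟪b, c⁻¹ • ξ⟫ : ℝ)) * hatL2 f (c⁻¹ • ξ)) 2 volume := by
    simp_rw [mul_assoc]
    exact (memLp_comp_smul hR1 (inv_ne_zero hc.ne')).const_mul _
  refine ae_eq_of_forall_schwartz ((memLp_hatL2 _).locallyIntegrable (by norm_num))
    (hR.locallyIntegrable (by norm_num)) fun φ => ?_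
  -- `χ` is `φ` in the variable `η = ξ / c`, with the phase of the translation absorbed, so that
  -- `hat φ` becomes `hat χ` evaluated at the point `c x + b` where `f` is evaluated.
  let χ : E3 → ℂ := fun η => Complex.exp (Complex.I * (⟪b, η⟫ : ℝ)) * φ (c • η)
  have hχm : AEStronglyMeasurable χ volume := (by fun_prop : Continuous χ).aestronglyMeasurable
  have hχn : ∀ η, ‖χ η‖ = ‖φ (c • η)‖ := fun η => by simp only [χ, norm_mul, norm_exp_I_mul, one_mul]
  have hχ2 : MemLp χ 2 volume :=
    (memLp_comp_smul (φ.memLp 2) hc.ne').of_le hχm (Eventually.of_forall fun η => (hχn η).le)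
  have hχ1 : Integrable χ volume :=
    (integrable_comp_smul φ.integrable hc.ne').mono hχm (Eventually.of_forall fun η => (hχn η).le)
  have hhat : ∀ x, hat φ x = (c : ℂ) ^ 3 * hat χ (c • x + b) := by
    intro x
    have := integral_comp_smul_E3 (fun ξ => Complex.exp (-Complex.I * (⟪x, ξ⟫ : ℝ)) * φ ξ) hc
    rw [hat, hat, inv_pow] at *
    rw [eq_comm, inv_mul_eq_iff_eq_mul₀ (pow_ne_zero _ hcC)] at this
    rw [this]
    congr 1
    refine integral_congr_ae (Eventually.of_forall fun η => ?_)
    simp only [χ]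
    rw [← mul_assoc, ← Complex.exp_add]
    congr 2
    rw [inner_add_left, inner_smul_left, inner_smul_right]
    simp
    ring
  calc ∫ x, hatL2 (fun x => f (c • x + b)) x * φ x
      = ∫ x, f (c • x + b) * hat φ x := integral_hatL2_mul_schwartz hF φ
    _ = (c : ℂ) ^ 3 * ∫ x, f (c • x + b) * hat χ (c • x + b) := by
        rw [← integral_const_mul]
        refine integral_congr_ae (Eventually.of_forall fun x => ?_)
        simp only [hhat]; ring
    _ = ∫ x, f x * hat χ x := by
        rw [integral_comp_smul_E3 (fun y => f (y + b) * hat χ (y + b)) hc, ← mul_assoc, inv_pow,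
          mul_inv_cancel₀ (pow_ne_zero _ hcC), one_mul,
          integral_add_right_eq_self (fun y => f y * hat χ y) b]
    _ = ∫ ξ, hatL2 f ξ * χ ξ := (integral_hatL2_mul_integrable hf hχ2 hχ1).symm
    _ = _ := by
        have := integral_comp_smul_E3 (fun ξ => hatL2 f ξ * χ ξ) (inv_pos.2 hc)
        rw [Complex.ofReal_inv, inv_inv] at this
        have h3 := congrArg (fun z => (c : ℂ)⁻¹ ^ 3 * z) this
        rw [← mul_assoc, ← mul_pow, inv_mul_cancel₀ hcC, one_pow, one_mul] at h3
        rw [← h3, ← integral_const_mul]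
        refine integral_congr_ae (Eventually.of_forall fun ξ => ?_)
        simp only [χ, smul_smul, mul_inv_cancel₀ hc.ne', one_smul]
        ring

/-! ### The Fourier transform on Schwartz functions, inversion, and the Helmholtz equation in
frequency -/

/-- The dilation by `2π` on `ℝ³`. -/
def dilation : E3 ≃L[ℝ] E3 :=
  ContinuousLinearEquiv.smulLeft (Units.mk0 (2 * Real.pi : ℝ) (by positivity))

lemma dilation_apply (x : E3) : dilation x = (2 * Real.pi) • x := rfl

lemma dilation_symm_apply (x : E3) : dilation.symm x = (2 * Real.pi)⁻¹ • x := by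
  rw [ContinuousLinearEquiv.symm_apply_eq, dilation_apply, smul_smul,
    mul_inv_cancel₀ (by positivity), one_smul]

/-- The Fourier transform `hat` on Schwartz functions. -/
def hatS (χ : 𝓢(E3, ℂ)) : 𝓢(E3, ℂ) :=
  SchwartzMap.compCLMOfContinuousLinearEquiv ℂ dilation.symm (𝓕 χ)

/-- The inverse Fourier transform `invHat` on Schwartz functions. -/
def invHatS (φ : 𝓢(E3, ℂ)) : 𝓢(E3, ℂ) :=
  𝓕⁻ (SchwartzMap.compCLMOfContinuousLinearEquiv ℂ dilation φ)

lemma hatS_apply (χ : 𝓢(E3, ℂ)) (x : E3) : hatS χ x = hat χ x := by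
  rw [hat_eq_fourier]
  simp [hatS, dilation_symm_apply, SchwartzMap.fourier_coe]

lemma coe_hatS (χ : 𝓢(E3, ℂ)) : ⇑(hatS χ) = hat χ := funext (hatS_apply χ)

lemma hatS_invHatS (φ : 𝓢(E3, ℂ)) : hatS (invHatS φ) = φ := by
  ext x
  simp [hatS, invHatS]

lemma invHatS_hatS (χ : 𝓢(E3, ℂ)) : invHatS (hatS χ) = χ := by
  have : SchwartzMap.compCLMOfContinuousLinearEquiv ℂ dilation (hatS χ) = 𝓕 χ := by
    ext x
    simp [hatS]
  rw [invHatS, this, FourierTransform.fourierInv_fourier_eq]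

lemma invHat_eq_hat (g : E3 → ℂ) (x : E3) :
    invHat g x = (2 * Real.pi : ℂ)⁻¹ ^ 3 * hat g (-x) := by
  rw [invHat, hat]
  congr 1
  refine integral_congr_ae (Eventually.of_forall fun ξ => ?_)
  simp

lemma invHatS_apply (φ : 𝓢(E3, ℂ)) (x : E3) : invHatS φ x = invHat φ x := by
  rw [invHat_eq_hat, hat_eq_fourier, invHatS, SchwartzMap.fourierInv_coe,
    Real.fourierInv_eq_fourier_neg]
  have := fourier_comp_smul φ (c := 2 * Real.pi) (by positivity) (-x)
  push_cast at this
  exact this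

lemma coe_invHatS (χ : 𝓢(E3, ℂ)) : ⇑(invHatS χ) = invHat χ := funext (invHatS_apply χ)

lemma hat_comp_neg (φ : E3 → ℂ) (x : E3) : hat (fun y => φ (-y)) x = hat φ (-x) := by
  rw [hat, hat, ← integral_neg_eq_self]
  refine integral_congr_ae (Eventually.of_forall fun ξ => ?_)
  simp

lemma integral_invHat_mul {f g : E3 → ℂ} (hf : Integrable f volume) (hg : Integrable g volume) :
    ∫ ξ, invHat f ξ * g ξ = ∫ x, f x * invHat g x := by
  have h := integral_hat_mul hf (hg.comp_neg)
  simp only [hat_comp_neg] at h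
  rw [← integral_neg_eq_self] at h
  simp only [neg_neg] at h
  calc _ = (2 * Real.pi : ℂ)⁻¹ ^ 3 * ∫ x, hat f (-x) * g x := by
        rw [← integral_const_mul]
        exact integral_congr_ae (Eventually.of_forall fun ξ => by
          simp only [invHat_eq_hat, mul_assoc])
    _ = _ := by
        rw [h, ← integral_const_mul]
        exact integral_congr_ae (Eventually.of_forall fun ξ => by
          simp only [invHat_eq_hat]; ring)

lemma continuous_invHat {g : E3 → ℂ} (hg : Integrable g volume) : Continuous (invHat g) := by
  have : invHat g = fun x => (2 * Real.pi : ℂ)⁻¹ ^ 3 * hat g (-x) := funext (invHat_eq_hat g)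
  rw [this]
  exact continuous_const.mul ((continuous_hat hg).comp continuous_neg)

/-- Fourier inversion on `L¹ ∩ L²`. -/
lemma hatL2_invHat {g : E3 → ℂ} (hg : MemLp g 2 volume) (hg1 : Integrable g volume) :
    MemLp (invHat g) 2 volume ∧ hatL2 (invHat g) =ᵐ[volume] g := by
  obtain ⟨f, hf, hfg⟩ := exists_hatL2_eq hg
  have : f =ᵐ[volume] invHat g := by
    refine ae_eq_of_forall_schwartz (hf.locallyIntegrable (by norm_num))
      (continuous_invHat hg1).locallyIntegrable fun φ => ?_
    rw [integral_invHat_mul hg1 φ.integrable, ← coe_invHatS]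
    calc ∫ x, f x * φ x = ∫ x, f x * hat (invHatS φ) x := by rw [← coe_hatS, hatS_invHatS]
      _ = ∫ x, hatL2 f x * invHatS φ x := (integral_hatL2_mul_schwartz hf _).symm
      _ = _ := integral_congr_ae (hfg.mono fun x hx => by simp only [hx])
  exact ⟨hf.ae_eq this, by rw [← hatL2_congr hf this]; exact hfg⟩

lemma integral_mul_schwartz {f : E3 → ℂ} (hf : MemLp f 2 volume) (φ : 𝓢(E3, ℂ)) :
    ∫ x, f x * φ x = ∫ x, hatL2 f x * invHatS φ x := by
  rw [integral_hatL2_mul_schwartz hf, ← coe_hatS, hatS_invHatS]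

lemma invHatS_laplacian (φ : 𝓢(E3, ℂ)) (ξ : E3) :
    invHatS (Δ φ) ξ = -((‖ξ‖ ^ 2 : ℝ) : ℂ) * invHatS φ ξ := by
  rw [invHatS_apply, invHatS_apply, invHat_eq_hat, invHat_eq_hat, hat_eq_fourier, hat_eq_fourier,
    ← SchwartzMap.fourier_coe, ← SchwartzMap.fourier_coe,
    SchwartzMap.laplacian_eq_fourierMultiplierCLM, FourierTransform.fourier_smul,
    SchwartzMap.fourierMultiplierCLM_apply, FourierTransform.fourier_fourierInv_eq,
    _root_.smul_apply, SchwartzMap.smulLeftCLM_apply_apply (by fun_prop)]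
  simp only [smul_neg, norm_neg, norm_smul, Complex.real_smul, Real.norm_eq_abs]
  rw [abs_of_pos (by positivity)]
  push_cast
  have : (Real.pi : ℂ) ≠ 0 := by exact_mod_cast Real.pi_ne_zero
  field_simp

lemma invHatS_add (φ ψ : 𝓢(E3, ℂ)) : invHatS (φ + ψ) = invHatS φ + invHatS ψ := by
  simp [invHatS, FourierTransform.fourierInv_add]

lemma invHatS_smul (c : ℂ) (φ : 𝓢(E3, ℂ)) : invHatS (c • φ) = c • invHatS φ := by
  simp [invHatS, FourierTransform.fourierInv_smul]

/-- The weak Helmholtz equation on the Fourier side. -/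
lemma integral_helmholtz {v : E3 → ℂ} (hv : MemLp v 2 volume) (a b : ℝ) (φ : 𝓢(E3, ℂ)) :
    ∫ x, v x * (-Complex.I * a * φ x + (Δ φ) x + b * φ x) =
      ∫ ξ, (-Complex.I * a - ((‖ξ‖ ^ 2 : ℝ) : ℂ) + b) * hatL2 v ξ * invHatS φ ξ := by
  have h := integral_mul_schwartz hv ((-Complex.I * a) • φ + Δ φ + (b : ℂ) • φ)
  simp only [_root_.add_apply, _root_.smul_apply, smul_eq_mul, invHatS_add,
    invHatS_smul, invHatS_laplacian] at h
  rw [h]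
  refine integral_congr_ae (Eventually.of_forall fun ξ => ?_)
  simp only
  ring

/-- Testing with `hatS χ` for arbitrary `χ` turns the weak equation into an identity of
distributions in frequency, between locally integrable functions. -/
lemma hatL2_of_isWeakHelmholtz {v f : E3 → ℂ} (hv : MemLp v 2 volume) (hf : MemLp f 2 volume)
    {a b : ℝ} (h : IsWeakHelmholtz a b f v) :
    (fun ξ => (-Complex.I * a - ((‖ξ‖ ^ 2 : ℝ) : ℂ) + b) * hatL2 v ξ) =ᵐ[volume] hatL2 f := by
  refine ae_eq_of_forall_schwartz ?_ ((memLp_hatL2 _).locallyIntegrable (by norm_num)) fun χ => ?_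
  · exact ((memLp_hatL2 v).locallyIntegrable (by norm_num)).continuous_mul (by fun_prop)
  · have h1 := h (hatS χ)
    rw [integral_helmholtz hv, integral_mul_schwartz hf, invHatS_hatS] at h1
    exact h1

/-! ### Sesquilinear forms of Fourier multipliers -/

/-- The sesquilinear form `∫ m f̂ conj(ĝ)` of the Fourier multiplier `m`. -/
def multForm (m : E3 → ℂ) (f g : E3 → ℂ) : ℂ :=
  ∫ ξ, m ξ * (hatL2 f ξ * conj (hatL2 g ξ))

/-- A bounded measurable multiplier. -/
structure BddMult (m : E3 → ℂ) (K : ℝ) : Prop where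
  meas : Measurable m
  bound : ∀ ξ, ‖m ξ‖ ≤ K

lemma BddMult.nonneg {m : E3 → ℂ} {K : ℝ} (hm : BddMult m K) : 0 ≤ K :=
  (norm_nonneg _).trans (hm.bound 0)

lemma BddMult.memLp_mul {m : E3 → ℂ} {K : ℝ} (hm : BddMult m K) {f : E3 → ℂ}
    (hf : MemLp f 2 volume) : MemLp (fun ξ => m ξ * f ξ) 2 volume :=
  hf.of_le_mul (c := K) (hm.meas.aestronglyMeasurable.mul hf.1) (Eventually.of_forall fun ξ => by
    rw [norm_mul]; exact mul_le_mul_of_nonneg_right (hm.bound ξ) (norm_nonneg _))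

lemma BddMult.mul {m m' : E3 → ℂ} {K K' : ℝ} (hm : BddMult m K) (hm' : BddMult m' K') :
    BddMult (fun ξ => m ξ * m' ξ) (K * K') :=
  ⟨hm.meas.mul hm'.meas, fun ξ => by
    rw [norm_mul]; exact mul_le_mul (hm.bound ξ) (hm'.bound ξ) (norm_nonneg _) hm.nonneg⟩

lemma bddMult_exp (a : E3) : BddMult (fun ξ => Complex.exp (-Complex.I * (⟪a, ξ⟫ : ℝ))) 1 :=
  ⟨by fun_prop, fun ξ => (norm_exp_neg_I_mul _).le⟩

lemma integrable_hat_mul_conj (f g : E3 → ℂ) :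
    Integrable (fun ξ => hatL2 f ξ * conj (hatL2 g ξ)) volume :=
  integrable_mul_of_memLp (memLp_hatL2 f) (memLp_conj (memLp_hatL2 g))

lemma BddMult.integrable {m : E3 → ℂ} {K : ℝ} (hm : BddMult m K) (f g : E3 → ℂ) :
    Integrable (fun ξ => m ξ * (hatL2 f ξ * conj (hatL2 g ξ))) volume :=
  (integrable_hat_mul_conj f g).bdd_mul hm.meas.aestronglyMeasurable
    (Eventually.of_forall hm.bound)

lemma nrm_hatL2_mul {f g : E3 → ℂ} (hf : MemLp f 2 volume) (hg : MemLp g 2 volume) :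
    nrm (hatL2 f) * nrm (hatL2 g) = (2 * Real.pi) ^ 3 * (nrm f * nrm g) := by
  have h1 := nrm_sq_hatL2 hf
  have h2 := nrm_sq_hatL2 hg
  have hp : (0 : ℝ) ≤ (2 * Real.pi) ^ 3 := by positivity
  rw [← pow_left_inj₀ (mul_nonneg (nrm_nonneg _) (nrm_nonneg _))
    (mul_nonneg hp (mul_nonneg (nrm_nonneg _) (nrm_nonneg _))) two_ne_zero, mul_pow, h1, h2]
  ring

lemma integral_norm_hat_mul_le {f g : E3 → ℂ} (hf : MemLp f 2 volume) (hg : MemLp g 2 volume) :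
    ∫ ξ, ‖hatL2 f ξ * conj (hatL2 g ξ)‖ ≤ (2 * Real.pi) ^ 3 * (nrm f * nrm g) := by
  rw [← nrm_hatL2_mul hf hg, ← nrm_conj (hatL2 g)]
  exact integral_norm_mul_le (memLp_hatL2 f) (memLp_conj (memLp_hatL2 g))

lemma norm_multForm_le {m : E3 → ℂ} {K : ℝ} (hm : BddMult m K) {f g : E3 → ℂ}
    (hf : MemLp f 2 volume) (hg : MemLp g 2 volume) :
    ‖multForm m f g‖ ≤ K * ((2 * Real.pi) ^ 3 * (nrm f * nrm g)) := by
  refine (norm_integral_le_integral_norm _).trans ?_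
  refine le_trans ?_ (mul_le_mul_of_nonneg_left (integral_norm_hat_mul_le hf hg) hm.nonneg)
  rw [← integral_const_mul]
  refine integral_mono (hm.integrable f g).norm ((integrable_hat_mul_conj f g).norm.const_mul _)
    fun ξ => ?_
  simp only
  rw [norm_mul (m ξ)]
  exact mul_le_mul_of_nonneg_right (hm.bound ξ) (norm_nonneg _)

lemma multForm_add_left {m : E3 → ℂ} {K : ℝ} (hm : BddMult m K) {f₁ f₂ : E3 → ℂ}
    (h₁ : MemLp f₁ 2 volume) (h₂ : MemLp f₂ 2 volume) (g : E3 → ℂ) :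
    multForm m (fun x => f₁ x + f₂ x) g = multForm m f₁ g + multForm m f₂ g := by
  rw [multForm, multForm, multForm, ← integral_add (hm.integrable _ _) (hm.integrable _ _)]
  refine integral_congr_ae ?_
  filter_upwards [hatL2_add h₁ h₂] with ξ hξ
  rw [hξ]; ring

lemma multForm_add_right {m : E3 → ℂ} {K : ℝ} (hm : BddMult m K) (f : E3 → ℂ) {g₁ g₂ : E3 → ℂ}
    (h₁ : MemLp g₁ 2 volume) (h₂ : MemLp g₂ 2 volume) :
    multForm m f (fun x => g₁ x + g₂ x) = multForm m f g₁ + multForm m f g₂ := by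
  rw [multForm, multForm, multForm, ← integral_add (hm.integrable _ _) (hm.integrable _ _)]
  refine integral_congr_ae ?_
  filter_upwards [hatL2_add h₁ h₂] with ξ hξ
  rw [hξ, map_add]; ring

lemma hatL2_zero : hatL2 (fun _ => 0) =ᵐ[volume] fun _ => 0 := by
  have h := hatL2_const_mul (f := fun _ => 0) 0 MemLp.zero'
  simpa using h

lemma memLp_finset_sum {ι : Type*} (F : Finset ι) {f : ι → E3 → ℂ}
    (hf : ∀ i, MemLp (f i) 2 volume) : MemLp (fun x => ∑ i ∈ F, f i x) 2 volume :=
  memLp_finsetSum F fun i _ => hf i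

lemma multForm_sum_left {ι : Type*} {m : E3 → ℂ} {K : ℝ} (hm : BddMult m K) (F : Finset ι)
    {f : ι → E3 → ℂ} (hf : ∀ i, MemLp (f i) 2 volume) (g : E3 → ℂ) :
    multForm m (fun x => ∑ i ∈ F, f i x) g = ∑ i ∈ F, multForm m (f i) g := by
  classical
  induction F using Finset.induction_on with
  | empty =>
    simp only [Finset.sum_empty]
    refine integral_eq_zero_of_ae ?_
    filter_upwards [hatL2_zero] with ξ hξ
    rw [hξ]; simp
  | insert i F hi ih =>
    simp only [Finset.sum_insert hi]
    rw [multForm_add_left hm (hf i) (memLp_finset_sum F hf), ih]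

lemma multForm_sum_right {ι : Type*} {m : E3 → ℂ} {K : ℝ} (hm : BddMult m K) (F : Finset ι)
    (f : E3 → ℂ) {g : ι → E3 → ℂ} (hg : ∀ i, MemLp (g i) 2 volume) :
    multForm m f (fun x => ∑ i ∈ F, g i x) = ∑ i ∈ F, multForm m f (g i) := by
  classical
  induction F using Finset.induction_on with
  | empty =>
    simp only [Finset.sum_empty]
    refine integral_eq_zero_of_ae ?_
    filter_upwards [hatL2_zero] with ξ hξ
    rw [hξ]; simp
  | insert i F hi ih =>
    simp only [Finset.sum_insert hi]
    rw [multForm_add_right hm f (hg i) (memLp_finset_sum F hg), ih]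

/-! ### Truncation -/

lemma tendsto_nrm_of_dominated {ι : Type*} {l : Filter ι} [l.IsCountablyGenerated]
    {F : ι → E3 → ℂ} {G : E3 → ℂ} (hF : ∀ᶠ i in l, AEStronglyMeasurable (F i) volume)
    (hG : MemLp G 2 volume) (hb : ∀ᶠ i in l, ∀ᵐ x, ‖F i x‖ ≤ ‖G x‖)
    (ht : ∀ᵐ x, Tendsto (fun i => F i x) l (𝓝 0)) :
    Tendsto (fun i => nrm (F i)) l (𝓝 0) := by
  have e : ∀ f : E3 → ℂ, eLpNorm f 2 volume = (∫⁻ x, ‖f x‖ₑ ^ 2) ^ (1 / 2 : ℝ) := by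
    intro f
    rw [eLpNorm_eq_lintegral_rpow_enorm_toReal (by norm_num) (by norm_num)]
    simp
  have hG2 : ∫⁻ x, ‖G x‖ₑ ^ 2 ≠ ∞ := by
    have := (hG.2)
    rw [e] at this
    intro h
    rw [h] at this
    simp at this
  have h1 : Tendsto (fun i => ∫⁻ x, ‖F i x‖ₑ ^ 2) l (𝓝 (∫⁻ _ : E3, 0)) := by
    refine tendsto_lintegral_filter_of_dominated_convergence' (fun x => ‖G x‖ₑ ^ 2) ?_ ?_ hG2 ?_
    · filter_upwards [hF] with i hi using hi.enorm.pow_const 2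
    · filter_upwards [hb] with i hi
      filter_upwards [hi] with x hx
      gcongr
      exact enorm_le_iff_norm_le.2 hx
    · filter_upwards [ht] with x hx
      have := ENNReal.Tendsto.pow (n := 2) ((continuous_enorm.tendsto _).comp hx)
      simpa using this
  rw [lintegral_zero] at h1
  have h2 := h1.ennrpow_const (1 / 2 : ℝ)
  simp only [one_div] at h2
  have h3 : Tendsto (fun i => eLpNorm (F i) 2 volume) l (𝓝 0) := by
    simp only [e, one_div]
    simpa using h2
  have h4 := (ENNReal.tendsto_toReal ENNReal.zero_ne_top).comp h3
  simpa [nrm, Function.comp_def] using h4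

lemma tendsto_nrm_sub_indicator {f : E3 → ℂ} (hf : MemLp f 2 volume) {A : ℕ → Set E3}
    (hA : ∀ n, MeasurableSet (A n)) (h : ∀ x, ∀ᶠ n in atTop, x ∈ A n) :
    Tendsto (fun n => nrm ((A n)ᶜ.indicator f)) atTop (𝓝 0) := by
  refine tendsto_nrm_of_dominated (G := f)
    (Eventually.of_forall fun n => (hf.indicator (hA n).compl).1) hf
    (Eventually.of_forall fun n => Eventually.of_forall fun x => norm_indicator_le_norm_self _ _)
    (Eventually.of_forall fun x => ?_)
  refine tendsto_const_nhds.congr' ?_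
  filter_upwards [h x] with n hn
  simp [hn]

/-! ### Locality of multipliers in the variables orthogonal to a direction -/

/-- The projection along `e`. -/
def proj (e ξ : E3) : E3 := ξ - ⟪e, ξ⟫ • e

lemma continuous_proj (e : E3) : Continuous (proj e) := by unfold proj; fun_prop

lemma inner_proj (e x y : E3) : ⟪proj e x, y⟫ = ⟪x, proj e y⟫ := by
  simp only [proj, inner_sub_left, inner_sub_right, inner_smul_left, inner_smul_right,
    real_inner_comm e]
  simp only [conj_trivial, real_inner_comm x e]
  ring

lemma inner_self_proj {e : E3} (he : ‖e‖ = 1) (y : E3) : ⟪e, proj e y⟫ = 0 := by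
  simp [proj, inner_sub_right, inner_smul_right, he]

lemma norm_sq_proj {e : E3} (he : ‖e‖ = 1) (ξ : E3) : ‖proj e ξ‖ ^ 2 = ‖ξ‖ ^ 2 - ⟪e, ξ⟫ ^ 2 := by
  rw [proj, norm_sub_sq_real, norm_smul, inner_smul_right, he, real_inner_comm e ξ,
    Real.norm_eq_abs, mul_one, sq_abs]
  rw [real_inner_comm]
  ring

/-- The positive and negative parts of `h` are densities of finite measures. By `h0` their images
under `P` have the same characteristic function, hence coincide, and then all bounded measurable
functions have equal integrals against them. -/
lemma integral_comp_mul_eq_zero_real {P : E3 → E3} (hP : Continuous P) {h : E3 → ℝ}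
    (hh : Integrable h volume)
    (h0 : ∀ t, ∫ ξ, Complex.exp (Complex.I * (⟪P ξ, t⟫ : ℝ)) * (h ξ : ℂ) = 0)
    {m : E3 → ℂ} {K : ℝ} (hm : BddMult m K) : ∫ ξ, m (P ξ) * (h ξ : ℂ) = 0 := by
  let ν : (E3 → ℝ) → Measure E3 := fun k =>
    (volume.withDensity fun ξ => ENNReal.ofReal (k ξ)).map P
  have hfin : ∀ k : E3 → ℝ, Integrable k volume → IsFiniteMeasure (ν k) := by
    intro k hk
    have := isFiniteMeasure_withDensity_ofReal hk.2
    infer_instance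
  have hint : ∀ k : E3 → ℝ, Integrable k volume → ∀ {q : E3 → ℂ}, Measurable q →
      ∫ x, q x ∂(ν k) = ∫ ξ, q (P ξ) * ((max (k ξ) 0 : ℝ) : ℂ) := by
    intro k hk q hq
    rw [integral_map hP.aemeasurable hq.aestronglyMeasurable,
      integral_withDensity_eq_integral_toReal_smul₀ hk.1.aemeasurable.ennreal_ofReal
        (Eventually.of_forall fun x => ENNReal.ofReal_lt_top)]
    refine integral_congr_ae (Eventually.of_forall fun ξ => ?_)
    simp only [Complex.real_smul, ENNReal.toReal_ofReal']
    rw [mul_comm]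
  have hbd : ∀ (q : E3 → ℂ) (C : ℝ), BddMult q C → ∀ k : E3 → ℝ, Integrable k volume →
      Integrable (fun ξ => q (P ξ) * ((max (k ξ) 0 : ℝ) : ℂ)) volume := by
    intro q C hq k hk
    exact (hk.pos_part.ofReal (𝕜 := ℂ)).bdd_mul (hq.meas.comp hP.measurable).aestronglyMeasurable
      (Eventually.of_forall fun ξ => hq.bound _)
  have hsub : ∀ (q : E3 → ℂ) (C : ℝ), BddMult q C → ∫ x, q x ∂(ν h) - ∫ x, q x ∂(ν (-h)) =
      ∫ ξ, q (P ξ) * (h ξ : ℂ) := by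
    intro q C hq
    rw [hint h hh hq.meas, hint (-h) hh.neg hq.meas, ← integral_sub (hbd q C hq h hh)
      (hbd q C hq _ hh.neg)]
    refine integral_congr_ae (Eventually.of_forall fun ξ => ?_)
    simp only [Pi.neg_apply]
    rw [← mul_sub, ← Complex.ofReal_sub]
    congr 2
    rcases le_total 0 (h ξ) with h1 | h1
    · rw [max_eq_left h1, max_eq_right (by linarith), sub_zero]
    · rw [max_eq_right h1, max_eq_left (by linarith), zero_sub, neg_neg]
  have := hfin h hh
  have := hfin (-h) hh.neg
  have heq : ν h = ν (-h) := by
    refine Measure.ext_of_charFun (funext fun t => ?_)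
    rw [charFun_apply, charFun_apply, ← sub_eq_zero]
    have hb : BddMult (fun x : E3 => Complex.exp ((⟪x, t⟫ : ℝ) * Complex.I)) 1 :=
      ⟨by fun_prop, fun ξ => (Complex.norm_exp_ofReal_mul_I _).le⟩
    rw [hsub _ 1 hb, ← h0 t]
    simp only [mul_comm]
  rw [← hsub m K hm, heq, sub_self]

/-- Conjugating the hypothesis at `-t` gives it for `conj H` at `t`, hence for the real and
imaginary parts of `H`, to which the real case applies. -/
lemma integral_comp_mul_eq_zero {P : E3 → E3} (hP : Continuous P) {H : E3 → ℂ}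
    (hH : Integrable H volume)
    (h0 : ∀ t, ∫ ξ, Complex.exp (Complex.I * (⟪P ξ, t⟫ : ℝ)) * H ξ = 0)
    {m : E3 → ℂ} {K : ℝ} (hm : BddMult m K) : ∫ ξ, m (P ξ) * H ξ = 0 := by
  have hb : ∀ (q : E3 → ℂ) (C : ℝ), BddMult q C → ∀ H : E3 → ℂ, Integrable H volume →
      Integrable (fun ξ => q (P ξ) * H ξ) volume := fun q C hq H hH =>
    hH.bdd_mul (hq.meas.comp hP.measurable).aestronglyMeasurable
      (Eventually.of_forall fun ξ => hq.bound _)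
  have he : ∀ t : E3, BddMult (fun x : E3 => Complex.exp (Complex.I * (⟪x, t⟫ : ℝ))) 1 := fun t =>
    ⟨by fun_prop, fun ξ => (norm_exp_I_mul _).le⟩
  have h1 : ∀ t, ∫ ξ, Complex.exp (Complex.I * (⟪P ξ, t⟫ : ℝ)) * conj (H ξ) = 0 := by
    intro t
    have := congrArg conj (h0 (-t))
    rw [← integral_conj, map_zero] at this
    rw [← this]
    refine integral_congr_ae (Eventually.of_forall fun ξ => ?_)
    simp [← Complex.exp_conj]
  have hHc : Integrable (fun ξ => conj (H ξ)) volume :=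
    (LinearIsometryEquiv.integrable_comp_iff Complex.conjLIE).2 hH
  have hre : ∫ ξ, m (P ξ) * ((H ξ).re : ℂ) = 0 := by
    refine integral_comp_mul_eq_zero_real hP hH.re (fun t => ?_) hm
    have e : ∀ ξ, Complex.exp (Complex.I * (⟪P ξ, t⟫ : ℝ)) * ((RCLike.re (H ξ) : ℝ) : ℂ) =
        2⁻¹ * (Complex.exp (Complex.I * (⟪P ξ, t⟫ : ℝ)) * H ξ +
          Complex.exp (Complex.I * (⟪P ξ, t⟫ : ℝ)) * conj (H ξ)) := by
      intro ξ
      rw [← mul_add, Complex.add_conj]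
      simp; ring
    simp_rw [e]
    rw [integral_const_mul, integral_add (hb _ 1 (he t) _ hH) (hb _ 1 (he t) _ hHc), h0, h1]
    simp
  have him : ∫ ξ, m (P ξ) * ((H ξ).im : ℂ) = 0 := by
    refine integral_comp_mul_eq_zero_real hP hH.im (fun t => ?_) hm
    have e : ∀ ξ, Complex.exp (Complex.I * (⟪P ξ, t⟫ : ℝ)) * ((RCLike.im (H ξ) : ℝ) : ℂ) =
        (2 * Complex.I)⁻¹ * (Complex.exp (Complex.I * (⟪P ξ, t⟫ : ℝ)) * H ξ -
          Complex.exp (Complex.I * (⟪P ξ, t⟫ : ℝ)) * conj (H ξ)) := by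
      intro ξ
      rw [← mul_sub, Complex.sub_conj]
      have := Complex.I_ne_zero
      simp only [RCLike.im_to_complex]
      push_cast
      field_simp
    simp_rw [e]
    rw [integral_const_mul, integral_sub (hb _ 1 (he t) _ hH) (hb _ 1 (he t) _ hHc), h0, h1]
    simp
  have e : ∀ ξ, m (P ξ) * H ξ = m (P ξ) * ((H ξ).re : ℂ) + Complex.I * (m (P ξ) * ((H ξ).im : ℂ)) := by
    intro ξ
    conv_lhs => rw [← Complex.re_add_im (H ξ)]
    ring
  simp_rw [e]
  have i1 : Integrable (fun ξ => ((H ξ).re : ℂ)) volume := hH.re.ofReal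
  have i2 : Integrable (fun ξ => ((H ξ).im : ℂ)) volume := hH.im.ofReal
  rw [integral_add (hb m K hm _ i1) ((hb m K hm _ i2).const_mul _),
    integral_const_mul, hre, him]
  simp

/-- A multiplier in the variables orthogonal to `e` does not move supports in the direction `e`. -/
lemma integral_proj_mult_eq_zero {f g : E3 → ℂ} (hf : MemLp f 2 volume) (hg : MemLp g 2 volume)
    {e b : E3} (hsupp : ∀ t x, f (x + (b + proj e t)) * conj (g x) = 0)
    {m : E3 → ℂ} {K : ℝ} (hm : BddMult m K) :
    ∫ ξ, m (proj e ξ) * (Complex.exp (Complex.I * (⟪b, ξ⟫ : ℝ)) *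
      (hatL2 f ξ * conj (hatL2 g ξ))) = 0 := by
  refine integral_comp_mul_eq_zero (continuous_proj e) ?_ (fun t => ?_) hm
  · exact (integrable_hat_mul_conj f g).bdd_mul
      (by fun_prop : Continuous _).aestronglyMeasurable
      (Eventually.of_forall fun ξ => (norm_exp_I_mul _).le)
  -- For the exponentials `e^{i⟪proj e ξ, t⟫}`, the integral is by Parseval the pairing of `g` with
  -- the translate of `f` by `b + proj e t`, and this product vanishes by `hsupp`.
  · have h := hatL2_comp_affine hf one_pos (b + proj e t)
    have h2 := integral_hatL2_mul_conj (f := fun x => f ((1 : ℝ) • x + (b + proj e t)))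
      (memLp_comp_smul (memLp_comp_add hf _) one_ne_zero) hg
    simp only [one_smul] at h2
    simp only [hsupp, integral_zero, mul_zero] at h2
    rw [← h2]
    refine integral_congr_ae ?_
    filter_upwards [h] with ξ hξ
    simp only [one_smul, inv_one, Complex.ofReal_one, one_pow, one_mul] at hξ
    rw [hξ, inner_proj, inner_add_left, real_inner_comm ξ (proj e t)]
    push_cast
    rw [mul_add, Complex.exp_add]
    ring

/-! ### The one-dimensional resolvent kernel -/

lemma norm_exp_neg_mul_abs (s : ℂ) (t : ℝ) :
    ‖Complex.exp (-s * (|t| : ℝ))‖ = Real.exp (-s.re * |t|) := by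
  rw [Complex.norm_exp]; simp

lemma integrable_exp_neg_mul_abs {c : ℝ} (hc : 0 < c) :
    Integrable (fun t : ℝ => Real.exp (-c * |t|)) volume := by
  rw [← integrableOn_univ, ← Set.Iic_union_Ioi (a := (0 : ℝ))]
  refine IntegrableOn.union ?_ ?_
  · refine (integrableOn_exp_mul_Iic hc 0).congr_fun (fun t ht => ?_) measurableSet_Iic
    simp only
    rw [abs_of_nonpos ht]; ring_nf
  · refine (integrableOn_exp_mul_Ioi (neg_neg_of_pos hc) 0).congr_fun (fun t ht => ?_)
      measurableSet_Ioi
    simp only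
    rw [abs_of_pos ht]

lemma integral_exp_neg_mul_abs {s : ℂ} (hs : 0 < s.re) (τ : ℝ) :
    ∫ t : ℝ, Complex.exp (-s * (|t| : ℝ)) * Complex.exp (-Complex.I * ((t * τ : ℝ) : ℂ)) =
      2 * s / (s ^ 2 + τ ^ 2) := by
  have h1 : (-(s + Complex.I * τ)).re < 0 := by simp [hs]
  have h2 : 0 < (s - Complex.I * τ).re := by simp [hs]
  have e1 : Set.EqOn (fun t : ℝ => Complex.exp (-s * (|t| : ℝ)) *
      Complex.exp (-Complex.I * ((t * τ : ℝ) : ℂ)))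
      (fun t : ℝ => Complex.exp (-(s + Complex.I * τ) * t)) (Set.Ioi 0) := by
    intro t ht
    simp only
    rw [abs_of_pos ht, ← Complex.exp_add]
    congr 1; push_cast; ring
  have e2 : Set.EqOn (fun t : ℝ => Complex.exp (-s * (|t| : ℝ)) *
      Complex.exp (-Complex.I * ((t * τ : ℝ) : ℂ)))
      (fun t : ℝ => Complex.exp ((s - Complex.I * τ) * t)) (Set.Iic 0) := by
    intro t ht
    simp only
    rw [abs_of_nonpos ht, ← Complex.exp_add]
    congr 1; push_cast; ring
  rw [← intervalIntegral.integral_Iic_add_Ioi (b := 0)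
    ((integrableOn_exp_mul_complex_Iic h2 0).congr_fun e2.symm measurableSet_Iic)
    ((integrableOn_exp_mul_complex_Ioi h1 0).congr_fun e1.symm measurableSet_Ioi),
    setIntegral_congr_fun measurableSet_Iic e2, setIntegral_congr_fun measurableSet_Ioi e1,
    integral_exp_mul_complex_Iic h2, integral_exp_mul_complex_Ioi h1]
  have n1 : s + Complex.I * τ ≠ 0 := fun h => by rw [h] at h1; simp at h1
  have n2 : s - Complex.I * τ ≠ 0 := fun h => by rw [h] at h2; simp at h2
  have n3 : s ^ 2 + (τ : ℂ) ^ 2 = (s + Complex.I * τ) * (s - Complex.I * τ) := by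
    ring_nf; rw [Complex.I_sq]; ring
  rw [n3]
  simp only [Complex.ofReal_zero, mul_zero, Complex.exp_zero]
  field_simp
  ring

/-- The square root with nonnegative real part of `r - 1 + i δ`. -/
def sroot (δ r : ℝ) : ℂ := (((r - 1 : ℝ) : ℂ) + Complex.I * δ) ^ (1 / 2 : ℂ)

lemma sroot_sq (δ r : ℝ) : sroot δ r ^ 2 = ((r - 1 : ℝ) : ℂ) + Complex.I * δ := by
  rw [sroot, ← Complex.cpow_nat_mul]
  norm_num

lemma sroot_re_nonneg (δ r : ℝ) : 0 ≤ (sroot δ r).re := by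
  unfold sroot
  set z := ((r - 1 : ℝ) : ℂ) + Complex.I * δ
  by_cases hz : z = 0
  · rw [hz]; simp
  · rw [Complex.cpow_def_of_ne_zero hz, Complex.exp_re]
    refine mul_nonneg (Real.exp_pos _).le (Real.cos_nonneg_of_mem_Icc ?_)
    have h1 := Complex.neg_pi_lt_arg z
    have h2 := Complex.arg_le_pi z
    have : (Complex.log z * (1 / 2)).im = z.arg / 2 := by
      rw [show (1 / 2 : ℂ) = ((1 / 2 : ℝ) : ℂ) by push_cast; rfl, Complex.im_mul_ofReal,
        Complex.log_im]
      ring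
    rw [this]
    constructor <;> linarith

/-- The square of the left side is at most `√(1 + δ²)`, which is at least `1` and so at most its own
square. Only boundedness as `δ → 0` matters. -/
lemma norm_sroot_le {δ r : ℝ} (hr0 : 0 ≤ r) (hr1 : r ≤ 1) :
    ‖sroot δ r‖ ≤ Real.sqrt (1 + δ ^ 2) := by
  have h1 : ‖sroot δ r‖ ^ 2 ≤ Real.sqrt (1 + δ ^ 2) := by
    rw [← norm_pow, sroot_sq, mul_comm, Complex.norm_add_mul_I]
    refine Real.sqrt_le_sqrt ?_
    nlinarith
  have h2 : 1 ≤ Real.sqrt (1 + δ ^ 2) := by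
    rw [Real.one_le_sqrt]; nlinarith
  have h3 := norm_nonneg (sroot δ r)
  nlinarith

/-- From `δ = Im (s²) = 2 Re s · Im s`, an upper bound of `|Im s|` is a lower bound of `Re s`. This
rate degenerates as `δ → 0`; it only makes the kernel integrable in `t` and does not enter the final
constants. -/
lemma sroot_re_ge {δ r : ℝ} (hδ : 0 < δ) (hr0 : 0 ≤ r) (hr1 : r ≤ 1) :
    δ / (2 * Real.sqrt (1 + δ ^ 2)) ≤ (sroot δ r).re := by
  have h1 := sroot_re_nonneg δ r
  have h2 := (Complex.abs_im_le_norm (sroot δ r)).trans (norm_sroot_le hr0 hr1)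
  have h3 : (sroot δ r ^ 2).im = δ := by rw [sroot_sq]; simp
  rw [sq, Complex.mul_im] at h3
  have h4 : 0 < Real.sqrt (1 + δ ^ 2) := by positivity
  rw [div_le_iff₀ (by positivity)]
  have h5 := le_abs_self (sroot δ r).im
  nlinarith

lemma measurable_sroot (δ : ℝ) : Measurable (sroot δ) := by
  unfold sroot
  fun_prop

/-- The kernel of the resolvent in the direction `e`, localized to frequencies with `|η| < 1`. -/
def resKernel (δ t : ℝ) (η : E3) : ℂ :=
  if ‖η‖ < 1 then sroot δ (‖η‖ ^ 2) / 2 * Complex.exp (-sroot δ (‖η‖ ^ 2) * (|t| : ℝ)) else 0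

lemma measurable_resKernel (δ : ℝ) : Measurable fun p : ℝ × E3 => resKernel δ p.1 p.2 := by
  have h := measurable_sroot δ
  unfold resKernel
  refine Measurable.ite (measurableSet_lt (by fun_prop) (by fun_prop)) ?_ measurable_const
  fun_prop

lemma norm_resKernel_le {δ : ℝ} (hδ : 0 < δ) (t : ℝ) (η : E3) :
    ‖resKernel δ t η‖ ≤ Real.sqrt (1 + δ ^ 2) *
      Real.exp (-(δ / (2 * Real.sqrt (1 + δ ^ 2))) * |t|) := by
  unfold resKernel
  split_ifs with h
  · have h0 : 0 ≤ ‖η‖ ^ 2 := by positivity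
    have h1 : ‖η‖ ^ 2 ≤ 1 := pow_le_one₀ (norm_nonneg _) h.le
    rw [norm_mul, norm_exp_neg_mul_abs, norm_div]
    refine mul_le_mul ?_ ?_ (Real.exp_pos _).le (by positivity)
    · refine le_trans ?_ (norm_sroot_le (δ := δ) h0 h1)
      have := norm_nonneg (sroot δ (‖η‖ ^ 2))
      simp
    · refine Real.exp_le_exp.2 (mul_le_mul_of_nonneg_right ?_ (abs_nonneg _))
      linarith [sroot_re_ge hδ h0 h1]
  · rw [norm_zero]
    exact mul_nonneg (Real.sqrt_nonneg _) (Real.exp_pos _).le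

lemma bddMult_resKernel {δ : ℝ} (hδ : 0 < δ) (t : ℝ) :
    BddMult (resKernel δ t) (Real.sqrt (1 + δ ^ 2)) := by
  have hmeas : Measurable ((fun p : ℝ × E3 => resKernel δ p.1 p.2) ∘ fun η => (t, η)) :=
    (measurable_resKernel δ).comp (by fun_prop)
  refine ⟨hmeas, fun η => (norm_resKernel_le hδ t η).trans ?_⟩
  refine mul_le_of_le_one_right (by positivity) (Real.exp_le_one_iff.2 ?_)
  have : 0 ≤ δ / (2 * Real.sqrt (1 + δ ^ 2)) * |t| := by positivity
  linarith

/-- The symbol `|ξ|² - 1 + i δ`. -/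
def symb (δ : ℝ) (ξ : E3) : ℂ := ((‖ξ‖ ^ 2 - 1 : ℝ) : ℂ) + Complex.I * δ

lemma le_norm_symb {δ : ℝ} (hδ : 0 < δ) (ξ : E3) : δ ≤ ‖symb δ ξ‖ := by
  refine le_trans (le_of_eq ?_) (Complex.abs_im_le_norm _)
  have : (symb δ ξ).im = δ := by
    rw [symb, Complex.add_im, Complex.ofReal_im]; simp
  rw [this, abs_of_pos hδ]

lemma symb_ne_zero {δ : ℝ} (hδ : 0 < δ) (ξ : E3) : symb δ ξ ≠ 0 :=
  norm_pos_iff.1 (hδ.trans_le (le_norm_symb hδ ξ))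

lemma measurable_symb (δ : ℝ) : Measurable (symb δ) := by unfold symb; fun_prop

/-- The part of the resolvent that is singular in the direction `e`. -/
def dirMult (δ : ℝ) (e ξ : E3) : ℂ :=
  if ‖proj e ξ‖ < 1 then symb δ (proj e ξ) / symb δ ξ else 0

/-- With `s² = symb δ (proj e ξ)` and `τ = ⟪e, ξ⟫`, Pythagoras gives `symb δ ξ = s² + τ²`, and
`s²/(s² + τ²)` is the transform of `(s/2) e^{-s|t|}`. The numerator `s²` of `dirMult` is what keeps
this kernel bounded: that of `1/(s² + τ²)` is `e^{-s|t|}/(2s)`, which blows up as `s → 0`. -/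
lemma dirMult_eq_integral {δ : ℝ} (hδ : 0 < δ) {e : E3} (he : ‖e‖ = 1) (ξ : E3) :
    dirMult δ e ξ =
      ∫ t : ℝ, resKernel δ t (proj e ξ) * Complex.exp (-Complex.I * ((t * ⟪e, ξ⟫ : ℝ) : ℂ)) := by
  unfold dirMult resKernel
  split_ifs with h
  · have h0 : 0 ≤ ‖proj e ξ‖ ^ 2 := by positivity
    have h1 : ‖proj e ξ‖ ^ 2 ≤ 1 := pow_le_one₀ (norm_nonneg _) h.le
    have hs : 0 < (sroot δ (‖proj e ξ‖ ^ 2)).re :=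
      lt_of_lt_of_le (by positivity) (sroot_re_ge hδ h0 h1)
    simp_rw [mul_assoc]
    rw [integral_const_mul, integral_exp_neg_mul_abs hs]
    have e1 : symb δ (proj e ξ) = sroot δ (‖proj e ξ‖ ^ 2) ^ 2 := by rw [sroot_sq, symb]
    have e2 : symb δ ξ = sroot δ (‖proj e ξ‖ ^ 2) ^ 2 + (⟪e, ξ⟫ : ℂ) ^ 2 := by
      rw [sroot_sq, symb, norm_sq_proj he]
      push_cast; ring
    rw [← e2, e1]
    ring
  · simp

lemma measurable_dirMult (δ : ℝ) (e : E3) : Measurable (dirMult δ e) := by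
  have h := measurable_symb δ
  have h2 := (continuous_proj e).measurable
  unfold dirMult
  exact Measurable.ite (measurableSet_lt (by fun_prop) (by fun_prop)) (by fun_prop) measurable_const

lemma norm_symb_proj_le {δ : ℝ} {e ξ : E3} (h : ‖proj e ξ‖ < 1) :
    ‖symb δ (proj e ξ)‖ ≤ Real.sqrt (1 + δ ^ 2) := by
  rw [symb, mul_comm, Complex.norm_add_mul_I]
  refine Real.sqrt_le_sqrt ?_
  have h0 : 0 ≤ ‖proj e ξ‖ ^ 2 := by positivity
  have h1 : ‖proj e ξ‖ ^ 2 ≤ 1 := pow_le_one₀ (norm_nonneg _) h.le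
  nlinarith

lemma bddMult_dirMult {δ : ℝ} (hδ : 0 < δ) (e : E3) :
    BddMult (dirMult δ e) (Real.sqrt (1 + δ ^ 2) / δ) := by
  refine ⟨measurable_dirMult δ e, fun ξ => ?_⟩
  unfold dirMult
  split_ifs with h
  · rw [norm_div]
    exact div_le_div₀ (by positivity) (norm_symb_proj_le h) hδ (le_norm_symb hδ ξ)
  · simp; positivity

/-- The strips orthogonal to `e`. -/
def strip (e : E3) (n : ℤ) : Set E3 := {x | ⌊⟪e, x⟫⌋ = n}

lemma measurableSet_strip (e : E3) (n : ℤ) : MeasurableSet (strip e n) := by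
  have : Measurable fun x : E3 => ⌊⟪e, x⟫⌋ := by fun_prop
  exact this (measurableSet_singleton n)

/-- The multiplier is a superposition over `t` of translations along `e` (and by `a`), each composed
with the multiplier `resKernel δ t` in the orthogonal frequencies, which cannot move a strip. Hence
only those `t` contribute that carry one strip onto the other: an interval of length `2`, on which
the kernel is at most `√(1 + δ²)`. -/
lemma norm_multForm_strip_le {δ : ℝ} (hδ : 0 < δ) {e : E3} (he : ‖e‖ = 1) (a : E3) {f g : E3 → ℂ}
    (hf : MemLp f 2 volume) (hg : MemLp g 2 volume) {m n : ℤ}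
    (hfs : ∀ x, f x ≠ 0 → x ∈ strip e m) (hgs : ∀ x, g x ≠ 0 → x ∈ strip e n) :
    ‖multForm (fun ξ => dirMult δ e ξ * Complex.exp (-Complex.I * (⟪a, ξ⟫ : ℝ))) f g‖ ≤
      2 * Real.sqrt (1 + δ ^ 2) * ((2 * Real.pi) ^ 3 * (nrm f * nrm g)) := by
  set D := Real.sqrt (1 + δ ^ 2) with hD
  have hD0 : 0 < D := by positivity
  let H : E3 → ℂ := fun ξ => hatL2 f ξ * conj (hatL2 g ξ)
  have hH : Integrable H volume := integrable_hat_mul_conj f g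
  let G : E3 → ℝ → ℂ := fun ξ t => resKernel δ t (proj e ξ) *
    (Complex.exp (Complex.I * (⟪-(t • e) - a, ξ⟫ : ℝ)) * H ξ)
  have hGeq : ∀ ξ, dirMult δ e ξ * Complex.exp (-Complex.I * (⟪a, ξ⟫ : ℝ)) * H ξ = ∫ t, G ξ t := by
    intro ξ
    rw [dirMult_eq_integral hδ he, mul_assoc, ← integral_mul_const]
    refine integral_congr_ae (Eventually.of_forall fun t => ?_)
    simp only [G]
    rw [inner_sub_left, inner_neg_left, inner_smul_left]
    simp only [conj_trivial]
    rw [mul_assoc, ← mul_assoc (Complex.exp _) (Complex.exp _), ← Complex.exp_add]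
    congr 3
    push_cast; ring
  have hGint : Integrable (Function.uncurry G) (volume.prod volume) := by
    have hb : Integrable (fun p : E3 × ℝ => H p.1 * ((D * Real.exp (-(δ / (2 * D)) * |p.2|) : ℝ) : ℂ))
        (volume.prod volume) :=
      hH.mul_prod (((integrable_exp_neg_mul_abs (by positivity)).const_mul D).ofReal)
    refine hb.mono ?_ (Eventually.of_forall fun p => ?_)
    · refine AEStronglyMeasurable.mul ?_ (AEStronglyMeasurable.mul ?_ hH.1.comp_fst)
      · exact ((measurable_resKernel δ).comp (measurable_snd.prodMk
          ((continuous_proj e).measurable.comp measurable_fst))).aestronglyMeasurable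
      · exact (by fun_prop : Continuous fun p : E3 × ℝ =>
          Complex.exp (Complex.I * (⟪-(p.2 • e) - a, p.1⟫ : ℝ))).aestronglyMeasurable
    · simp only [Function.uncurry, G, norm_mul, norm_exp_I_mul, one_mul]
      rw [mul_comm]
      refine mul_le_mul_of_nonneg_left ?_ (norm_nonneg _)
      have := norm_resKernel_le hδ p.2 (proj e p.1)
      refine this.trans (le_of_eq ?_)
      rw [Complex.norm_real, Real.norm_of_nonneg (by positivity)]
  have hsw : multForm (fun ξ => dirMult δ e ξ * Complex.exp (-Complex.I * (⟪a, ξ⟫ : ℝ))) f g =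
      ∫ t, ∫ ξ, G ξ t := by
    rw [← integral_integral_swap hGint]
    exact integral_congr_ae (Eventually.of_forall hGeq)
  -- If `x` is in strip `n` and `x - t e - a`, moved orthogonally to `e`, is in strip `m`, then `t`
  -- differs from `n - m - ⟪e, a⟫` by less than `1`.
  let c : ℝ := n - m - ⟪e, a⟫
  have hzero : ∀ t, t ∉ Set.Icc (c - 1) (c + 1) → ∫ ξ, G ξ t = 0 := by
    intro t ht
    refine integral_proj_mult_eq_zero hf hg (e := e) (b := -(t • e) - a) (fun v x => ?_)
      (bddMult_resKernel hδ t)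
    by_contra hne
    have h1 := hfs _ (left_ne_zero_of_mul hne)
    have h2 := hgs x (by simpa using right_ne_zero_of_mul hne)
    simp only [strip, Set.mem_ofPred_eq, Int.floor_eq_iff, inner_add_right, inner_sub_right,
      inner_neg_right, inner_smul_right, inner_self_proj he, real_inner_self_eq_norm_sq, he] at h1 h2
    refine ht ⟨?_, ?_⟩ <;> simp only [c] <;> linarith [h1.1, h1.2, h2.1, h2.2]
  have hbound : ∀ t, ‖∫ ξ, G ξ t‖ ≤ D * ((2 * Real.pi) ^ 3 * (nrm f * nrm g)) := by
    intro t
    refine (norm_integral_le_integral_norm _).trans ?_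
    refine le_trans ?_ (mul_le_mul_of_nonneg_left (integral_norm_hat_mul_le hf hg) hD0.le)
    rw [← integral_const_mul]
    refine integral_mono_of_nonneg (Eventually.of_forall fun ξ => norm_nonneg _)
      (hH.norm.const_mul _) (Eventually.of_forall fun ξ => ?_)
    simp only [G]
    rw [norm_mul, norm_mul (Complex.exp _), norm_exp_I_mul, one_mul]
    exact mul_le_mul_of_nonneg_right ((bddMult_resKernel hδ t).bound _) (norm_nonneg _)
  rw [hsw, ← setIntegral_eq_integral_of_forall_compl_eq_zero hzero]
  refine (norm_setIntegral_le_of_norm_le_const (by simp) fun t _ => hbound t).trans (le_of_eq ?_)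
  rw [Real.volume_real_Icc_of_le (by linarith)]
  ring

/-! ### The strip norm -/

/-- The `ℓ¹(L²)` norm over the strips orthogonal to `e`. -/
def stripNorm (e : E3) (f : E3 → ℂ) : ℝ≥0∞ :=
  ∑' n : ℤ, eLpNorm ((strip e n).indicator f) 2 volume

/-- The union of the strips with `-N ≤ n < N`. -/
def slab (e : E3) (N : ℕ) : Set E3 := {x | ⌊⟪e, x⟫⌋ ∈ Finset.Ico (-(N : ℤ)) N}

lemma measurableSet_slab (e : E3) (N : ℕ) : MeasurableSet (slab e N) := by
  have : Measurable fun x : E3 => ⌊⟪e, x⟫⌋ := by fun_prop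
  exact this (Finset.measurableSet _)

lemma eventually_mem_slab (e x : E3) : ∀ᶠ N : ℕ in atTop, x ∈ slab e N := by
  filter_upwards [eventually_gt_atTop (⌊⟪e, x⟫⌋.natAbs)] with N hN
  simp only [slab, Set.mem_ofPred_eq, Finset.mem_Ico]
  omega

lemma slab_indicator_eq_sum (e : E3) (N : ℕ) (f : E3 → ℂ) :
    (slab e N).indicator f =
      fun x => ∑ n ∈ Finset.Ico (-(N : ℤ)) N, (strip e n).indicator f x := by
  ext x
  have h : ∀ n, (strip e n).indicator f x = if ⌊⟪e, x⟫⌋ = n then f x else 0 := fun n => by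
    by_cases h : ⌊⟪e, x⟫⌋ = n
    · rw [Set.indicator_of_mem (show x ∈ strip e n from h), if_pos h]
    · rw [Set.indicator_of_notMem (show x ∉ strip e n from h), if_neg h]
  simp_rw [h]
  rw [Finset.sum_ite_eq]
  by_cases h : ⌊⟪e, x⟫⌋ ∈ Finset.Ico (-(N : ℤ)) N
  · rw [Set.indicator_of_mem (show x ∈ slab e N from h), if_pos h]
  · rw [Set.indicator_of_notMem (show x ∉ slab e N from h), if_neg h]

lemma sum_nrm_strip_le {e : E3} {f : E3 → ℂ} (h : stripNorm e f ≠ ∞) (F : Finset ℤ) :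
    ∑ n ∈ F, nrm ((strip e n).indicator f) ≤ (stripNorm e f).toReal := by
  unfold nrm
  rw [← ENNReal.toReal_sum fun n _ => ENNReal.ne_top_of_tsum_ne_top h n]
  exact ENNReal.toReal_mono h (ENNReal.sum_le_tsum F)

lemma nrm_finset_sum_le {ι : Type*} (F : Finset ι) {f : ι → E3 → ℂ}
    (hf : ∀ i, MemLp (f i) 2 volume) : nrm (fun x => ∑ i ∈ F, f i x) ≤ ∑ i ∈ F, nrm (f i) := by
  unfold nrm
  rw [← ENNReal.toReal_sum fun n _ => (hf n).2.ne]
  refine ENNReal.toReal_mono (ENNReal.sum_ne_top.2 fun n _ => (hf n).2.ne) ?_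
  have := eLpNorm_sum_le (s := F) (f := f) (p := 2) (μ := volume) (fun i _ => (hf i).1) (by norm_num)
  convert this using 2
  ext x; simp

lemma indicator_add_compl (A : Set E3) (f : E3 → ℂ) :
    (fun x => A.indicator f x + Aᶜ.indicator f x) = f := by
  ext x; simp

lemma nrm_le_stripNorm {e : E3} {f : E3 → ℂ} (hf : MemLp f 2 volume) (h : stripNorm e f ≠ ∞) :
    nrm f ≤ (stripNorm e f).toReal := by
  have ht := (tendsto_nrm_sub_indicator hf (measurableSet_slab e) (eventually_mem_slab e)).const_add
    (stripNorm e f).toReal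
  rw [add_zero] at ht
  refine ge_of_tendsto ht (Eventually.of_forall fun N => ?_)
  conv_lhs => rw [← indicator_add_compl (slab e N) f]
  refine (nrm_add_le (hf.indicator (measurableSet_slab e N))
    (hf.indicator (measurableSet_slab e N).compl)).trans (add_le_add_left ?_ _)
  rw [slab_indicator_eq_sum]
  exact (nrm_finset_sum_le _ fun n => hf.indicator (measurableSet_strip e n)).trans
    (sum_nrm_strip_le h _)

lemma tendsto_multForm_trunc {m : E3 → ℂ} {K : ℝ} (hm : BddMult m K) {f g : E3 → ℂ}
    (hf : MemLp f 2 volume) (hg : MemLp g 2 volume) {A : ℕ → Set E3}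
    (hA : ∀ n, MeasurableSet (A n)) (h : ∀ x, ∀ᶠ n in atTop, x ∈ A n) :
    Tendsto (fun n => multForm m ((A n).indicator f) ((A n).indicator g)) atTop
      (𝓝 (multForm m f g)) := by
  rw [tendsto_iff_norm_sub_tendsto_zero]
  have h1 := tendsto_nrm_sub_indicator hf hA h
  have h2 := tendsto_nrm_sub_indicator hg hA h
  have h3 : Tendsto (fun n => K * ((2 * Real.pi) ^ 3 * (nrm ((A n)ᶜ.indicator f) * nrm g)) +
      K * ((2 * Real.pi) ^ 3 * (nrm f * nrm ((A n)ᶜ.indicator g)))) atTop (𝓝 0) := by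
    have := (((h1.mul_const (nrm g)).const_mul ((2 * Real.pi) ^ 3)).const_mul K).add
      (((h2.const_mul (nrm f)).const_mul ((2 * Real.pi) ^ 3)).const_mul K)
    simpa using this
  refine squeeze_zero (fun n => norm_nonneg _) (fun n => ?_) h3
  have hfA := hf.indicator (hA n)
  have hfA' := hf.indicator (hA n).compl
  have hgA := hg.indicator (hA n)
  have hgA' := hg.indicator (hA n).compl
  have e1 : multForm m f g = multForm m ((A n).indicator f) ((A n).indicator g) +
      multForm m ((A n).indicator f) ((A n)ᶜ.indicator g) + multForm m ((A n)ᶜ.indicator f) g := by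
    rw [← multForm_add_right hm _ hgA hgA', indicator_add_compl, ← multForm_add_left hm hfA hfA',
      indicator_add_compl]
  rw [e1, ← norm_neg]
  have e2 : ∀ x y z : ℂ, -(x - (x + y + z)) = z + y := fun x y z => by ring
  rw [e2]
  refine (norm_add_le _ _).trans (add_le_add (norm_multForm_le hm hfA' hg) ?_)
  refine (norm_multForm_le hm hfA hgA').trans ?_
  have h0 := hm.nonneg
  have := nrm_nonneg ((A n)ᶜ.indicator g)
  have h5 : nrm ((A n).indicator f) ≤ nrm f :=
    nrm_mono hf (Eventually.of_forall fun x => norm_indicator_le_norm_self _ _)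
  gcongr

/-- The bound for a pair of strips does not depend on the pair, so the double sum factors into a
product of `ℓ¹` norms. The bound of `dirMult` by a multiple of `1/δ` is used only to pass from
finitely many strips to all of them. -/
lemma norm_multForm_dir_le {δ : ℝ} (hδ : 0 < δ) {e : E3} (he : ‖e‖ = 1) (a : E3) {f g : E3 → ℂ}
    (hf : MemLp f 2 volume) (hg : MemLp g 2 volume)
    (hfY : stripNorm e f ≠ ∞) (hgY : stripNorm e g ≠ ∞) :
    ‖multForm (fun ξ => dirMult δ e ξ * Complex.exp (-Complex.I * (⟪a, ξ⟫ : ℝ))) f g‖ ≤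
      2 * Real.sqrt (1 + δ ^ 2) * ((2 * Real.pi) ^ 3 *
        ((stripNorm e f).toReal * (stripNorm e g).toReal)) := by
  have hm := (bddMult_dirMult hδ e).mul (bddMult_exp a)
  have ht := (tendsto_multForm_trunc hm hf hg (measurableSet_slab e) (eventually_mem_slab e)).norm
  refine le_of_tendsto ht (Eventually.of_forall fun N => ?_)
  have hfn := fun n : ℤ => hf.indicator (measurableSet_strip e n)
  have hgn := fun n : ℤ => hg.indicator (measurableSet_strip e n)
  rw [slab_indicator_eq_sum, slab_indicator_eq_sum, multForm_sum_left hm _ hfn]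
  simp_rw [multForm_sum_right hm _ _ hgn]
  refine (norm_sum_le _ _).trans ?_
  calc _ ≤ ∑ i ∈ Finset.Ico (-(N : ℤ)) N, ∑ j ∈ Finset.Ico (-(N : ℤ)) N,
        2 * Real.sqrt (1 + δ ^ 2) * ((2 * Real.pi) ^ 3 *
          (nrm ((strip e i).indicator f) * nrm ((strip e j).indicator g))) := by
        refine Finset.sum_le_sum fun i _ => (norm_sum_le _ _).trans (Finset.sum_le_sum fun j _ => ?_)
        exact norm_multForm_strip_le hδ he a (hfn i) (hgn j)
          (fun x hx => Set.mem_of_indicator_ne_zero hx) (fun x hx => Set.mem_of_indicator_ne_zero hx)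
    _ = 2 * Real.sqrt (1 + δ ^ 2) * ((2 * Real.pi) ^ 3 *
          ((∑ i ∈ Finset.Ico (-(N : ℤ)) N, nrm ((strip e i).indicator f)) *
            ∑ j ∈ Finset.Ico (-(N : ℤ)) N, nrm ((strip e j).indicator g))) := by
        rw [Finset.sum_mul_sum]
        simp_rw [Finset.mul_sum]
    _ ≤ _ := by
        have h1 := sum_nrm_strip_le hfY (Finset.Ico (-(N : ℤ)) N)
        have h2 := sum_nrm_strip_le hgY (Finset.Ico (-(N : ℤ)) N)
        have h3 : 0 ≤ ∑ j ∈ Finset.Ico (-(N : ℤ)) N, nrm ((strip e j).indicator g) :=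
          Finset.sum_nonneg fun _ _ => nrm_nonneg _
        gcongr

/-! ### The uniform resolvent estimate -/

/-- The multiplier of the resolvent composed with the translation by `a`. -/
def resMult (δ : ℝ) (a ξ : E3) : ℂ := Complex.exp (-Complex.I * (⟪a, ξ⟫ : ℝ)) / symb δ ξ

lemma bddMult_resMult {δ : ℝ} (hδ : 0 < δ) (a : E3) : BddMult (resMult δ a) δ⁻¹ := by
  refine ⟨(bddMult_exp a).meas.div (measurable_symb δ), fun ξ => ?_⟩
  rw [resMult, norm_div, norm_exp_neg_I_mul, one_div]
  exact inv_anti₀ hδ (le_norm_symb hδ ξ)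

/-- The standard basis of `ℝ³`. -/
def bvec (k : Fin 3) : E3 := EuclideanSpace.single k 1

lemma norm_bvec (k : Fin 3) : ‖bvec k‖ = 1 := by simp [bvec]

lemma sum_inner_bvec_sq (ξ : E3) : ∑ k, ⟪bvec k, ξ⟫ ^ 2 = ‖ξ‖ ^ 2 := by
  rw [EuclideanSpace.norm_sq_eq]
  simp [bvec, EuclideanSpace.inner_single_left]

/-- The regular part of the multiplier `⟪e, ξ⟫² / (|ξ|² - 1 + i δ)`. -/
def regMult (δ : ℝ) (e ξ : E3) : ℂ := (⟪e, ξ⟫ : ℂ) ^ 2 / symb δ ξ + dirMult δ e ξ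

/-- Where `‖proj e ξ‖ < 1`, the two terms add up to `1`. Elsewhere `Re (symb δ ξ) = ⟪e, ξ⟫² + ‖proj
e ξ‖² - 1 ≥ ⟪e, ξ⟫²`. -/
lemma bddMult_regMult {δ : ℝ} (hδ : 0 < δ) {e : E3} (he : ‖e‖ = 1) :
    BddMult (regMult δ e) 1 := by
  have h1 := measurable_symb δ
  have h2 := measurable_dirMult δ e
  refine ⟨by unfold regMult; fun_prop, fun ξ => ?_⟩
  have hs := symb_ne_zero hδ ξ
  have hsq := norm_sq_proj he ξ
  unfold regMult dirMult
  split_ifs with h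
  · rw [← add_div]
    have : (⟪e, ξ⟫ : ℂ) ^ 2 + symb δ (proj e ξ) = symb δ ξ := by
      rw [symb, symb, hsq]; push_cast; ring
    rw [this, div_self hs, norm_one]
  · rw [add_zero, norm_div, div_le_one (norm_pos_iff.2 hs)]
    have h3 : (symb δ ξ).re = ‖ξ‖ ^ 2 - 1 := by
      rw [symb, Complex.add_re, Complex.ofReal_re]; simp
    have h4 : ‖(⟪e, ξ⟫ : ℂ) ^ 2‖ = ⟪e, ξ⟫ ^ 2 := by
      rw [norm_pow, Complex.norm_real, Real.norm_eq_abs, sq_abs]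
    rw [h4]
    refine le_trans ?_ ((le_abs_self _).trans (Complex.abs_re_le_norm _))
    rw [h3]
    nlinarith [norm_nonneg (proj e ξ)]

/-- Since `∑ ⟪bvec k, ξ⟫² = ‖ξ‖² = symb δ ξ + (1 - iδ)`, dividing by the symbol expresses the
resolvent through multipliers singular in one direction each. The factor `1 - iδ` has modulus `√(1 +
δ²)`, the same constant that the directional estimates carry. -/
lemma resMult_decomp {δ : ℝ} (hδ : 0 < δ) (a ξ : E3) :
    (1 - Complex.I * δ) * resMult δ a ξ =
      ∑ k, (regMult δ (bvec k) ξ * Complex.exp (-Complex.I * (⟪a, ξ⟫ : ℝ)) -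
        dirMult δ (bvec k) ξ * Complex.exp (-Complex.I * (⟪a, ξ⟫ : ℝ))) -
      Complex.exp (-Complex.I * (⟪a, ξ⟫ : ℝ)) := by
  have hs := symb_ne_zero hδ ξ
  simp only [regMult, add_mul, add_sub_cancel_right]
  rw [← Finset.sum_mul, ← Finset.sum_div]
  have h := sum_inner_bvec_sq ξ
  have h2 : ∑ k, (⟪bvec k, ξ⟫ : ℂ) ^ 2 = symb δ ξ + (1 - Complex.I * δ) := by
    rw [symb, ← h]; push_cast; ring
  rw [h2, resMult]
  field_simp
  ring

/-- The sum of the strip norms in the coordinate directions. -/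
def sumStripNorm (f : E3 → ℂ) : ℝ≥0∞ := ∑ k, stripNorm (bvec k) f

lemma stripNorm_le_sum (k : Fin 3) (f : E3 → ℂ) : stripNorm (bvec k) f ≤ sumStripNorm f :=
  Finset.single_le_sum (f := fun k => stripNorm (bvec k) f) (fun _ _ => zero_le)
    (Finset.mem_univ k)

/-- The resolvent is bounded uniformly in `δ` and in translations, for the sum of strip norms. -/
lemma norm_multForm_resMult_le {δ : ℝ} (hδ : 0 < δ) (a : E3) {f g : E3 → ℂ}
    (hf : MemLp f 2 volume) (hg : MemLp g 2 volume)
    (hfY : sumStripNorm f ≠ ∞) (hgY : sumStripNorm g ≠ ∞) :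
    ‖multForm (resMult δ a) f g‖ ≤
      10 * (2 * Real.pi) ^ 3 * ((sumStripNorm f).toReal * (sumStripNorm g).toReal) := by
  set D := Real.sqrt (1 + δ ^ 2) with hD
  have hD1 : 1 ≤ D := by rw [Real.one_le_sqrt]; nlinarith
  set C := (2 * Real.pi) ^ 3
  have hC : 0 ≤ C := by positivity
  set Yf := (sumStripNorm f).toReal
  set Yg := (sumStripNorm g).toReal
  have hYf : 0 ≤ Yf := ENNReal.toReal_nonneg
  have hYg : 0 ≤ Yg := ENNReal.toReal_nonneg
  have tf : ∀ k, stripNorm (bvec k) f ≠ ∞ := fun k => ne_top_of_le_ne_top hfY (stripNorm_le_sum k f)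
  have tg : ∀ k, stripNorm (bvec k) g ≠ ∞ := fun k => ne_top_of_le_ne_top hgY (stripNorm_le_sum k g)
  have lf : ∀ k, (stripNorm (bvec k) f).toReal ≤ Yf := fun k =>
    ENNReal.toReal_mono hfY (stripNorm_le_sum k f)
  have lg : ∀ k, (stripNorm (bvec k) g).toReal ≤ Yg := fun k =>
    ENNReal.toReal_mono hgY (stripNorm_le_sum k g)
  have nf : nrm f ≤ Yf := (nrm_le_stripNorm hf (tf 0)).trans (lf 0)
  have ng : nrm g ≤ Yg := (nrm_le_stripNorm hg (tg 0)).trans (lg 0)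
  have nn : nrm f * nrm g ≤ Yf * Yg := mul_le_mul nf ng (nrm_nonneg _) hYf
  have he := bddMult_exp a
  have hr := fun k => (bddMult_regMult hδ (norm_bvec k)).mul he
  have hd := fun k => (bddMult_dirMult hδ (bvec k)).mul he
  have key : (1 - Complex.I * δ) * multForm (resMult δ a) f g =
      ∑ k, (multForm (fun ξ => regMult δ (bvec k) ξ * Complex.exp (-Complex.I * (⟪a, ξ⟫ : ℝ))) f g -
        multForm (fun ξ => dirMult δ (bvec k) ξ * Complex.exp (-Complex.I * (⟪a, ξ⟫ : ℝ))) f g) -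
      multForm (fun ξ => Complex.exp (-Complex.I * (⟪a, ξ⟫ : ℝ))) f g := by
    unfold multForm
    simp_rw [← integral_sub ((hr _).integrable f g) ((hd _).integrable f g)]
    have hi : ∀ k ∈ Finset.univ, Integrable (fun ξ =>
        regMult δ (bvec k) ξ * Complex.exp (-Complex.I * (⟪a, ξ⟫ : ℝ)) *
          (hatL2 f ξ * conj (hatL2 g ξ)) -
        dirMult δ (bvec k) ξ * Complex.exp (-Complex.I * (⟪a, ξ⟫ : ℝ)) *
          (hatL2 f ξ * conj (hatL2 g ξ))) volume := fun k _ =>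
      ((hr k).integrable f g).sub ((hd k).integrable f g)
    rw [← integral_finsetSum _ hi,
      ← integral_sub (integrable_finsetSum _ hi) (he.integrable f g),
      ← integral_const_mul]
    refine integral_congr_ae (Eventually.of_forall fun ξ => ?_)
    simp only
    rw [← mul_assoc, resMult_decomp hδ, sub_mul, Finset.sum_mul]
    simp only [sub_mul]
  have hnD : ‖(1 - Complex.I * δ : ℂ)‖ = D := by
    have : (1 - Complex.I * δ : ℂ) = ((1 : ℝ) : ℂ) + ((-δ : ℝ) : ℂ) * Complex.I := by
      push_cast; ring
    rw [this, Complex.norm_add_mul_I, hD]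
    norm_num
  -- Each direction costs `1 + 2D` and the last exponential `1`; as `D ≥ 1`, the total `3(1 + 2D) +
  -- 1` is at most `10 D`, and `D` cancels, which leaves a constant valid for all `δ > 0`.
  have hbound : D * ‖multForm (resMult δ a) f g‖ ≤ D * (10 * C * (Yf * Yg)) := by
    rw [← hnD, ← norm_mul, key, hnD]
    have hyy : 0 ≤ Yf * Yg := by positivity
    have b1 : ∀ k, ‖multForm (fun ξ => regMult δ (bvec k) ξ *
        Complex.exp (-Complex.I * (⟪a, ξ⟫ : ℝ))) f g‖ ≤ C * (Yf * Yg) := fun k => by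
      refine (norm_multForm_le (hr k) hf hg).trans ?_
      rw [one_mul, one_mul]
      exact mul_le_mul_of_nonneg_left nn hC
    have b2 : ∀ k, ‖multForm (fun ξ => dirMult δ (bvec k) ξ *
        Complex.exp (-Complex.I * (⟪a, ξ⟫ : ℝ))) f g‖ ≤ 2 * D * (C * (Yf * Yg)) := fun k => by
      refine (norm_multForm_dir_le hδ (norm_bvec k) a hf hg (tf k) (tg k)).trans ?_
      have := mul_le_mul (lf k) (lg k) ENNReal.toReal_nonneg hYf
      gcongr
    have b3 : ‖multForm (fun ξ => Complex.exp (-Complex.I * (⟪a, ξ⟫ : ℝ))) f g‖ ≤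
        C * (Yf * Yg) := by
      refine (norm_multForm_le he hf hg).trans ?_
      rw [one_mul]
      exact mul_le_mul_of_nonneg_left nn hC
    have b4 : ∀ k, ‖multForm (fun ξ => regMult δ (bvec k) ξ *
        Complex.exp (-Complex.I * (⟪a, ξ⟫ : ℝ))) f g - multForm (fun ξ => dirMult δ (bvec k) ξ *
        Complex.exp (-Complex.I * (⟪a, ξ⟫ : ℝ))) f g‖ ≤ C * (Yf * Yg) + 2 * D * (C * (Yf * Yg)) :=
      fun k => (norm_sub_le _ _).trans (add_le_add (b1 k) (b2 k))
    refine (norm_sub_le _ _).trans ((add_le_add ((norm_sum_le _ _).trans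
      (Finset.sum_le_sum fun k _ => b4 k)) b3).trans ?_)
    simp only [Finset.sum_const, Finset.card_univ, Fintype.card_fin, nsmul_eq_mul]
    have : 0 ≤ C * (Yf * Yg) := by positivity
    push_cast
    nlinarith
  exact le_of_mul_le_mul_left hbound (by linarith)

/-! ### Bounds of the strip norm -/

lemma eLpNorm_two_sq (f : E3 → ℂ) : eLpNorm f 2 volume ^ 2 = ∫⁻ x, ‖f x‖ₑ ^ 2 := by
  rw [eLpNorm_eq_lintegral_rpow_enorm_toReal (by norm_num) (by norm_num)]
  rw [← ENNReal.rpow_natCast, ← ENNReal.rpow_mul]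
  norm_num

lemma sum_eLpNorm_strip_sq_le (e : E3) (f : E3 → ℂ) (F : Finset ℤ) :
    ∑ n ∈ F, eLpNorm ((strip e n).indicator f) 2 volume ^ 2 ≤ eLpNorm f 2 volume ^ 2 := by
  have h : ∀ n, eLpNorm ((strip e n).indicator f) 2 volume ^ 2 = ∫⁻ x in strip e n, ‖f x‖ₑ ^ 2 := by
    intro n
    rw [eLpNorm_two_sq, ← lintegral_indicator (measurableSet_strip e n)]
    refine lintegral_congr fun x => ?_
    by_cases hx : x ∈ strip e n <;> simp [hx]
  simp_rw [h]
  rw [eLpNorm_two_sq, ← lintegral_biUnion_finset]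
  · exact setLIntegral_le_lintegral _ _
  · intro m _ n _ hmn
    refine Set.disjoint_left.2 fun x hx hx' => hmn ?_
    exact (show ⌊⟪e, x⟫⌋ = m from hx).symm.trans hx'
  · exact fun n _ => measurableSet_strip e n

/-- Cauchy–Schwarz over the strips, which are disjoint. The weights `d` will be either the indicator
of finitely many strips or a negative power of `1 + |n|`. -/
lemma stripNorm_le_of_le (e : E3) {f F : E3 → ℂ} {d : ℤ → NNReal}
    (hd : ∀ n, ∀ x ∈ strip e n, ‖f x‖ ≤ d n * ‖F x‖) :
    stripNorm e f ≤ (∑' n, (d n : ℝ≥0∞) ^ 2) ^ (1 / 2 : ℝ) * eLpNorm F 2 volume := by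
  have h1 : ∀ n, eLpNorm ((strip e n).indicator f) 2 volume ≤
      d n * eLpNorm ((strip e n).indicator F) 2 volume := by
    intro n
    refine eLpNorm_le_nnreal_smul_eLpNorm_of_ae_le_mul (Eventually.of_forall fun x => ?_) 2
    by_cases hx : x ∈ strip e n
    · simp only [Set.indicator_of_mem hx]
      exact_mod_cast hd n x hx
    · simp [Set.indicator_of_notMem hx]
  rw [stripNorm, ENNReal.tsum_eq_iSup_sum]
  refine iSup_le fun S => ?_
  refine (Finset.sum_le_sum fun n _ => h1 n).trans ?_
  refine (ENNReal.inner_le_Lp_mul_Lq S _ _ Real.HolderConjugate.two_two).trans ?_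
  simp only [ENNReal.rpow_ofNat]
  refine mul_le_mul' (ENNReal.rpow_le_rpow (ENNReal.sum_le_tsum S) (by norm_num)) ?_
  refine (ENNReal.rpow_le_rpow (sum_eLpNorm_strip_sq_le e F S) (by norm_num)).trans (le_of_eq ?_)
  rw [← ENNReal.rpow_natCast, ← ENNReal.rpow_mul]
  norm_num

/-- Functions supported in a ball of radius `R ≥ 1`. -/
lemma sumStripNorm_ball_le {R : ℕ} {g : E3 → ℂ} (hg : MemLp g 2 volume)
    (hs : ∀ x, g x ≠ 0 → ‖x‖ < R) :
    sumStripNorm g ≠ ∞ ∧ (sumStripNorm g).toReal ≤ 3 * Real.sqrt (2 * R) * nrm g := by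
  have h : ∀ k, stripNorm (bvec k) g ≤ ENNReal.ofReal (Real.sqrt (2 * R)) * eLpNorm g 2 volume := by
    intro k
    -- A ball of radius `R` meets only the `2R` strips `-R ≤ n < R`, whence the factor `√(2R)`.
    let d : ℤ → NNReal := fun n => if n ∈ Finset.Ico (-(R : ℤ)) R then 1 else 0
    refine (stripNorm_le_of_le (bvec k) (F := g) (d := d) fun n x hx => ?_).trans (le_of_eq ?_)
    · by_cases hgx : g x = 0
      · rw [hgx]; simp
      · have h1 := hs x hgx
        have h2 := abs_le.1 (abs_real_inner_le_norm (bvec k) x)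
        rw [norm_bvec, one_mul] at h2
        have h3 : ⌊⟪bvec k, x⟫⌋ = n := hx
        have h4 : n ∈ Finset.Ico (-(R : ℤ)) R := by
          rw [Finset.mem_Ico, ← h3]
          refine ⟨Int.le_floor.2 ?_, Int.floor_lt.2 ?_⟩
          · push_cast; linarith [h2.1]
          · push_cast; linarith [h2.2]
        simp only [d, if_pos h4]; simp
    · congr 1
      rw [tsum_eq_sum (s := Finset.Ico (-(R : ℤ)) R) (fun n hn => by simp only [d, if_neg hn]; simp)]
      rw [Finset.sum_congr rfl (g := fun _ => (1 : ℝ≥0∞)) fun n hn => by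
        simp only [d, if_pos hn]; simp]
      rw [Finset.sum_const, Int.card_Ico, nsmul_eq_mul, mul_one,
        show ((R : ℤ) - -(R : ℤ)).toNat = 2 * R by omega, Real.sqrt_eq_rpow,
        ← ENNReal.ofReal_rpow_of_nonneg (by positivity) (by norm_num)]
      congr 1
      rw [ENNReal.ofReal_mul (by norm_num)]
      simp
  have h2 : sumStripNorm g ≤ 3 * (ENNReal.ofReal (Real.sqrt (2 * R)) * eLpNorm g 2 volume) := by
    refine (Finset.sum_le_sum fun k _ => h k).trans (le_of_eq ?_)
    simp
  have h3 : 3 * (ENNReal.ofReal (Real.sqrt (2 * R)) * eLpNorm g 2 volume) ≠ ∞ :=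
    ENNReal.mul_ne_top (by norm_num) (ENNReal.mul_ne_top ENNReal.ofReal_ne_top hg.2.ne)
  refine ⟨ne_top_of_le_ne_top h3 h2, (ENNReal.toReal_mono h3 h2).trans (le_of_eq ?_)⟩
  rw [ENNReal.toReal_mul, ENNReal.toReal_mul, ENNReal.toReal_ofReal (Real.sqrt_nonneg _), nrm]
  simp; ring

/-! ### Weighted `L²` spaces -/

lemma one_le_japanese (x : E3) : 1 ≤ japanese x := by
  rw [japanese, Real.one_le_sqrt]; nlinarith [sq_nonneg ‖x‖]

lemma japanese_pos (x : E3) : 0 < japanese x := one_pos.trans_le (one_le_japanese x)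

lemma norm_le_japanese (x : E3) : ‖x‖ ≤ japanese x := by
  rw [japanese]; exact Real.le_sqrt_of_sq_le (by linarith)

lemma continuous_japanese : Continuous japanese := by unfold japanese; fun_prop

lemma continuous_japanese_rpow (s : ℝ) : Continuous fun x => japanese x ^ s :=
  continuous_japanese.rpow_const fun x => Or.inl (japanese_pos x).ne'

/-- The function `⟨x⟩^s f(x)`. -/
def weighted (s : ℝ) (f : E3 → ℂ) (x : E3) : ℂ := ((japanese x ^ s : ℝ) : ℂ) * f x

lemma norm_weighted (s : ℝ) (f : E3 → ℂ) (x : E3) : ‖weighted s f x‖ = japanese x ^ s * ‖f x‖ := by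
  rw [weighted, norm_mul, Complex.norm_real,
    Real.norm_of_nonneg (Real.rpow_nonneg (japanese_pos x).le _)]

/-- The weighted space `⟨x⟩^s f ∈ L²`. -/
def MemZ (s : ℝ) (f : E3 → ℂ) : Prop := MemLp (weighted s f) 2 volume

/-- The norm of the weighted space. -/
def normZ (s : ℝ) (f : E3 → ℂ) : ℝ := nrm (weighted s f)

lemma aestronglyMeasurable_weighted {f : E3 → ℂ} (hf : AEStronglyMeasurable f volume) (s : ℝ) :
    AEStronglyMeasurable (weighted s f) volume :=
  (Complex.continuous_ofReal.comp (continuous_japanese_rpow s)).aestronglyMeasurable.mul hf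

lemma weighted_weighted (s t : ℝ) (f : E3 → ℂ) : weighted s (weighted t f) = weighted (s + t) f := by
  ext x
  rw [weighted, weighted, weighted, Real.rpow_add (japanese_pos x)]
  push_cast; ring

lemma weighted_zero (f : E3 → ℂ) : weighted 0 f = f := by ext x; simp [weighted]

lemma MemZ.aestronglyMeasurable {s : ℝ} {f : E3 → ℂ} (hf : MemZ s f) :
    AEStronglyMeasurable f volume := by
  have := aestronglyMeasurable_weighted hf.1 (-s)
  rwa [weighted_weighted, neg_add_cancel, weighted_zero] at this

lemma MemZ.mono {s t : ℝ} (hst : s ≤ t) {f : E3 → ℂ} (hf : MemZ t f) : MemZ s f := by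
  refine hf.of_le (aestronglyMeasurable_weighted hf.aestronglyMeasurable s)
    (Eventually.of_forall fun x => ?_)
  rw [norm_weighted, norm_weighted]
  exact mul_le_mul_of_nonneg_right (Real.rpow_le_rpow_of_exponent_le (one_le_japanese x) hst)
    (norm_nonneg _)

lemma MemZ.memLp {s : ℝ} (hs : 0 ≤ s) {f : E3 → ℂ} (hf : MemZ s f) : MemLp f 2 volume := by
  have := hf.mono hs
  rwa [MemZ, weighted_zero] at this

lemma weighted_indicator (s : ℝ) (A : Set E3) (f : E3 → ℂ) :
    weighted s (A.indicator f) = A.indicator (weighted s f) := by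
  ext x
  by_cases hx : x ∈ A <;> simp [weighted, hx]

lemma MemZ.indicator {s : ℝ} {f : E3 → ℂ} (hf : MemZ s f) {A : Set E3} (hA : MeasurableSet A) :
    MemZ s (A.indicator f) := by
  rw [MemZ, weighted_indicator]
  exact MemLp.indicator hA hf

lemma MemZ.add {s : ℝ} {f g : E3 → ℂ} (hf : MemZ s f) (hg : MemZ s g) :
    MemZ s (fun x => f x + g x) := by
  have : weighted s (fun x => f x + g x) = weighted s f + weighted s g := by
    ext x; simp [weighted, mul_add]
  rw [MemZ, this]
  exact MemLp.add hf hg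

/-- The constant in the comparison of strip norms and weighted norms. -/
def stripConst (s : ℝ) : ℝ≥0∞ :=
  (∑' n : ℤ, (((3 / (1 + |(n : ℝ)|)) ^ s).toNNReal : ℝ≥0∞) ^ 2) ^ (1 / 2 : ℝ)

lemma stripConst_ne_top {s : ℝ} (hs : 1 / 2 < s) : stripConst s ≠ ∞ := by
  refine ENNReal.rpow_ne_top_of_nonneg (by norm_num) ?_
  have h : Summable fun n : ℤ => (3 / (1 + |(n : ℝ)|)) ^ (2 * s) := by
    -- The series converges because `2s > 1`. By convention `|0| ^ (-(2s)) = 0`, so the term `n = 0`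
    -- is supplied by `Pi.single`.
    have hb : Summable fun n : ℤ => (3 : ℝ) ^ (2 * s) * |(n : ℝ)| ^ (-(2 * s)) +
        Pi.single (M := fun _ => ℝ) (0 : ℤ) ((3 : ℝ) ^ (2 * s)) n :=
      ((Real.summable_abs_int_rpow (by linarith : 1 < 2 * s)).mul_left _).add
        (summable_of_hasFiniteSupport ((Set.finite_singleton (0 : ℤ)).subset
          Pi.support_single_subset))
    refine hb.of_nonneg_of_le (fun n => by positivity) fun n => ?_
    rcases eq_or_ne n 0 with rfl | hn
    · simp only [Int.cast_zero, abs_zero, add_zero, div_one, Pi.single_eq_same]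
      exact le_add_of_nonneg_left (by positivity)
    · have hn' : 0 < |(n : ℝ)| := abs_pos.2 (by exact_mod_cast hn)
      rw [Pi.single_eq_of_ne hn, add_zero, Real.rpow_neg hn'.le, ← div_eq_mul_inv,
        ← Real.div_rpow (by norm_num) hn'.le]
      refine Real.rpow_le_rpow (by positivity) ?_ (by linarith)
      exact div_le_div_of_nonneg_left (by norm_num) hn' (by linarith)
  have e : ∀ n : ℤ, (((3 / (1 + |(n : ℝ)|)) ^ s).toNNReal : ℝ≥0∞) ^ 2 =
      ENNReal.ofReal ((3 / (1 + |(n : ℝ)|)) ^ (2 * s)) := by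
    intro n
    have : 0 ≤ 3 / (1 + |(n : ℝ)|) := by positivity
    rw [mul_comm 2 s, Real.rpow_mul this, Real.rpow_two, ENNReal.ofReal_pow (by positivity)]
    rfl
  simp_rw [e]
  exact h.tsum_ofReal_ne_top

lemma sumStripNorm_le_normZ {s : ℝ} (hs : 1 / 2 < s) {f : E3 → ℂ} (hf : MemZ s f) :
    sumStripNorm f ≠ ∞ ∧ (sumStripNorm f).toReal ≤ 3 * (stripConst s).toReal * normZ s f := by
  have h : ∀ k, stripNorm (bvec k) f ≤ stripConst s * eLpNorm (weighted s f) 2 volume := by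
    intro k
    refine stripNorm_le_of_le (bvec k) fun n x hx => ?_
    have hj := japanese_pos x
    have h2 := abs_le.1 (abs_real_inner_le_norm (bvec k) x)
    rw [norm_bvec, one_mul] at h2
    have h3 : ⌊⟪bvec k, x⟫⌋ = n := hx
    -- On strip `n`, `|n| ≤ 1 + ‖x‖`, and both `1` and `‖x‖` are at most `⟨x⟩`: this is the `3` in
    -- `stripConst`.
    have h4 : 1 + |(n : ℝ)| ≤ 3 * japanese x := by
      have h5 := Int.floor_le ⟪bvec k, x⟫
      have h6 := Int.lt_floor_add_one ⟪bvec k, x⟫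
      rw [h3] at h5 h6
      have h7 := one_le_japanese x
      have h8 := norm_le_japanese x
      have : |(n : ℝ)| ≤ 1 + ‖x‖ := abs_le.2 ⟨by linarith [h2.1], by linarith [h2.2]⟩
      linarith
    have h9 : 1 ≤ 3 / (1 + |(n : ℝ)|) * japanese x := by
      rw [div_mul_eq_mul_div, le_div_iff₀ (by positivity)]; linarith
    rw [norm_weighted, Real.coe_toNNReal _ (by positivity), ← mul_assoc,
      ← Real.mul_rpow (by positivity) hj.le]
    exact le_mul_of_one_le_left (norm_nonneg _) (Real.one_le_rpow h9 (by linarith))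
  have h2 : sumStripNorm f ≤ 3 * (stripConst s * eLpNorm (weighted s f) 2 volume) := by
    refine (Finset.sum_le_sum fun k _ => h k).trans (le_of_eq ?_)
    simp
  have h3 : 3 * (stripConst s * eLpNorm (weighted s f) 2 volume) ≠ ∞ :=
    ENNReal.mul_ne_top (by norm_num) (ENNReal.mul_ne_top (stripConst_ne_top hs) hf.2.ne)
  refine ⟨ne_top_of_le_ne_top h3 h2, (ENNReal.toReal_mono h3 h2).trans (le_of_eq ?_)⟩
  rw [ENNReal.toReal_mul, ENNReal.toReal_mul, normZ, nrm]
  simp; ring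

/-- Uniform resolvent estimate in weighted spaces. -/
lemma exists_norm_resForm_le {s : ℝ} (hs : 1 / 2 < s) :
    ∃ C : ℝ, 0 ≤ C ∧ ∀ {δ : ℝ}, 0 < δ → ∀ (a : E3) {f g : E3 → ℂ}, MemZ s f → MemZ s g →
      ‖multForm (resMult δ a) f g‖ ≤ C * (normZ s f * normZ s g) := by
  refine ⟨10 * (2 * Real.pi) ^ 3 * (3 * (stripConst s).toReal) ^ 2, by positivity, ?_⟩
  intro δ hδ a f g hf hg
  obtain ⟨f1, f2⟩ := sumStripNorm_le_normZ hs hf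
  obtain ⟨g1, g2⟩ := sumStripNorm_le_normZ hs hg
  refine (norm_multForm_resMult_le hδ a (hf.memLp (by linarith)) (hg.memLp (by linarith)) f1
    g1).trans ?_
  have : (sumStripNorm f).toReal * (sumStripNorm g).toReal ≤
      (3 * (stripConst s).toReal * normZ s f) * (3 * (stripConst s).toReal * normZ s g) :=
    mul_le_mul f2 g2 ENNReal.toReal_nonneg (mul_nonneg (by positivity) (nrm_nonneg _))
  calc _ ≤ 10 * (2 * Real.pi) ^ 3 * ((3 * (stripConst s).toReal * normZ s f) *
        (3 * (stripConst s).toReal * normZ s g)) := by gcongr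
    _ = _ := by ring

/-- Uniform resolvent estimate tested on functions supported in balls. -/
lemma exists_norm_resForm_ball_le {s : ℝ} (hs : 1 / 2 < s) :
    ∃ C : ℝ, 0 ≤ C ∧ ∀ {δ : ℝ}, 0 < δ → ∀ {f g : E3 → ℂ} {R : ℕ}, MemZ s f → MemLp g 2 volume →
      (∀ x, g x ≠ 0 → ‖x‖ < R) →
      ‖multForm (resMult δ 0) f g‖ ≤ C * (normZ s f * (Real.sqrt R * nrm g)) := by
  refine ⟨10 * (2 * Real.pi) ^ 3 * (3 * (stripConst s).toReal) * (3 * Real.sqrt 2),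
    by positivity, ?_⟩
  intro δ hδ f g R hf hg hR
  obtain ⟨f1, f2⟩ := sumStripNorm_le_normZ hs hf
  obtain ⟨g1, g2⟩ := sumStripNorm_ball_le hg hR
  refine (norm_multForm_resMult_le hδ 0 (hf.memLp (by linarith)) hg f1 g1).trans ?_
  have : (sumStripNorm f).toReal * (sumStripNorm g).toReal ≤
      (3 * (stripConst s).toReal * normZ s f) * (3 * Real.sqrt (2 * R) * nrm g) :=
    mul_le_mul f2 g2 ENNReal.toReal_nonneg (mul_nonneg (by positivity) (nrm_nonneg _))
  calc _ ≤ 10 * (2 * Real.pi) ^ 3 * ((3 * (stripConst s).toReal * normZ s f) *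
        (3 * Real.sqrt (2 * R) * nrm g)) := by gcongr
    _ = _ := by rw [Real.sqrt_mul (by norm_num)]; ring

/-! ### The dispersive estimate -/

lemma integrable_gaussian {b : ℂ} (hb : 0 < b.re) :
    Integrable (fun v : E3 => Complex.exp (-b * (‖v‖ : ℂ) ^ 2)) volume := by
  have := GaussianFourier.integrable_cexp_neg_mul_sq_norm_add hb 0 (0 : E3)
  simpa using this

/-- The Gaussian integral is explicit: `(π/b)^{3/2}` times `exp (-‖w‖²/(4b))`, and the latter has
modulus at most `1` because `Re (1/b) > 0`. -/
lemma norm_integral_gaussian_le {b : ℂ} (hb : 0 < b.re) (w : E3) :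
    ‖∫ v : E3, Complex.exp (-b * (‖v‖ : ℂ) ^ 2) * Complex.exp (Complex.I * (⟪w, v⟫ : ℝ))‖ ≤
      (Real.pi / ‖b‖) ^ (3 / 2 : ℝ) := by
  have h := GaussianFourier.integral_cexp_neg_mul_sq_norm_add hb Complex.I w
  simp_rw [Complex.exp_add] at h
  rw [h, norm_mul]
  have hfin : (Module.finrank ℝ E3 / 2 : ℂ) = ((3 / 2 : ℝ) : ℂ) := by simp
  rw [hfin, Complex.norm_cpow_real, norm_div, Complex.norm_real,
    Real.norm_of_nonneg Real.pi_pos.le]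
  refine mul_le_of_le_one_right (by positivity) ?_
  rw [Complex.norm_exp, Real.exp_le_one_iff]
  have : Complex.I ^ 2 * (‖w‖ : ℂ) ^ 2 / (4 * b) = ((-(‖w‖ ^ 2 / 4) : ℝ) : ℂ) * b⁻¹ := by
    rw [Complex.I_sq]
    have : b ≠ 0 := fun h => by simp [h] at hb
    push_cast; field_simp
  rw [this, Complex.re_ofReal_mul, Complex.inv_re]
  have h1 : 0 ≤ b.re / Complex.normSq b := div_nonneg hb.le (Complex.normSq_nonneg _)
  have h2 : 0 ≤ ‖w‖ ^ 2 / 4 := by positivity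
  nlinarith

lemma integrable_conj {f : E3 → ℂ} (hf : Integrable f volume) :
    Integrable (fun x => conj (f x)) volume :=
  (LinearIsometryEquiv.integrable_comp_iff Complex.conjLIE).2 hf

lemma norm_integral_mul_le_of_bound {f k : E3 → ℂ} (hf : Integrable f volume) {K : ℝ}
    (hk : ∀ x, ‖k x‖ ≤ K) : ‖∫ x, f x * k x‖ ≤ (∫ x, ‖f x‖) * K := by
  rw [← integral_mul_const]
  refine norm_integral_le_of_norm_le (hf.norm.mul_const K) (Eventually.of_forall fun x => ?_)
  rw [norm_mul]
  exact mul_le_mul_of_nonneg_left (hk x) (norm_nonneg _)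

/-- Moving both transforms onto the Gaussian leaves `f(x)` and `conj (g y)` integrated against
Gaussian integrals at `y - a - x`, which are bounded uniformly in all three points. -/
lemma norm_gaussian_form_le {f g : E3 → ℂ} (hf : Integrable f volume) (hg : Integrable g volume)
    {b : ℂ} (hb : 0 < b.re) (a : E3) :
    ‖∫ ξ, Complex.exp (-b * (‖ξ‖ : ℂ) ^ 2) * (Complex.exp (-Complex.I * (⟪a, ξ⟫ : ℝ)) *
      (hat f ξ * conj (hat g ξ)))‖ ≤
      (∫ x, ‖f x‖) * ((∫ x, ‖g x‖) * (Real.pi / ‖b‖) ^ (3 / 2 : ℝ)) := by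
  let E : E3 → E3 → ℂ := fun w ξ =>
    Complex.exp (-b * (‖ξ‖ : ℂ) ^ 2) * Complex.exp (-Complex.I * (⟪w, ξ⟫ : ℝ))
  have hE : ∀ w, Integrable (E w) volume := fun w =>
    (integrable_gaussian hb).mul_bdd (c := 1) (by fun_prop : Continuous _).aestronglyMeasurable
      (Eventually.of_forall fun ξ => (norm_exp_neg_I_mul _).le)
  have hEg : ∀ w, Integrable (fun ξ => E w ξ * conj (hat g ξ)) volume := fun w =>
    (hE w).mul_bdd (c := ∫ x, ‖g x‖)
      (Complex.continuous_conj.comp (continuous_hat hg)).aestronglyMeasurable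
      (Eventually.of_forall fun ξ => by rw [RCLike.norm_conj]; exact norm_hat_le g ξ)
  have h1 : ∫ ξ, Complex.exp (-b * (‖ξ‖ : ℂ) ^ 2) * (Complex.exp (-Complex.I * (⟪a, ξ⟫ : ℝ)) *
      (hat f ξ * conj (hat g ξ))) = ∫ x, f x * hat (fun ξ => E a ξ * conj (hat g ξ)) x := by
    rw [← integral_hat_mul hf (hEg a)]
    exact integral_congr_ae (Eventually.of_forall fun ξ => by simp only [E]; ring)
  rw [h1]
  refine norm_integral_mul_le_of_bound hf fun x => ?_
  have h2 : hat (fun ξ => E a ξ * conj (hat g ξ)) x =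
      conj (∫ y, g y * hat (fun ξ => conj (E (a + x) ξ)) y) := by
    rw [← integral_hat_mul hg (integrable_conj (hE _)), ← integral_conj, hat]
    refine integral_congr_ae (Eventually.of_forall fun ξ => ?_)
    simp only [E, map_mul, Complex.conj_conj]
    rw [inner_add_left]
    push_cast
    rw [mul_add, Complex.exp_add]
    ring
  rw [h2, RCLike.norm_conj]
  refine norm_integral_mul_le_of_bound hg fun y => ?_
  have h3 : hat (fun ξ => conj (E (a + x) ξ)) y =
      conj (∫ v : E3, Complex.exp (-b * (‖v‖ : ℂ) ^ 2) *
        Complex.exp (Complex.I * (⟪y - a - x, v⟫ : ℝ))) := by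
    rw [hat, ← integral_conj]
    refine integral_congr_ae (Eventually.of_forall fun ξ => ?_)
    simp only [E, map_mul, ← Complex.exp_conj, map_neg, Complex.conj_I, Complex.conj_ofReal]
    rw [mul_left_comm, ← Complex.exp_add, inner_sub_left, inner_sub_left, inner_add_left]
    congr 2
    push_cast; ring
  rw [h3, RCLike.norm_conj]
  exact norm_integral_gaussian_le hb _

/-- The sesquilinear form of the Schrödinger group `e^{i τ (|ξ|² - 1)}`. -/
def schrodForm (τ : ℝ) (a : E3) (f g : E3 → ℂ) : ℂ :=
  multForm (fun ξ => Complex.exp (-Complex.I * (⟪a, ξ⟫ : ℝ)) *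
    Complex.exp (Complex.I * ((τ * (‖ξ‖ ^ 2 - 1) : ℝ) : ℂ))) f g

lemma bddMult_schrod (τ : ℝ) (a : E3) : BddMult (fun ξ => Complex.exp (-Complex.I * (⟪a, ξ⟫ : ℝ)) *
    Complex.exp (Complex.I * ((τ * (‖ξ‖ ^ 2 - 1) : ℝ) : ℂ))) 1 :=
  ⟨by fun_prop, fun ξ => by rw [norm_mul, norm_exp_neg_I_mul, norm_exp_I_mul, one_mul]⟩

lemma norm_schrodForm_le_L2 (τ : ℝ) (a : E3) {f g : E3 → ℂ} (hf : MemLp f 2 volume)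
    (hg : MemLp g 2 volume) :
    ‖schrodForm τ a f g‖ ≤ (2 * Real.pi) ^ 3 * (nrm f * nrm g) := by
  have := norm_multForm_le (bddMult_schrod τ a) hf hg
  rwa [one_mul] at this

/-- The oscillating Gaussian `e^{iτ‖ξ‖²}` is not integrable, so it is damped: `b η = η - iτ` with `η
→ 0⁺`. Since `‖b η‖ ≥ τ`, the bound is uniform in `η`. -/
lemma norm_schrodForm_le_L1 {τ : ℝ} (hτ : 0 < τ) (a : E3) {f g : E3 → ℂ} (hf : MemLp f 2 volume)
    (hg : MemLp g 2 volume) (hf1 : Integrable f volume) (hg1 : Integrable g volume) :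
    ‖schrodForm τ a f g‖ ≤ (∫ x, ‖f x‖) * ((∫ x, ‖g x‖) * (Real.pi / τ) ^ (3 / 2 : ℝ)) := by
  let H : E3 → ℂ := fun ξ => hatL2 f ξ * conj (hatL2 g ξ)
  have hH : Integrable H volume := integrable_hat_mul_conj f g
  let b : ℝ → ℂ := fun η => (η : ℂ) - Complex.I * τ
  have e1 : schrodForm τ a f g = Complex.exp (-Complex.I * τ) *
      ∫ ξ, Complex.exp (-b 0 * (‖ξ‖ : ℂ) ^ 2) *
        (Complex.exp (-Complex.I * (⟪a, ξ⟫ : ℝ)) * H ξ) := by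
    rw [schrodForm, multForm, ← integral_const_mul]
    refine integral_congr_ae (Eventually.of_forall fun ξ => ?_)
    simp only [H, b]
    have : Complex.I * ((τ * (‖ξ‖ ^ 2 - 1) : ℝ) : ℂ) =
        -Complex.I * τ + -(((0 : ℝ) : ℂ) - Complex.I * τ) * (‖ξ‖ : ℂ) ^ 2 := by
      push_cast; ring
    rw [this, Complex.exp_add]
    ring
  have hlim : Tendsto (fun η : ℝ => ∫ ξ, Complex.exp (-b η * (‖ξ‖ : ℂ) ^ 2) *
        (Complex.exp (-Complex.I * (⟪a, ξ⟫ : ℝ)) * H ξ)) (𝓝[>] 0)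
      (𝓝 (∫ ξ, Complex.exp (-b 0 * (‖ξ‖ : ℂ) ^ 2) *
        (Complex.exp (-Complex.I * (⟪a, ξ⟫ : ℝ)) * H ξ))) := by
    refine tendsto_integral_filter_of_dominated_convergence (fun ξ => ‖H ξ‖) ?_ ?_ hH.norm ?_
    · refine Eventually.of_forall fun η => ?_
      exact (by fun_prop : Continuous _).aestronglyMeasurable.mul
        ((by fun_prop : Continuous _).aestronglyMeasurable.mul hH.1)
    · filter_upwards [self_mem_nhdsWithin] with η hη
      refine Eventually.of_forall fun ξ => ?_
      rw [norm_mul, norm_mul, norm_exp_neg_I_mul, one_mul]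
      refine mul_le_of_le_one_left (norm_nonneg _) ?_
      have : -b η * (‖ξ‖ : ℂ) ^ 2 = ((-(η * ‖ξ‖ ^ 2) : ℝ) : ℂ) +
          ((τ * ‖ξ‖ ^ 2 : ℝ) : ℂ) * Complex.I := by
        simp only [b]; push_cast; ring
      rw [this, Complex.exp_add, norm_mul, Complex.norm_exp_ofReal_mul_I, mul_one,
        ← Complex.ofReal_exp, Complex.norm_real, Real.norm_of_nonneg (Real.exp_pos _).le,
        Real.exp_le_one_iff]
      have : 0 ≤ η * ‖ξ‖ ^ 2 := mul_nonneg (le_of_lt hη) (by positivity)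
      linarith
    · refine Eventually.of_forall fun ξ => ?_
      refine Tendsto.mul ?_ tendsto_const_nhds
      have : Continuous fun η : ℝ => Complex.exp (-b η * (‖ξ‖ : ℂ) ^ 2) := by
        simp only [b]; fun_prop
      exact (this.tendsto 0).mono_left nhdsWithin_le_nhds
  rw [e1, norm_mul, norm_exp_neg_I_mul, one_mul]
  refine le_of_tendsto hlim.norm ?_
  filter_upwards [self_mem_nhdsWithin] with η hη
  have hbre : (b η).re = η := by simp [b]
  have hb : 0 < (b η).re := by rw [hbre]; exact hη
  have hbn : τ ≤ ‖b η‖ := by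
    refine le_trans (le_of_eq ?_) (Complex.abs_im_le_norm _)
    simp [b, abs_of_pos hτ]
  have h2 := norm_gaussian_form_le hf1 hg1 hb a
  have e2 : ∫ ξ, Complex.exp (-b η * (‖ξ‖ : ℂ) ^ 2) *
        (Complex.exp (-Complex.I * (⟪a, ξ⟫ : ℝ)) * H ξ) =
      ∫ ξ, Complex.exp (-b η * (‖ξ‖ : ℂ) ^ 2) * (Complex.exp (-Complex.I * (⟪a, ξ⟫ : ℝ)) *
        (hat f ξ * conj (hat g ξ))) := by
    refine integral_congr_ae ?_
    filter_upwards [hatL2_eq_hat hf hf1, hatL2_eq_hat hg hg1] with ξ h1 h2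
    simp only [H, h1, h2]
  rw [e2]
  refine h2.trans ?_
  have : 0 ≤ ∫ x, ‖f x‖ := integral_nonneg fun _ => norm_nonneg _
  have : 0 ≤ ∫ x, ‖g x‖ := integral_nonneg fun _ => norm_nonneg _
  gcongr

/-- The `L²` bound serves for `τ ≤ 1` and the dispersive bound for `τ ≥ 1`. Together they give a
majorant that is integrable on `(0, ∞)`, as `3/2 > 1`, and independent of `a`. -/
lemma exists_schrodForm_bound {f g : E3 → ℂ} (hf : MemLp f 2 volume)
    (hg : MemLp g 2 volume) (hf1 : Integrable f volume) (hg1 : Integrable g volume) :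
    ∃ K : ℝ, ∀ τ > 0, ∀ a, ‖schrodForm τ a f g‖ ≤ K * (1 + ‖τ‖) ^ (-(3 / 2 : ℝ)) := by
  set M := (2 * Real.pi) ^ 3 * (nrm f * nrm g)
  set A := ∫ x, ‖f x‖
  set B := ∫ x, ‖g x‖
  have hA : 0 ≤ A := integral_nonneg fun _ => norm_nonneg _
  have hB : 0 ≤ B := integral_nonneg fun _ => norm_nonneg _
  have hM : 0 ≤ M := mul_nonneg (by positivity) (mul_nonneg (nrm_nonneg _) (nrm_nonneg _))
  refine ⟨(2 : ℝ) ^ (3 / 2 : ℝ) * M + A * (B * (2 * Real.pi) ^ (3 / 2 : ℝ)), fun τ hτ a => ?_⟩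
  rw [Real.norm_of_nonneg hτ.le, Real.rpow_neg (by positivity), ← div_eq_mul_inv,
    le_div_iff₀ (by positivity)]
  rcases le_total τ 1 with h | h
  · have h1 := norm_schrodForm_le_L2 τ a hf hg
    have h2 : (1 + τ) ^ (3 / 2 : ℝ) ≤ 2 ^ (3 / 2 : ℝ) :=
      Real.rpow_le_rpow (by positivity) (by linarith) (by norm_num)
    have h3 : 0 ≤ A * (B * (2 * Real.pi) ^ (3 / 2 : ℝ)) := by positivity
    calc _ ≤ M * 2 ^ (3 / 2 : ℝ) := mul_le_mul h1 h2 (by positivity) hM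
      _ ≤ _ := by linarith
  · have h1 := norm_schrodForm_le_L1 hτ a hf hg hf1 hg1
    have h2 : (1 + τ) ^ (3 / 2 : ℝ) ≤ (2 * τ) ^ (3 / 2 : ℝ) :=
      Real.rpow_le_rpow (by positivity) (by linarith) (by norm_num)
    calc _ ≤ (A * (B * (Real.pi / τ) ^ (3 / 2 : ℝ))) * (2 * τ) ^ (3 / 2 : ℝ) :=
          mul_le_mul h1 h2 (by positivity) (by positivity)
      _ = A * (B * (2 * Real.pi) ^ (3 / 2 : ℝ)) := by
          rw [mul_assoc, mul_assoc, ← Real.mul_rpow (by positivity) (by positivity)]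
          rw [show Real.pi / τ * (2 * τ) = 2 * Real.pi by field_simp]
      _ ≤ _ := by
          have : 0 ≤ (2 : ℝ) ^ (3 / 2 : ℝ) * M := by positivity
          linarith

/-! ### The resolvent as a time integral -/

lemma inv_symb_eq {δ : ℝ} (hδ : 0 < δ) (ξ : E3) :
    (symb δ ξ)⁻¹ = -Complex.I * ∫ τ in Set.Ioi (0 : ℝ), Complex.exp (Complex.I * symb δ ξ * τ) := by
  have hs := symb_ne_zero hδ ξ
  have hre : (Complex.I * symb δ ξ).re < 0 := by
    rw [symb, mul_add, Complex.add_re, Complex.re_mul_ofReal]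
    simp [← mul_assoc, hδ]
  rw [integral_exp_mul_complex_Ioi hre]
  simp only [Complex.ofReal_zero, mul_zero, Complex.exp_zero]
  have := Complex.I_ne_zero
  field_simp

/-- For `δ > 0` the factor `e^{-δτ}` makes the double integral in `(ξ, τ)` absolutely convergent, so
Fubini applies to `inv_symb_eq`. -/
lemma multForm_resMult_eq {δ : ℝ} (hδ : 0 < δ) (a : E3) (f g : E3 → ℂ) :
    multForm (resMult δ a) f g =
      -Complex.I * ∫ τ in Set.Ioi (0 : ℝ), (Real.exp (-(δ * τ)) : ℂ) * schrodForm τ a f g := by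
  let H : E3 → ℂ := fun ξ => hatL2 f ξ * conj (hatL2 g ξ)
  have hH : Integrable H volume := integrable_hat_mul_conj f g
  let G : E3 → ℝ → ℂ := fun ξ τ => Complex.exp (Complex.I * symb δ ξ * τ) *
    (Complex.exp (-Complex.I * (⟪a, ξ⟫ : ℝ)) * H ξ)
  have hexp : ∀ ξ (τ : ℝ), Complex.exp (Complex.I * symb δ ξ * τ) = (Real.exp (-(δ * τ)) : ℂ) *
      Complex.exp (Complex.I * ((τ * (‖ξ‖ ^ 2 - 1) : ℝ) : ℂ)) := by
    intro ξ τ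
    rw [Complex.ofReal_exp, ← Complex.exp_add, symb]
    congr 1
    push_cast
    linear_combination (δ * τ : ℂ) * Complex.I_sq
  have hG : Integrable (Function.uncurry G) (volume.prod (volume.restrict (Set.Ioi 0))) := by
    have hb : Integrable (fun p : E3 × ℝ => H p.1 * ((Real.exp (-δ * p.2) : ℝ) : ℂ))
        (volume.prod (volume.restrict (Set.Ioi 0))) :=
      hH.mul_prod ((integrableOn_exp_mul_Ioi (neg_neg_of_pos hδ) 0).ofReal)
    refine hb.mono ?_ (Eventually.of_forall fun p => ?_)
    · refine AEStronglyMeasurable.mul ?_ (AEStronglyMeasurable.mul ?_ hH.1.comp_fst)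
      · have h := measurable_symb δ
        exact (by fun_prop : Measurable fun p : E3 × ℝ =>
          Complex.exp (Complex.I * symb δ p.1 * p.2)).aestronglyMeasurable
      · exact (by fun_prop : Continuous fun p : E3 × ℝ =>
          Complex.exp (-Complex.I * (⟪a, p.1⟫ : ℝ))).aestronglyMeasurable
    · simp only [Function.uncurry, G]
      rw [norm_mul, norm_mul (Complex.exp (-Complex.I * _)), norm_exp_neg_I_mul, one_mul, hexp,
        norm_mul, norm_exp_I_mul, mul_one, norm_mul (H p.1), mul_comm, neg_mul]
  have h1 : multForm (resMult δ a) f g = -Complex.I * ∫ ξ, ∫ τ in Set.Ioi (0 : ℝ), G ξ τ := by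
    rw [multForm, ← integral_const_mul]
    refine integral_congr_ae (Eventually.of_forall fun ξ => ?_)
    simp only [G, resMult]
    rw [integral_mul_const, ← mul_assoc (-Complex.I), ← inv_symb_eq hδ, div_eq_mul_inv]
    ring
  rw [h1, integral_integral_swap hG]
  congr 1
  refine integral_congr_ae (Eventually.of_forall fun τ => ?_)
  simp only [G, schrodForm, multForm]
  rw [← integral_const_mul]
  refine integral_congr_ae (Eventually.of_forall fun ξ => ?_)
  simp only [hexp, H]
  ring

/-- Convergence of the resolvent on integrable functions. -/
lemma tendsto_resForm_of_integrable {ι : Type*} {l : Filter ι} [l.IsCountablyGenerated]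
    {δ : ι → ℝ} {a : ι → E3} (hδ : Tendsto δ l (𝓝 0)) (hδ0 : ∀ᶠ i in l, 0 < δ i)
    {f g : E3 → ℂ} (hf : MemLp f 2 volume) (hg : MemLp g 2 volume) (hf1 : Integrable f volume)
    (hg1 : Integrable g volume) {J : ℝ → ℂ}
    (hJ : ∀ τ > 0, Tendsto (fun i => schrodForm τ (a i) f g) l (𝓝 (J τ))) :
    Tendsto (fun i => multForm (resMult (δ i) (a i)) f g) l
      (𝓝 (-Complex.I * ∫ τ in Set.Ioi (0 : ℝ), J τ)) := by
  obtain ⟨K, hK⟩ := exists_schrodForm_bound hf hg hf1 hg1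
  have hmeas : ∀ a, AEStronglyMeasurable (fun τ => schrodForm τ a f g)
      (volume.restrict (Set.Ioi (0 : ℝ))) := by
    intro a
    refine Continuous.aestronglyMeasurable ?_
    refine continuous_of_dominated (bound := fun ξ => ‖hatL2 f ξ * conj (hatL2 g ξ)‖)
      (fun τ => ((bddMult_schrod τ a).integrable f g).1) (fun τ => Eventually.of_forall fun ξ => ?_)
      (integrable_hat_mul_conj f g).norm (Eventually.of_forall fun ξ => ?_)
    · rw [norm_mul (_ * _)]
      exact mul_le_of_le_one_left (norm_nonneg _) ((bddMult_schrod τ a).bound ξ)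
    · fun_prop
  have hmain : Tendsto (fun i => ∫ τ in Set.Ioi (0 : ℝ), (Real.exp (-(δ i * τ)) : ℂ) *
      schrodForm τ (a i) f g) l (𝓝 (∫ τ in Set.Ioi (0 : ℝ), J τ)) := by
    refine tendsto_integral_filter_of_dominated_convergence
      (fun τ => K * (1 + ‖τ‖) ^ (-(3 / 2 : ℝ))) ?_ ?_ ?_ ?_
    · refine Eventually.of_forall fun i => ?_
      exact (by fun_prop : Continuous fun τ : ℝ =>
        (Real.exp (-(δ i * τ)) : ℂ)).aestronglyMeasurable.mul (hmeas _)
    · filter_upwards [hδ0] with i hi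
      refine (ae_restrict_iff' measurableSet_Ioi).2 (Eventually.of_forall fun τ hτ => ?_)
      rw [norm_mul, Complex.norm_real, Real.norm_of_nonneg (Real.exp_pos _).le]
      refine (mul_le_of_le_one_left (norm_nonneg _) (Real.exp_le_one_iff.2 ?_)).trans (hK τ hτ _)
      have := mul_pos hi hτ
      linarith
    · exact ((integrable_one_add_norm (by simp; norm_num)).const_mul K).integrableOn
    · refine (ae_restrict_iff' measurableSet_Ioi).2 (Eventually.of_forall fun τ hτ => ?_)
      have h1 : Tendsto (fun i => (Real.exp (-(δ i * τ)) : ℂ)) l (𝓝 1) := by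
        have : Continuous fun d : ℝ => (Real.exp (-(d * τ)) : ℂ) := by fun_prop
        have := (this.tendsto 0).comp hδ
        simpa [Function.comp_def] using this
      simpa using h1.mul (hJ τ hτ)
  refine (hmain.const_mul (-Complex.I)).congr' ?_
  filter_upwards [hδ0] with i hi
  rw [multForm_resMult_eq hi]

/-- At fixed `τ` the translation `a` appears as a frequency: this is the Riemann–Lebesgue lemma, up
to the factor `2π`. -/
lemma tendsto_schrodForm_cocompact (τ : ℝ) (f g : E3 → ℂ) :
    Tendsto (fun a => schrodForm τ a f g) (cocompact E3) (𝓝 0) := by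
  have h := tendsto_integral_exp_inner_smul_cocompact (V := E3) (fun ξ =>
    Complex.exp (Complex.I * ((τ * (‖ξ‖ ^ 2 - 1) : ℝ) : ℂ)) * (hatL2 f ξ * conj (hatL2 g ξ)))
  have h2 : Tendsto (fun a : E3 => (2 * Real.pi)⁻¹ • a) (cocompact E3) (cocompact E3) :=
    dilation.symm.toHomeomorph.isClosedEmbedding.tendsto_cocompact.congr dilation_symm_apply
  refine (h.comp h2).congr fun a => ?_
  rw [schrodForm, multForm]
  refine integral_congr_ae (Eventually.of_forall fun ξ => ?_)
  simp only [Circle.smul_def, Real.fourierChar_apply, smul_eq_mul]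
  rw [← mul_assoc]
  congr 3
  rw [inner_smul_right, real_inner_comm]
  push_cast
  have : (Real.pi : ℂ) ≠ 0 := by exact_mod_cast Real.pi_ne_zero
  field_simp

/-! ### Convergence in weighted spaces -/

lemma integrable_indicator_ball {f : E3 → ℂ} (hf : MemLp f 2 volume) (n : ℕ) :
    Integrable ((Metric.ball (0 : E3) n).indicator f) volume := by
  rw [integrable_indicator_iff measurableSet_ball]
  have : IsFiniteMeasure (volume.restrict (Metric.ball (0 : E3) n)) :=
    ⟨by simpa using measure_ball_lt_top (μ := volume) (x := (0 : E3)) (r := n)⟩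
  exact (hf.restrict _).integrable (by norm_num)

lemma eventually_mem_ball (x : E3) : ∀ᶠ n : ℕ in atTop, x ∈ Metric.ball (0 : E3) n := by
  obtain ⟨m, hm⟩ := exists_nat_gt ‖x‖
  filter_upwards [eventually_ge_atTop m] with n hn
  rw [mem_ball_zero_iff]
  exact hm.trans_le (by exact_mod_cast hn)

/-- The weighted estimate makes truncation to balls harmless uniformly in `δ` and `a`; truncated
functions are in `L¹`, where the dispersive estimate is available. -/
lemma exists_resForm_approx {s : ℝ} (hs : 1 / 2 < s) {f g : E3 → ℂ} (hf : MemZ s f)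
    (hg : MemZ s g) {ε : ℝ} (hε : 0 < ε) :
    ∃ n : ℕ, ∀ {δ : ℝ}, 0 < δ → ∀ a, ‖multForm (resMult δ a) f g -
      multForm (resMult δ a) ((Metric.ball (0 : E3) n).indicator f)
        ((Metric.ball (0 : E3) n).indicator g)‖ ≤ ε := by
  obtain ⟨C, hC0, hC⟩ := exists_norm_resForm_le hs
  have hA : ∀ n : ℕ, MeasurableSet (Metric.ball (0 : E3) n) := fun n => measurableSet_ball
  have h1 : Tendsto (fun n : ℕ => normZ s ((Metric.ball (0 : E3) n)ᶜ.indicator f)) atTop (𝓝 0) := by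
    have := tendsto_nrm_sub_indicator hf hA eventually_mem_ball
    simpa only [normZ, weighted_indicator] using this
  have h2 : Tendsto (fun n : ℕ => normZ s ((Metric.ball (0 : E3) n)ᶜ.indicator g)) atTop (𝓝 0) := by
    have := tendsto_nrm_sub_indicator hg hA eventually_mem_ball
    simpa only [normZ, weighted_indicator] using this
  have h3 : Tendsto (fun n : ℕ => C * (normZ s ((Metric.ball (0 : E3) n)ᶜ.indicator f) * normZ s g) +
      C * (normZ s f * normZ s ((Metric.ball (0 : E3) n)ᶜ.indicator g))) atTop (𝓝 0) := by
    have := ((h1.mul_const (normZ s g)).const_mul C).add ((h2.const_mul (normZ s f)).const_mul C)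
    simpa using this
  obtain ⟨n, hn⟩ := (h3.eventually (ge_mem_nhds hε)).exists
  refine ⟨n, fun {δ} hδ a => ?_⟩
  have hs0 : 0 ≤ s := by linarith
  have hm := bddMult_resMult hδ a
  have fA := hf.indicator (hA n)
  have fA' := hf.indicator (hA n).compl
  have gA := hg.indicator (hA n)
  have gA' := hg.indicator (hA n).compl
  have e1 : multForm (resMult δ a) f g =
      multForm (resMult δ a) ((Metric.ball (0 : E3) n).indicator f)
        ((Metric.ball (0 : E3) n).indicator g) +
      multForm (resMult δ a) ((Metric.ball (0 : E3) n).indicator f)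
        ((Metric.ball (0 : E3) n)ᶜ.indicator g) +
      multForm (resMult δ a) ((Metric.ball (0 : E3) n)ᶜ.indicator f) g := by
    rw [← multForm_add_right hm _ (gA.memLp hs0) (gA'.memLp hs0), indicator_add_compl,
      ← multForm_add_left hm (fA.memLp hs0) (fA'.memLp hs0), indicator_add_compl]
  rw [e1]
  have e2 : ∀ x y z : ℂ, x + y + z - x = z + y := fun x y z => by ring
  rw [e2]
  refine ((norm_add_le _ _).trans (add_le_add (hC hδ a fA' hg) ((hC hδ a fA gA').trans ?_))).trans hn
  have h5 : normZ s ((Metric.ball (0 : E3) n).indicator f) ≤ normZ s f := by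
    rw [normZ, weighted_indicator]
    exact nrm_mono hf (Eventually.of_forall fun x => norm_indicator_le_norm_self _ _)
  have := nrm_nonneg (weighted s ((Metric.ball (0 : E3) n)ᶜ.indicator g))
  rw [← normZ] at this
  gcongr

lemma exists_tendsto_of_approx {ι : Type*} {l : Filter ι} [l.NeBot] {F : ι → ℂ}
    (h : ∀ ε > 0, ∃ (G : ι → ℂ) (L : ℂ), Tendsto G l (𝓝 L) ∧ ∀ᶠ i in l, ‖F i - G i‖ ≤ ε) :
    ∃ L, Tendsto F l (𝓝 L) := by
  rw [← cauchy_map_iff_exists_tendsto, Metric.cauchy_iff]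
  refine ⟨inferInstance, fun ε hε => ?_⟩
  obtain ⟨G, L, hG, hFG⟩ := h (ε / 5) (by positivity)
  have h1 := (Metric.tendsto_nhds.1 hG) (ε / 5) (by positivity)
  refine ⟨F '' {i | ‖F i - G i‖ ≤ ε / 5 ∧ dist (G i) L < ε / 5}, ?_, ?_⟩
  · exact image_mem_map (hFG.and h1)
  · rintro _ ⟨i, hi, rfl⟩ _ ⟨j, hj, rfl⟩
    have a1 : dist (F i) (G i) ≤ ε / 5 := by rw [dist_eq_norm]; exact hi.1
    have a2 : dist (G j) (F j) ≤ ε / 5 := by rw [dist_comm, dist_eq_norm]; exact hj.1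
    have a3 : dist L (G j) < ε / 5 := by rw [dist_comm]; exact hj.2
    have := dist_triangle4 (F i) (G i) L (F j)
    have := dist_triangle L (G j) (F j)
    linarith [hi.2]

lemma tendsto_zero_of_approx {ι : Type*} {l : Filter ι} {F : ι → ℂ}
    (h : ∀ ε > 0, ∃ G : ι → ℂ, Tendsto G l (𝓝 0) ∧ ∀ᶠ i in l, ‖F i - G i‖ ≤ ε) :
    Tendsto F l (𝓝 0) := by
  rw [Metric.tendsto_nhds]
  intro ε hε
  obtain ⟨G, hG, hFG⟩ := h (ε / 2) (by positivity)
  filter_upwards [hFG, (Metric.tendsto_nhds.1 hG) (ε / 2) (by positivity)] with i h1 h2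
  rw [dist_zero_right] at h2 ⊢
  have := norm_add_le (F i - G i) (G i)
  rw [sub_add_cancel] at this
  linarith

/-- Limiting absorption: the resolvent form converges as the absorption vanishes. -/
lemma exists_tendsto_resForm {s : ℝ} (hs : 1 / 2 < s) {f g : E3 → ℂ} (hf : MemZ s f)
    (hg : MemZ s g) :
    ∃ L, Tendsto (fun δ => multForm (resMult δ 0) f g) (𝓝[>] 0) (𝓝 L) := by
  have hs0 : 0 ≤ s := by linarith
  refine exists_tendsto_of_approx fun ε hε => ?_
  obtain ⟨n, hn⟩ := exists_resForm_approx hs hf hg hε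
  have hf' := hf.memLp hs0
  have hg' := hg.memLp hs0
  refine ⟨_, _, tendsto_resForm_of_integrable (a := fun _ => 0)
    (tendsto_id.mono_left nhdsWithin_le_nhds) self_mem_nhdsWithin
    (hf'.indicator measurableSet_ball) (hg'.indicator measurableSet_ball)
    (integrable_indicator_ball hf' n) (integrable_indicator_ball hg' n)
    (fun τ _ => tendsto_const_nhds), ?_⟩
  filter_upwards [self_mem_nhdsWithin] with δ hδ
  exact hn hδ 0

/-- Two sources that drift apart do not interact in the limit. -/
lemma tendsto_resForm_cocompact {s : ℝ} (hs : 1 / 2 < s) {f g : E3 → ℂ} (hf : MemZ s f)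
    (hg : MemZ s g) {ι : Type*} {l : Filter ι} [l.IsCountablyGenerated]
    {δ : ι → ℝ} {a : ι → E3} (hδ : Tendsto δ l (𝓝 0)) (hδ0 : ∀ᶠ i in l, 0 < δ i)
    (ha : Tendsto a l (cocompact E3)) :
    Tendsto (fun i => multForm (resMult (δ i) (a i)) f g) l (𝓝 0) := by
  have hs0 : 0 ≤ s := by linarith
  refine tendsto_zero_of_approx fun ε hε => ?_
  obtain ⟨n, hn⟩ := exists_resForm_approx hs hf hg hε
  have hf' := hf.memLp hs0
  have hg' := hg.memLp hs0
  have ht := tendsto_resForm_of_integrable (a := a) (J := fun _ => 0) hδ hδ0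
    (hf'.indicator measurableSet_ball) (hg'.indicator measurableSet_ball)
    (integrable_indicator_ball hf' n) (integrable_indicator_ball hg' n)
    (fun τ _ => (tendsto_schrodForm_cocompact τ _ _).comp ha)
  simp only [integral_zero, mul_zero] at ht
  refine ⟨_, ht, ?_⟩
  filter_upwards [hδ0] with i hi
  exact hn hi (a i)

/-! ### The outgoing solution -/

lemma memLp_regularizedHat (S : E3 → ℂ) {δ : ℝ} (hδ : 0 < δ) :
    MemLp (regularizedHat S δ) 2 volume := by
  have h := (bddMult_resMult hδ 0).memLp_mul (memLp_hatL2 S)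
  have e : regularizedHat S δ = fun ξ => -(resMult δ 0 ξ * hatL2 S ξ) := by
    ext ξ
    simp [regularizedHat, resMult, symb]
    ring
  rw [e]; exact h.neg

lemma integral_regularizedHat (S g : E3 → ℂ) (δ : ℝ) :
    ∫ ξ, regularizedHat S δ ξ * conj (hatL2 g ξ) = -multForm (resMult δ 0) S g := by
  rw [multForm, ← integral_neg]
  refine integral_congr_ae (Eventually.of_forall fun ξ => ?_)
  simp [regularizedHat, resMult, symb]
  ring

/-- `w` is the weak limit of the solutions with absorption, tested on the weighted space. -/
structure IsAbsorptionLimit (s : ℝ) (S w : E3 → ℂ) : Prop where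
  memLp : MemLp (weighted (-s) w) 2 volume
  tendsto : ∀ g, MemZ s g → Tendsto (fun δ => multForm (resMult δ 0) S g) (𝓝[>] 0)
    (𝓝 (-(2 * Real.pi : ℂ) ^ 3 * ∫ x, w x * conj (g x)))

lemma two_pi_pow_ne : (2 * Real.pi : ℂ) ^ 3 ≠ 0 := by
  exact_mod_cast (by positivity : (2 * Real.pi) ^ 3 ≠ 0)

lemma memZ_weighted_neg {s : ℝ} {h : E3 → ℂ} (hh : MemLp h 2 volume) :
    MemZ s (weighted (-s) h) := by
  rw [MemZ, weighted_weighted, add_neg_cancel, weighted_zero]; exact hh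

lemma weighted_mul_conj (s : ℝ) (f g : E3 → ℂ) (x : E3) :
    weighted s f x * conj (g x) = f x * conj (weighted s g x) := by
  simp only [weighted, map_mul, Complex.conj_ofReal]; ring

/-- Seen through the weight, the solutions with absorption are functionals on `L²` that converge
pointwise by `exists_tendsto_resForm`. By Banach–Steinhaus the limit is continuous, and the Riesz
representation yields `v ∈ L²` with `w = ⟨x⟩^s v`. -/
lemma exists_absorptionLimit {s : ℝ} (hs : 1 / 2 < s) {S : E3 → ℂ} (hS : MemZ s S) :
    ∃ w, IsAbsorptionLimit s S w := by
  have hs0 : 0 ≤ s := by linarith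
  have hw : ∀ δ : ℝ, ∃ w : E3 → ℂ, MemLp w 2 volume ∧ (0 < δ →
      hatL2 w =ᵐ[volume] regularizedHat S δ) := by
    intro δ
    by_cases hδ : 0 < δ
    · obtain ⟨w, h1, h2⟩ := exists_hatL2_eq (memLp_regularizedHat S hδ)
      exact ⟨w, h1, fun _ => h2⟩
    · exact ⟨fun _ => 0, MemLp.zero', fun h => absurd h hδ⟩
  choose w hwL hwh using hw
  have hpair : ∀ {δ : ℝ}, 0 < δ → ∀ {g : E3 → ℂ}, MemLp g 2 volume →
      (2 * Real.pi : ℂ) ^ 3 * ∫ x, w δ x * conj (g x) = -multForm (resMult δ 0) S g := by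
    intro δ hδ g hg
    rw [← integral_hatL2_mul_conj (hwL δ) hg, ← integral_regularizedHat]
    exact integral_congr_ae ((hwh δ hδ).mono fun ξ hξ => by simp only [hξ])
  have hv : ∀ δ, MemLp (weighted (-s) (w δ)) 2 volume := fun δ =>
    MemZ.mono (by linarith : -s ≤ 0) (by rw [MemZ, weighted_zero]; exact hwL δ)
  let T : ℝ → (Lp (α := E3) ℂ 2 volume →L[ℂ] ℂ) := fun δ => innerSL ℂ ((hv δ).toLp _)
  have hT : ∀ δ (h : Lp (α := E3) ℂ 2 volume),
      T δ h = conj (∫ x, w δ x * conj (weighted (-s) h x)) := by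
    intro δ h
    simp only [T, innerSL_apply_apply]
    rw [L2.inner_def, ← integral_conj]
    refine integral_congr_ae ?_
    filter_upwards [(hv δ).coeFn_toLp] with x hx
    rw [RCLike.inner_apply, hx, ← weighted_mul_conj, map_mul, Complex.conj_conj, mul_comm]
  have hlim : ∀ h : Lp (α := E3) ℂ 2 volume, ∃ L, Tendsto (fun δ => T δ h) (𝓝[>] 0) (𝓝 L) := by
    intro h
    have hZ : MemZ s (weighted (-s) h) := memZ_weighted_neg (Lp.memLp h)
    obtain ⟨L, hL⟩ := exists_tendsto_resForm hs hS hZ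
    refine ⟨conj ((2 * Real.pi : ℂ)⁻¹ ^ 3 * -L), ?_⟩
    refine ((Complex.continuous_conj.tendsto _).comp ((hL.neg).const_mul _)).congr' ?_
    filter_upwards [self_mem_nhdsWithin] with δ hδ
    rw [hT, Function.comp_apply, ← hpair hδ (hZ.memLp hs0), ← mul_assoc, inv_pow,
      inv_mul_cancel₀ two_pi_pow_ne, one_mul]
  choose ℓ hℓ using hlim
  let ℓ' : Lp (α := E3) ℂ 2 volume →L[ℂ] ℂ :=
    continuousLinearMapOfTendsto (l := 𝓝[>] (0 : ℝ)) T (f := ℓ) (tendsto_pi_nhds.2 hℓ)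
  have hℓ' : ∀ h, ℓ' h = ℓ h := fun h => rfl
  let v : Lp (α := E3) ℂ 2 volume := (InnerProductSpace.toDual ℂ _).symm ℓ'
  have hvv : ∀ h, inner ℂ v h = ℓ h := fun h => by
    rw [← hℓ']; exact InnerProductSpace.toDual_symm_apply
  refine ⟨weighted s v, ?_, fun g hg => ?_⟩
  · rw [weighted_weighted, neg_add_cancel, weighted_zero]; exact Lp.memLp v
  · have h1 := hℓ (MemLp.toLp _ hg)
    rw [← hvv] at h1
    have e1 : ∫ x, weighted s v x * conj (g x) = conj (inner ℂ v (MemLp.toLp _ hg)) := by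
      rw [L2.inner_def, ← integral_conj]
      refine integral_congr_ae ?_
      filter_upwards [MemLp.coeFn_toLp hg] with x hx
      rw [weighted_mul_conj, RCLike.inner_apply, hx, map_mul, Complex.conj_conj, mul_comm]
    rw [e1]
    refine (((Complex.continuous_conj.tendsto _).comp h1).const_mul _).congr' ?_
    filter_upwards [self_mem_nhdsWithin] with δ hδ
    rw [Function.comp_apply, hT, Complex.conj_conj, neg_mul]
    have e2 : ∫ x, w δ x * conj (weighted (-s) (MemLp.toLp _ hg) x) =
        ∫ x, w δ x * conj (g x) := by
      refine integral_congr_ae ?_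
      filter_upwards [MemLp.coeFn_toLp hg] with x hx
      have : weighted (-s) (MemLp.toLp _ hg) x = weighted (-s) (weighted s g) x := by
        rw [weighted, weighted, hx]
      rw [this, weighted_weighted, neg_add_cancel, weighted_zero]
    rw [e2, hpair hδ (hg.memLp hs0), neg_neg]

namespace IsAbsorptionLimit

variable {s : ℝ} {S w : E3 → ℂ}

lemma aestronglyMeasurable (h : IsAbsorptionLimit s S w) : AEStronglyMeasurable w volume := by
  have := aestronglyMeasurable_weighted h.memLp.1 s
  rwa [weighted_weighted, add_neg_cancel, weighted_zero] at this

lemma tendsto_regularizedHat (h : IsAbsorptionLimit s S w) {g : E3 → ℂ} (hg : MemZ s g) :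
    Tendsto (fun δ => ∫ ξ, regularizedHat S δ ξ * conj (hatL2 g ξ)) (𝓝[>] 0)
      (𝓝 ((2 * Real.pi : ℂ) ^ 3 * ∫ x, w x * conj (g x))) := by
  simp_rw [integral_regularizedHat]
  simpa using (h.tendsto g hg).neg

end IsAbsorptionLimit

lemma japanese_le_of_norm_le {x : E3} {R : ℝ} (hR : 1 ≤ R) (hx : ‖x‖ ≤ R) : japanese x ≤ 2 * R := by
  rw [japanese, Real.sqrt_le_left (by linarith)]
  nlinarith [norm_nonneg x]

lemma annulus_subset {k : ℕ} {x : E3} (hx : x ∈ annulus k) : ‖x‖ < 2 ^ k := by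
  cases k with
  | zero => simpa [annulus] using hx
  | succ k => exact hx.2

lemma measurableSet_annulus (k : ℕ) : MeasurableSet (annulus k) := by
  cases k with
  | zero => exact measurableSet_ball
  | succ k =>
    exact (measurableSet_le measurable_const measurable_norm).inter
      (measurableSet_lt measurable_norm measurable_const)

lemma half_pow_le_japanese {k : ℕ} {x : E3} (hx : x ∈ annulus k) : 2 ^ k / 2 ≤ japanese x := by
  cases k with
  | zero => have := one_le_japanese x; norm_num; linarith
  | succ k =>
    have h1 : 2 ^ k ≤ ‖x‖ := hx.1
    rw [pow_succ, mul_div_cancel_right₀ _ two_ne_zero]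
    exact h1.trans (norm_le_japanese x)

lemma lintegral_annulus_eq (f : E3 → ℂ) (k : ℕ) :
    ∫⁻ x in annulus k, ‖f x‖ₑ ^ 2 = eLpNorm ((annulus k).indicator f) 2 volume ^ 2 := by
  rw [eLpNorm_two_sq, ← lintegral_indicator (measurableSet_annulus k)]
  refine lintegral_congr fun x => ?_
  by_cases hx : x ∈ annulus k <;> simp [hx]

/-- Duality: test `w` on its own restriction `g` to a ring. The pairing is `‖g‖²`, while the
estimate on the ball of radius `2^k` bounds it by a constant times `2^{k/2} ‖g‖`; one factor `‖g‖`
is divided out. -/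
lemma IsAbsorptionLimit.memBStar {s : ℝ} (hs : 1 / 2 < s) {S w : E3 → ℂ} (hS : MemZ s S)
    (h : IsAbsorptionLimit s S w) : MemBStar w := by
  have hs0 : 0 ≤ s := by linarith
  obtain ⟨C, hC0, hC⟩ := exists_norm_resForm_ball_le hs
  refine ⟨h.aestronglyMeasurable, ?_⟩
  set M : ℝ := ((2 * Real.pi) ^ 3)⁻¹ * (C * normZ s S) with hM
  have hM0 : 0 ≤ M := mul_nonneg (by positivity) (mul_nonneg hC0 (nrm_nonneg _))
  refine lt_of_le_of_lt (iSup_le fun k => ?_)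
    (ENNReal.ofReal_lt_top (r := Real.sqrt (2 * M ^ 2)))
  set g := (annulus k).indicator w with hgdef
  have hgZ : MemZ s g := by
    have hm := (aestronglyMeasurable_weighted h.aestronglyMeasurable s).indicator
      (measurableSet_annulus k)
    rw [MemZ, weighted_indicator]
    -- On the ring `⟨x⟩ ≤ 2 · 2^k`, so passing from the weight `⟨x⟩^{-s}`, under which `w` is in
    -- `L²`, to `⟨x⟩^s` costs a finite factor. Its dependence on `k` is irrelevant, since only
    -- membership is needed here.
    refine h.memLp.of_le_mul (c := (2 * 2 ^ k) ^ (2 * s)) hm (Eventually.of_forall fun x => ?_)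
    by_cases hx : x ∈ annulus k
    · rw [Set.indicator_of_mem hx, norm_weighted, norm_weighted, ← mul_assoc]
      refine mul_le_mul_of_nonneg_right ?_ (norm_nonneg _)
      have hj := japanese_pos x
      have h1 := japanese_le_of_norm_le (one_le_pow₀ one_le_two) (annulus_subset hx).le
      have h2 : japanese x ^ s = japanese x ^ (2 * s) * japanese x ^ (-s) := by
        rw [← Real.rpow_add hj]
        congr 1
        ring
      rw [h2]
      exact mul_le_mul_of_nonneg_right (Real.rpow_le_rpow hj.le h1 (by linarith))
        (Real.rpow_nonneg hj.le _)
    · rw [Set.indicator_of_notMem hx, norm_zero]; positivity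
  have hg2 := hgZ.memLp hs0
  have hint : ∫ x, w x * conj (g x) = ((nrm g ^ 2 : ℝ) : ℂ) := by
    rw [← integral_norm_sq_eq hg2, ← integral_complex_ofReal]
    refine integral_congr_ae (Eventually.of_forall fun x => ?_)
    by_cases hx : x ∈ annulus k
    · simp only [hgdef, Set.indicator_of_mem hx]
      rw [Complex.mul_conj, Complex.normSq_eq_norm_sq]
    · simp [hgdef, Set.indicator_of_notMem hx]
  have hle : (2 * Real.pi) ^ 3 * nrm g ^ 2 ≤ C * (normZ s S * (Real.sqrt (2 ^ k) * nrm g)) := by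
    have ht := (h.tendsto g hgZ).norm
    rw [hint] at ht
    have e : ‖-(2 * Real.pi : ℂ) ^ 3 * ((nrm g ^ 2 : ℝ) : ℂ)‖ = (2 * Real.pi) ^ 3 * nrm g ^ 2 := by
      rw [norm_mul, norm_neg, Complex.norm_real, Real.norm_of_nonneg (by positivity), norm_pow,
        norm_mul, Complex.norm_real, Real.norm_of_nonneg Real.pi_pos.le]
      simp
    rw [e] at ht
    refine le_of_tendsto ht ?_
    filter_upwards [self_mem_nhdsWithin] with δ hδ
    have hsupp : ∀ x, g x ≠ 0 → ‖x‖ < ((2 ^ k : ℕ) : ℝ) := by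
      intro x hx
      push_cast
      refine annulus_subset ?_
      by_contra hn
      exact hx (by simp [hgdef, hn])
    have := hC (δ := δ) hδ (R := 2 ^ k) hS hg2 hsupp
    push_cast at this
    exact this
  have hn : nrm g ≤ M * Real.sqrt (2 ^ k) := by
    rcases (nrm_nonneg g).eq_or_lt with h0 | h0
    · rw [← h0]; positivity
    · have hp : 0 < (2 * Real.pi) ^ 3 := by positivity
      rw [hM, mul_assoc, ← div_eq_inv_mul, le_div_iff₀ hp]
      refine le_of_mul_le_mul_right ?_ h0
      calc _ = (2 * Real.pi) ^ 3 * nrm g ^ 2 := by ring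
        _ ≤ _ := hle
        _ = _ := by ring
  rw [lintegral_annulus_eq, ← hgdef, ← ENNReal.ofReal_toReal hg2.2.ne, ← nrm, one_div]
  rw [Real.sqrt_eq_rpow, ← ENNReal.ofReal_rpow_of_nonneg (by positivity) (by norm_num), one_div]
  refine ENNReal.rpow_le_rpow ?_ (by norm_num)
  have h2k : (2 / 2 ^ k : ℝ≥0∞) = ENNReal.ofReal (2 / 2 ^ k) := by
    rw [ENNReal.ofReal_div_of_pos (by positivity), ENNReal.ofReal_pow (by norm_num)]
    simp
  rw [h2k, ← ENNReal.ofReal_pow (nrm_nonneg _), ← ENNReal.ofReal_mul (by positivity)]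
  refine ENNReal.ofReal_le_ofReal ?_
  calc 2 / 2 ^ k * nrm g ^ 2 ≤ 2 / 2 ^ k * (M * Real.sqrt (2 ^ k)) ^ 2 := by
        have := nrm_nonneg g
        gcongr
    _ = 2 * M ^ 2 := by
        rw [mul_pow, Real.sq_sqrt (by positivity)]; field_simp

/-- For `s ≤ 2` the weight is dominated by the polynomial `1 + ‖x‖²`. -/
lemma memZ_schwartz {s : ℝ} (hs : s ≤ 2) (φ : 𝓢(E3, ℂ)) : MemZ s φ := by
  have ht : (fun x : E3 => ((1 + ‖x‖ ^ 2 : ℝ) : ℂ)).HasTemperateGrowth := by fun_prop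
  have hL := (SchwartzMap.smulLeftCLM ℂ (fun x : E3 => ((1 + ‖x‖ ^ 2 : ℝ) : ℂ)) φ).memLp 2 volume
  refine hL.of_le (aestronglyMeasurable_weighted φ.continuous.aestronglyMeasurable s)
    (Eventually.of_forall fun x => ?_)
  rw [SchwartzMap.smulLeftCLM_apply_apply ht, norm_weighted, smul_eq_mul, norm_mul,
    Complex.norm_real, Real.norm_of_nonneg (by positivity)]
  refine mul_le_mul_of_nonneg_right ?_ (norm_nonneg _)
  refine (Real.rpow_le_rpow_of_exponent_le (one_le_japanese x) hs).trans (le_of_eq ?_)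
  rw [Real.rpow_two, japanese, Real.sq_sqrt (by positivity)]

lemma MemZ.conj {s : ℝ} {f : E3 → ℂ} (hf : MemZ s f) : MemZ s (fun x => conj (f x)) := by
  have : weighted s (fun x => conj (f x)) = fun x => conj (weighted s f x) := by
    ext x; simp [weighted]
  rw [MemZ, this]; exact memLp_conj hf

lemma MemZ.const_mul {s : ℝ} {f : E3 → ℂ} (hf : MemZ s f) (c : ℂ) : MemZ s (fun x => c * f x) := by
  have : weighted s (fun x => c * f x) = fun x => c * weighted s f x := by
    ext x; simp only [weighted]; ring
  rw [MemZ, this]; exact MemLp.const_mul hf c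

lemma conj_hat (φ : E3 → ℂ) (x : E3) : conj (hat φ x) = hat (fun ξ => conj (φ ξ)) (-x) := by
  rw [hat, hat, ← integral_conj]
  refine integral_congr_ae (Eventually.of_forall fun ξ => ?_)
  simp [← Complex.exp_conj]

/-- Convergence of the regularized transforms as tempered distributions. -/
lemma IsAbsorptionLimit.tendsto_schwartz {s : ℝ} (hs2 : s ≤ 2) {S w : E3 → ℂ}
    (h : IsAbsorptionLimit s S w) (φ : 𝓢(E3, ℂ)) :
    Tendsto (fun δ : ℝ => ∫ ξ, regularizedHat S δ ξ * φ ξ) (𝓝[>] 0)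
        (𝓝 (∫ x, w x * hat φ x)) := by
  have hc2 : MemLp (fun ξ => conj (φ ξ)) 2 volume := memLp_conj (φ.memLp 2)
  have hc1 : Integrable (fun ξ => conj (φ ξ)) volume := integrable_conj φ.integrable
  obtain ⟨-, g2⟩ := hatL2_invHat hc2 hc1
  have hg : invHat (fun ξ => conj (φ ξ)) =
      fun x => (2 * Real.pi : ℂ)⁻¹ ^ 3 * conj (hatS φ x) := by
    ext x
    rw [invHat_eq_hat, hatS_apply, conj_hat]
  have hgZ : MemZ s (invHat fun ξ => conj (φ ξ)) := by
    rw [hg]; exact (memZ_schwartz hs2 (hatS φ)).conj.const_mul _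
  have ht := h.tendsto_regularizedHat hgZ
  have e : (2 * Real.pi : ℂ) ^ 3 * ∫ x, w x * conj (invHat (fun ξ => conj (φ ξ)) x) =
      ∫ x, w x * hat φ x := by
    rw [← integral_const_mul]
    refine integral_congr_ae (Eventually.of_forall fun x => ?_)
    simp only [hg, map_mul, Complex.conj_conj, hatS_apply, map_pow, map_inv₀, Complex.conj_ofReal,
      Complex.conj_ofNat]
    have := two_pi_pow_ne
    rw [inv_pow]
    field_simp
  rw [e] at ht
  refine ht.congr fun δ => integral_congr_ae ?_
  filter_upwards [g2] with ξ hξ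
  rw [hξ, Complex.conj_conj]

/-- In frequency `Δ + 1` is multiplication by `-(‖ξ‖² - 1)`. The quotient `(‖ξ‖² - 1)/(‖ξ‖² - 1 +
iδ)` is bounded by `1` and tends to `1` off the unit sphere, a null set, so dominated convergence
applies. -/
lemma IsAbsorptionLimit.isWeakHelmholtz {s : ℝ} (hs2 : s ≤ 2) {S w : E3 → ℂ}
    (hS : MemLp S 2 volume) (h : IsAbsorptionLimit s S w) : IsWeakHelmholtz 0 1 S w := by
  intro φ
  have ht := h.tendsto_schwartz hs2 (invHatS (Δ φ + φ))
  rw [← coe_hatS, hatS_invHatS] at ht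
  have e1 : ∫ x, w x * (-Complex.I * (0 : ℝ) * φ x + (Δ φ) x + (1 : ℝ) * φ x) =
      ∫ x, w x * (Δ φ + φ) x := by
    refine integral_congr_ae (Eventually.of_forall fun x => ?_)
    simp
  rw [e1, integral_mul_schwartz hS]
  refine tendsto_nhds_unique ht ?_
  have hI : Integrable (fun ξ => hatL2 S ξ * invHatS φ ξ) volume :=
    integrable_mul_of_memLp (memLp_hatL2 S) ((invHatS φ).memLp 2)
  refine tendsto_integral_filter_of_dominated_convergence
    (fun ξ => ‖hatL2 S ξ * invHatS φ ξ‖) ?_ ?_ hI.norm ?_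
  · filter_upwards [self_mem_nhdsWithin] with δ hδ
    exact (memLp_regularizedHat S hδ).1.mul (invHatS (Δ φ + φ)).continuous.aestronglyMeasurable
  · filter_upwards [self_mem_nhdsWithin] with δ hδ
    refine Eventually.of_forall fun ξ => ?_
    have hs := norm_pos_iff.2 (symb_ne_zero (show 0 < δ from hδ) ξ)
    have e2 : regularizedHat S δ ξ * invHatS (Δ φ + φ) ξ =
        (((‖ξ‖ ^ 2 - 1 : ℝ) : ℂ) / symb δ ξ) * (hatL2 S ξ * invHatS φ ξ) := by
      rw [invHatS_add, _root_.add_apply, invHatS_laplacian, regularizedHat, ← symb]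
      push_cast; ring
    rw [e2, norm_mul]
    refine mul_le_of_le_one_left (norm_nonneg _) ?_
    rw [norm_div, div_le_one hs, Complex.norm_real]
    have : (symb δ ξ).re = ‖ξ‖ ^ 2 - 1 := by
      rw [symb, Complex.add_re, Complex.ofReal_re]; simp
    rw [← this, Real.norm_eq_abs]
    exact Complex.abs_re_le_norm _
  · have hsph : ∀ᵐ ξ : E3, ‖ξ‖ ≠ 1 := by
      have h0 := Measure.addHaar_sphere (volume : Measure E3) 0 1
      rw [measure_eq_zero_iff_ae_notMem] at h0
      filter_upwards [h0] with ξ hξ h1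
      exact hξ (by simpa using h1)
    filter_upwards [hsph] with ξ hξ
    have hne : ((‖ξ‖ ^ 2 - 1 : ℝ) : ℂ) ≠ 0 := by
      rw [Complex.ofReal_ne_zero]
      intro h0
      have : (‖ξ‖ - 1) * (‖ξ‖ + 1) = 0 := by linarith
      rcases mul_eq_zero.1 this with h1 | h1
      · exact hξ (by linarith)
      · linarith [norm_nonneg ξ]
    have hcont : Tendsto (fun δ : ℝ => regularizedHat S δ ξ) (𝓝[>] 0) (𝓝 (regularizedHat S 0 ξ)) := by
      have : ContinuousAt (fun δ : ℝ => regularizedHat S δ ξ) 0 := by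
        unfold regularizedHat
        refine ContinuousAt.div (by fun_prop) (by fun_prop) ?_
        simpa using hne
      exact this.tendsto.mono_left nhdsWithin_le_nhds
    have e3 : hatL2 S ξ * invHatS φ ξ = regularizedHat S 0 ξ * invHatS (Δ φ + φ) ξ := by
      rw [invHatS_add, _root_.add_apply, invHatS_laplacian, regularizedHat, Complex.ofReal_zero,
        mul_zero, add_zero]
      field_simp
      push_cast; ring
    rw [e3]
    exact hcont.mul_const _

lemma IsAbsorptionLimit.isOutgoingSolution {s : ℝ} (hs : 1 / 2 < s) (hs2 : s ≤ 2) {S w : E3 → ℂ}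
    (hS : MemZ s S) (h : IsAbsorptionLimit s S w) : IsOutgoingSolution S w :=
  ⟨h.memBStar hs hS, h.isWeakHelmholtz hs2 (hS.memLp (by linarith)), h.tendsto_schwartz hs2⟩

/-- On ring `k` one has `⟨x⟩ ≥ 2^k/2`, so the `k`-th term is at most a constant times `2^{k(1/2 -
s)}`, a convergent geometric series as `s > 1/2`. -/
lemma memB_of_memZ {s : ℝ} (hs : 1 / 2 < s) {f : E3 → ℂ} (hf : MemZ s f) : MemB f := by
  refine ⟨hf.aestronglyMeasurable, ?_⟩
  set M := eLpNorm (weighted s f) 2 volume with hM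
  set r : ℝ := 2 ^ (1 / 2 - s) with hr
  have hr0 : 0 < r := by positivity
  have hr1 : r < 1 := Real.rpow_lt_one_of_one_lt_of_neg one_lt_two (by linarith)
  have hk : ∀ k : ℕ, (2 ^ k * ∫⁻ x in annulus k, ‖f x‖ₑ ^ 2) ^ (1 / 2 : ℝ) ≤
      ENNReal.ofReal (2 ^ s * r ^ k) * M := by
    intro k
    have h1 : eLpNorm ((annulus k).indicator f) 2 volume ≤
        ENNReal.ofReal ((2 ^ k / 2) ^ (-s)) * M := by
      refine eLpNorm_le_mul_eLpNorm_of_ae_le_mul (Eventually.of_forall fun x => ?_) 2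
      by_cases hx : x ∈ annulus k
      · rw [Set.indicator_of_mem hx, norm_weighted, ← mul_assoc]
        refine le_mul_of_one_le_left (norm_nonneg _) ?_
        rw [Real.rpow_neg (by positivity), ← div_eq_inv_mul, one_le_div (by positivity)]
        exact Real.rpow_le_rpow (by positivity) (half_pow_le_japanese hx) (by linarith)
      · rw [Set.indicator_of_notMem hx, norm_zero]; positivity
    rw [lintegral_annulus_eq, ENNReal.mul_rpow_of_nonneg _ _ (by norm_num), ← ENNReal.rpow_natCast _ 2,
      ← ENNReal.rpow_mul]
    have e1 : ((2 : ℕ) : ℝ) * (1 / 2) = 1 := by norm_num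
    rw [e1, ENNReal.rpow_one]
    refine (mul_le_mul_right h1 _).trans (le_of_eq ?_)
    rw [← mul_assoc]
    congr 1
    have e2 : ((2 : ℝ≥0∞) ^ k) ^ (1 / 2 : ℝ) = ENNReal.ofReal (((2 : ℝ) ^ k) ^ (1 / 2 : ℝ)) := by
      rw [← ENNReal.ofReal_rpow_of_nonneg (by positivity) (by norm_num),
        ENNReal.ofReal_pow (by norm_num)]
      simp
    rw [e2, ← ENNReal.ofReal_mul (by positivity)]
    congr 1
    have h2k : (0 : ℝ) < 2 ^ k := by positivity
    rw [Real.div_rpow h2k.le (by norm_num), Real.rpow_neg (by norm_num : (0 : ℝ) ≤ 2), div_inv_eq_mul,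
      ← mul_assoc, ← Real.rpow_add h2k, hr, ← Real.rpow_natCast, ← Real.rpow_mul (by norm_num),
      ← Real.rpow_natCast, ← Real.rpow_mul (by norm_num), mul_comm]
    congr 2
    ring
  refine lt_of_le_of_lt (ENNReal.tsum_le_tsum hk) ?_
  rw [ENNReal.tsum_mul_right]
  refine ENNReal.mul_lt_top ?_ hf.2
  have hsum : Summable fun k : ℕ => 2 ^ s * r ^ k :=
    (summable_geometric_of_lt_one hr0.le hr1).mul_left _
  exact hsum.tsum_ofReal_lt_top

lemma IsAbsorptionLimit.isFourierIntegral {s : ℝ} (hs : 1 / 2 < s) {S w g : E3 → ℂ}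
    (h : IsAbsorptionLimit s S w) (hg2 : MemLp g 2 volume) (hg1 : Integrable g volume)
    (hgZ : MemZ s (invHat g)) :
    IsFourierIntegral S w g ((2 * Real.pi : ℂ) ^ 3 * ∫ x, conj (w x) * invHat g x) := by
  refine ⟨memB_of_memZ hs hgZ, rfl, ?_⟩
  obtain ⟨-, g2⟩ := hatL2_invHat hg2 hg1
  have ht := (Complex.continuous_conj.tendsto _).comp (h.tendsto_regularizedHat hgZ)
  have e : conj ((2 * Real.pi : ℂ) ^ 3 * ∫ x, w x * conj (invHat g x)) =
      (2 * Real.pi : ℂ) ^ 3 * ∫ x, conj (w x) * invHat g x := by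
    rw [map_mul, ← integral_conj]
    simp [Complex.conj_ofNat]
  rw [e] at ht
  refine ht.congr fun δ => ?_
  rw [Function.comp_apply, ← integral_conj]
  refine integral_congr_ae ?_
  filter_upwards [g2] with ξ hξ
  rw [hξ, map_mul, Complex.conj_conj]

/-! ### Partial Fourier transforms of Schwartz functions -/

/-- The slice is `ψ`, translated, composed with the injection of the second factor, a linear map of
norm at most `1`. Schwartz seminorms of slices are thus bounded uniformly in `x`. -/
lemma norm_iteratedFDeriv_slice_le (ψ : 𝓢(E3 × E3, ℂ)) (x : E3) (n : ℕ) (ξ : E3) :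
    ‖iteratedFDeriv ℝ n (fun ξ => ψ (x, ξ)) ξ‖ ≤ ‖iteratedFDeriv ℝ n ψ (x, ξ)‖ := by
  have e : (fun ξ => ψ (x, ξ)) = (fun p => ψ (p + (x, 0))) ∘ ContinuousLinearMap.inr ℝ E3 E3 := by
    ext ξ; simp
  have hψ : ContDiff ℝ n fun p => ψ (p + (x, 0)) := (ψ.smooth n).comp (by fun_prop)
  rw [e, ContinuousLinearMap.iteratedFDeriv_comp_right _ hψ ξ le_rfl, iteratedFDeriv_comp_add_right]
  refine (ContinuousMultilinearMap.norm_compContinuousLinearMap_le _ _).trans ?_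
  have h1 : ‖ContinuousLinearMap.inr ℝ E3 E3‖ ≤ 1 :=
    ContinuousLinearMap.opNorm_le_bound _ zero_le_one fun y => by simp
  have h2 : ∏ _i : Fin n, ‖ContinuousLinearMap.inr ℝ E3 E3‖ ≤ 1 :=
    Finset.prod_le_one (fun _ _ => norm_nonneg _) fun _ _ => h1
  calc _ ≤ ‖iteratedFDeriv ℝ n ψ (ContinuousLinearMap.inr ℝ E3 E3 ξ + (x, 0))‖ * 1 :=
        mul_le_mul_of_nonneg_left h2 (norm_nonneg _)
    _ = _ := by simp

lemma slice_decay (ψ : 𝓢(E3 × E3, ℂ)) (x : E3) (k n : ℕ) (ξ : E3) :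
    ‖ξ‖ ^ k * ‖iteratedFDeriv ℝ n (fun ξ => ψ (x, ξ)) ξ‖ ≤ SchwartzMap.seminorm ℂ k n ψ := by
  refine le_trans ?_ (SchwartzMap.le_seminorm ℂ k n ψ (x, ξ))
  gcongr
  · exact norm_snd_le (x, ξ)
  · exact norm_iteratedFDeriv_slice_le ψ x n ξ

/-- The Schwartz function `ψ(x, ·)`. -/
def slice (ψ : 𝓢(E3 × E3, ℂ)) (x : E3) : 𝓢(E3, ℂ) where
  toFun ξ := ψ (x, ξ)
  smooth' := by
    have h : ContDiff ℝ ⊤ fun ξ : E3 => ((x, ξ) : E3 × E3) := by fun_prop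
    exact (ψ.smooth ⊤).comp (h.of_le (by simp))
  decay' k n := ⟨_, slice_decay ψ x k n⟩

lemma coe_slice (ψ : 𝓢(E3 × E3, ℂ)) (x : E3) : ⇑(slice ψ x) = fun ξ => ψ (x, ξ) := rfl

/-- The partial Fourier transform of `ψ` in its second variable. -/
def partialHat (ψ : 𝓢(E3 × E3, ℂ)) (x y : E3) : ℂ := hat (fun ξ => ψ (x, ξ)) y

/-- This is the continuity of the Fourier transform on Schwartz space, in quantitative form. -/
lemma exists_norm_hatS_le (m : ℕ) : ∃ (F : Finset (ℕ × ℕ)) (C : ℝ), 0 ≤ C ∧ ∀ (φ : 𝓢(E3, ℂ)) (y : E3),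
    (1 + ‖y‖) ^ m * ‖hatS φ y‖ ≤ C * (F.sup (schwartzSeminormFamily ℂ E3 ℂ)) φ := by
  let A : 𝓢(E3, ℂ) →L[ℂ] 𝓢(E3, ℂ) :=
    (SchwartzMap.compCLMOfContinuousLinearEquiv ℂ dilation.symm).comp
      (FourierTransform.fourierCLM ℂ 𝓢(E3, ℂ))
  have hA : ∀ φ, A φ = hatS φ := fun φ => rfl
  let p : Seminorm ℂ 𝓢(E3, ℂ) := (Finset.Iic (m, 0)).sup (schwartzSeminormFamily ℂ E3 ℂ)
  have hp : Continuous p :=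
    (schwartz_withSeminorms ℂ E3 ℂ).finset_sups.continuous_seminorm _
  obtain ⟨F, C, -, hC⟩ := Seminorm.bound_of_continuous (schwartz_withSeminorms ℂ E3 ℂ)
    (p.comp A.toLinearMap) (hp.comp A.continuous)
  refine ⟨F, 2 ^ m * C, by positivity, fun φ y => ?_⟩
  have h1 := SchwartzMap.one_add_le_sup_seminorm_apply (𝕜 := ℂ) (m := (m, 0)) (k := m) (n := 0)
    le_rfl le_rfl (hatS φ) y
  rw [norm_iteratedFDeriv_zero] at h1
  refine h1.trans ?_
  rw [mul_assoc]
  refine mul_le_mul_of_nonneg_left ?_ (by positivity)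
  exact hC φ

/-- The exponent `6` leaves one power for Peetre's inequality and `5 > 3` for integrability on `ℝ³`.
-/
lemma exists_norm_partialHat_le : ∃ (F : Finset (ℕ × ℕ)) (C : ℝ), 0 ≤ C ∧
    ∀ (ψ : 𝓢(E3 × E3, ℂ)) (x y : E3),
      ‖partialHat ψ x y‖ ≤
        C * (F.sup (schwartzSeminormFamily ℂ (E3 × E3) ℂ)) ψ * japanese y ^ (-6 : ℝ) := by
  obtain ⟨F, C, hC0, hC⟩ := exists_norm_hatS_le 6
  refine ⟨F, C, hC0, fun ψ x y => ?_⟩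
  have h1 := hC (slice ψ x) y
  rw [hatS_apply, coe_slice] at h1
  have h2 : (F.sup (schwartzSeminormFamily ℂ E3 ℂ)) (slice ψ x) ≤
      (F.sup (schwartzSeminormFamily ℂ (E3 × E3) ℂ)) ψ := by
    refine Seminorm.finset_sup_apply_le (apply_nonneg _ _) fun i hi => ?_
    refine le_trans ?_ (Seminorm.le_finset_sup_apply hi)
    exact SchwartzMap.seminorm_le_bound ℂ i.1 i.2 _ (apply_nonneg _ _) (slice_decay ψ x i.1 i.2)
  have hj : japanese y ≤ 1 + ‖y‖ := by
    rw [japanese, Real.sqrt_le_left (by positivity)]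
    nlinarith [norm_nonneg y]
  have hjp := japanese_pos y
  rw [Real.rpow_neg hjp.le, ← div_eq_mul_inv, le_div_iff₀ (by positivity), mul_comm]
  refine le_trans ?_ (h1.trans (mul_le_mul_of_nonneg_left h2 hC0))
  refine mul_le_mul_of_nonneg_right ?_ (norm_nonneg _)
  rw [show (6 : ℝ) = ((6 : ℕ) : ℝ) by norm_num, Real.rpow_natCast]
  gcongr

lemma continuous_partialHat (ψ : 𝓢(E3 × E3, ℂ)) :
    Continuous fun p : E3 × E3 => partialHat ψ p.1 p.2 := by
  obtain ⟨C, hC⟩ : ∃ C : ℝ, ∀ p : E3 × E3, ‖ψ p‖ ≤ C * (1 + ‖p.2‖) ^ (-(4 : ℝ)) := by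
    refine ⟨2 ^ 4 * (Finset.Iic ((4, 0) : ℕ × ℕ)).sup
      (fun m => SchwartzMap.seminorm ℂ m.1 m.2) ψ, fun p => ?_⟩
    have h1 := SchwartzMap.one_add_le_sup_seminorm_apply (𝕜 := ℂ) (m := (4, 0)) (k := 4) (n := 0)
      le_rfl le_rfl ψ p
    rw [norm_iteratedFDeriv_zero] at h1
    rw [Real.rpow_neg (by positivity), ← div_eq_mul_inv, le_div_iff₀ (by positivity), mul_comm]
    refine le_trans (mul_le_mul_of_nonneg_right ?_ (norm_nonneg _)) h1
    rw [show (4 : ℝ) = ((4 : ℕ) : ℝ) by norm_num, Real.rpow_natCast]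
    gcongr
    exact norm_snd_le p
  refine continuous_of_dominated (bound := fun ξ : E3 => C * (1 + ‖ξ‖) ^ (-(4 : ℝ))) ?_ ?_ ?_ ?_
  · intro p
    exact (by fun_prop : Continuous fun ξ : E3 =>
      Complex.exp (-Complex.I * (⟪p.2, ξ⟫ : ℝ)) * ψ (p.1, ξ)).aestronglyMeasurable
  · intro p
    refine Eventually.of_forall fun ξ => ?_
    rw [norm_mul, norm_exp_neg_I_mul, one_mul]
    exact hC (p.1, ξ)
  · refine (integrable_one_add_norm ?_).const_mul C
    norm_num
  · refine Eventually.of_forall fun ξ => ?_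
    fun_prop

/-! ### Integral operators with decaying kernels -/

lemma lintegral_mul_sq_le {f κ : E3 → ℝ≥0∞} (hf : AEMeasurable f volume)
    (hκ : AEMeasurable κ volume) :
    (∫⁻ z, f z * κ z) ^ 2 ≤ (∫⁻ z, κ z) * ∫⁻ z, f z ^ 2 * κ z := by
  have h := ENNReal.lintegral_mul_le_Lp_mul_Lq volume Real.HolderConjugate.two_two
    (f := fun z => κ z ^ (1 / 2 : ℝ)) (g := fun z => f z * κ z ^ (1 / 2 : ℝ))
    (hκ.pow_const _) (hf.mul (hκ.pow_const _))
  have e0 : ∀ z, κ z ^ (1 / 2 : ℝ) * κ z ^ (1 / 2 : ℝ) = κ z := fun z => by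
    rw [← ENNReal.rpow_add_of_nonneg _ _ (by norm_num) (by norm_num)]; norm_num
  have e1 : ∀ z, (κ z ^ (1 / 2 : ℝ)) ^ (2 : ℝ) = κ z := fun z => by
    rw [← ENNReal.rpow_mul]; norm_num
  have e2 : ∀ z, (f z * κ z ^ (1 / 2 : ℝ)) ^ (2 : ℝ) = f z ^ 2 * κ z := fun z => by
    rw [ENNReal.mul_rpow_of_nonneg _ _ (by norm_num), e1, ENNReal.rpow_two]
  have e3 : ∀ z, κ z ^ (1 / 2 : ℝ) * (f z * κ z ^ (1 / 2 : ℝ)) = f z * κ z := fun z => by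
    rw [mul_left_comm, e0]
  simp only [Pi.mul_apply, e1, e2, e3] at h
  calc (∫⁻ z, f z * κ z) ^ 2
      ≤ ((∫⁻ z, κ z) ^ (1 / 2 : ℝ) * (∫⁻ z, f z ^ 2 * κ z) ^ (1 / 2 : ℝ)) ^ 2 := by gcongr
    _ = _ := by
      rw [mul_pow, ← ENNReal.rpow_two, ← ENNReal.rpow_two, ← ENNReal.rpow_mul, ← ENNReal.rpow_mul]
      norm_num

/-- Young's inequality `L¹ * L² ⊆ L²`, by Cauchy–Schwarz against the weight `κ` and Tonelli. -/
lemma eLpNorm_le_of_kernel {F G : E3 → ℂ} {κ : E3 → ℝ≥0∞} (hF : AEStronglyMeasurable F volume)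
    (hκ : Measurable κ) (h : ∀ x, ‖G x‖ₑ ≤ ∫⁻ z, ‖F z‖ₑ * κ (z - x)) :
    eLpNorm G 2 volume ≤ (∫⁻ y, κ y) * eLpNorm F 2 volume := by
  have hsq : eLpNorm G 2 volume ^ 2 ≤ ((∫⁻ y, κ y) * eLpNorm F 2 volume) ^ 2 := by
    rw [eLpNorm_two_sq, mul_pow, eLpNorm_two_sq]
    calc ∫⁻ x, ‖G x‖ₑ ^ 2
        ≤ ∫⁻ x, (∫⁻ y, κ y) * ∫⁻ z, ‖F z‖ₑ ^ 2 * κ (z - x) := by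
          refine lintegral_mono fun x => ?_
          refine le_trans (pow_le_pow_left' (h x) 2) ?_
          have h1 := lintegral_mul_sq_le hF.enorm
            (hκ.comp (measurable_id.sub_const x)).aemeasurable
          refine h1.trans_eq ?_
          congr 1
          exact lintegral_sub_right_eq_self κ x
      _ = (∫⁻ y, κ y) * ∫⁻ z, ∫⁻ x, ‖F z‖ₑ ^ 2 * κ (z - x) := by
          have hm : AEMeasurable (Function.uncurry fun (x z : E3) => ‖F z‖ₑ ^ 2 * κ (z - x))
              (volume.prod volume) := by
            refine AEMeasurable.mul ?_ ?_
            · exact (hF.comp_snd.enorm).pow_const 2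
            · exact (hκ.comp (measurable_snd.sub measurable_fst)).aemeasurable
          rw [lintegral_const_mul'' (∫⁻ y, κ y) (f := fun x => ∫⁻ z, ‖F z‖ₑ ^ 2 * κ (z - x))
            hm.lintegral_prod_right', lintegral_lintegral_swap hm]
      _ = (∫⁻ y, κ y) * ∫⁻ z, ‖F z‖ₑ ^ 2 * ∫⁻ y, κ y := by
          congr 1
          refine lintegral_congr fun z => ?_
          rw [lintegral_const_mul (‖F z‖ₑ ^ 2) (f := fun x => κ (z - x))
              (hκ.comp (measurable_const.sub measurable_id)),
            lintegral_sub_left_eq_self κ z]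
      _ = _ := by
          rw [lintegral_mul_const'' _ (hF.enorm.pow_const 2)]
          ring
  exact (ENNReal.pow_le_pow_left_iff two_ne_zero).1 hsq

lemma japanese_rpow_neg_le_one (y : E3) {r : ℝ} (hr : 0 ≤ r) : japanese y ^ (-r) ≤ 1 :=
  Real.rpow_le_one_of_one_le_of_nonpos (one_le_japanese y) (by linarith)

lemma integrable_japanese {r : ℝ} (hr : 3 < r) : Integrable (fun y => japanese y ^ (-r)) volume := by
  have h := integrable_rpow_neg_one_add_norm_sq (E := E3) (μ := volume) (r := r) (by simpa using hr)
  refine h.congr (Eventually.of_forall fun y => ?_)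
  simp only [japanese]
  rw [Real.sqrt_eq_rpow, ← Real.rpow_mul (by positivity)]
  congr 1
  ring

lemma memLp_japanese {r : ℝ} (hr : 3 < r) :
    MemLp (fun y => ((japanese y ^ (-r) : ℝ) : ℂ)) 2 volume := by
  have hm : AEStronglyMeasurable (fun y => ((japanese y ^ (-r) : ℝ) : ℂ)) volume :=
    (Complex.continuous_ofReal.comp (continuous_japanese_rpow _)).aestronglyMeasurable
  rw [memLp_two_iff_integrable_sq_norm hm]
  refine (integrable_japanese hr).mono' (hm.norm.pow 2) (Eventually.of_forall fun y => ?_)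
  have h0 : 0 ≤ japanese y ^ (-r) := Real.rpow_nonneg (japanese_pos y).le _
  have h1 := japanese_rpow_neg_le_one y (r := r) (by linarith)
  rw [Complex.norm_real, Real.norm_of_nonneg h0, Real.norm_of_nonneg (by positivity)]
  nlinarith

/-- Peetre's inequality. -/
lemma japanese_rpow_le {s : ℝ} (hs0 : 0 ≤ s) (hs1 : s ≤ 1) (x z : E3) :
    japanese x ^ s ≤ 2 * (japanese z ^ s * japanese (z - x)) := by
  have h : japanese x ≤ 2 * japanese z * japanese (z - x) := by
    have h1 : ‖x‖ ≤ ‖z‖ + ‖z - x‖ := by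
      calc ‖x‖ = ‖z - (z - x)‖ := by congr 1; abel
        _ ≤ _ := norm_sub_le _ _
    simp only [japanese]
    rw [mul_assoc, ← Real.sqrt_mul (by positivity), show (2 : ℝ) = Real.sqrt 4 by
      rw [show (4 : ℝ) = 2 ^ 2 by norm_num]; simp, ← Real.sqrt_mul (by norm_num)]
    refine Real.sqrt_le_sqrt ?_
    nlinarith [sq_nonneg (‖z‖ - ‖z - x‖), norm_nonneg x, mul_nonneg (sq_nonneg ‖z‖) (sq_nonneg ‖z - x‖),
      mul_self_le_mul_self (norm_nonneg x) h1]
  have hz := japanese_pos z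
  have hd := one_le_japanese (z - x)
  calc japanese x ^ s ≤ (2 * japanese z * japanese (z - x)) ^ s :=
        Real.rpow_le_rpow (japanese_pos x).le h hs0
    _ = 2 ^ s * (japanese z ^ s * japanese (z - x) ^ s) := by
        rw [Real.mul_rpow (by positivity) (by positivity), Real.mul_rpow (by positivity) hz.le]; ring
    _ ≤ _ := by
        have h2 : (2 : ℝ) ^ s ≤ 2 := by
          simpa using Real.rpow_le_rpow_of_exponent_le (by norm_num : (1 : ℝ) ≤ 2) hs1
        have h3 : japanese (z - x) ^ s ≤ japanese (z - x) := by
          simpa using Real.rpow_le_rpow_of_exponent_le hd hs1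
        gcongr

/-- The operator with kernel `⟨z - x⟩^{-5}`, applied to `|F|`. -/
def bracketConv (F : E3 → ℂ) (x : E3) : ℝ := ∫ z, ‖F z‖ * japanese (z - x) ^ (-5 : ℝ)

lemma bracketConv_nonneg (F : E3 → ℂ) (x : E3) : 0 ≤ bracketConv F x :=
  integral_nonneg fun _ => mul_nonneg (norm_nonneg _) (Real.rpow_nonneg (japanese_pos _).le _)

/-- The norm of `bracketConv`. -/
def bracketConst : ℝ := (∫⁻ y : E3, ENNReal.ofReal (japanese y ^ (-5 : ℝ))).toReal

lemma lintegral_japanese_ne_top : ∫⁻ y : E3, ENNReal.ofReal (japanese y ^ (-5 : ℝ)) ≠ ∞ := by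
  have h := (integrable_japanese (r := 5) (by norm_num)).2
  rw [hasFiniteIntegral_iff_norm] at h
  refine ne_of_lt (lt_of_eq_of_lt (lintegral_congr fun y => ?_) h)
  rw [Real.norm_of_nonneg (Real.rpow_nonneg (japanese_pos y).le _)]

lemma memLp_bracketConv {F : E3 → ℂ} (hF : MemLp F 2 volume) :
    MemLp (fun x => (bracketConv F x : ℂ)) 2 volume ∧
      nrm (fun x => (bracketConv F x : ℂ)) ≤ bracketConst * nrm F := by
  have hm : Measurable fun y : E3 => ENNReal.ofReal (japanese y ^ (-5 : ℝ)) :=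
    (continuous_japanese_rpow _).measurable.ennreal_ofReal
  have hle := eLpNorm_le_of_kernel (G := fun x => (bracketConv F x : ℂ)) hF.1 hm fun x => by
    rw [← ofReal_norm, Complex.norm_real, ofReal_norm]
    refine (enorm_integral_le_lintegral_enorm _).trans (lintegral_mono fun z => ?_)
    rw [enorm_mul, enorm_norm, Real.enorm_of_nonneg (Real.rpow_nonneg (japanese_pos _).le _)]
  have hfin := ENNReal.mul_ne_top lintegral_japanese_ne_top hF.2.ne
  refine ⟨⟨?_, lt_of_le_of_lt hle hfin.lt_top⟩, ?_⟩
  · refine Complex.continuous_ofReal.comp_aestronglyMeasurable ?_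
    have h2 : AEStronglyMeasurable (fun p : E3 × E3 => ‖F p.2‖ * japanese (p.2 - p.1) ^ (-5 : ℝ))
        (volume.prod volume) :=
      hF.1.comp_snd.norm.mul
        ((continuous_japanese_rpow _).comp (continuous_snd.sub continuous_fst)).aestronglyMeasurable
    exact h2.integral_prod_right'
  · rw [nrm, nrm, bracketConst, ← ENNReal.toReal_mul]
    exact ENNReal.toReal_mono hfin hle

/-- The function `x ↦ ∫ S(z) Φ(q + ε (z + x) / 2, z - x) dz`. -/
def smear (Φ : E3 → E3 → ℂ) (S : E3 → ℂ) (q : E3) (ε : ℝ) (x : E3) : ℂ :=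
  ∫ z, S z * Φ (q + (ε / 2) • (z + x)) (z - x)

section Smear

variable {Φ : E3 → E3 → ℂ} (hΦ : Continuous fun p : E3 × E3 => Φ p.1 p.2) {P : ℝ}
  (hP : ∀ x y, ‖Φ x y‖ ≤ P * japanese y ^ (-6 : ℝ)) {S : E3 → ℂ} (q : E3) {s : ℝ}

include hΦ in
lemma aestronglyMeasurable_smear (hS : AEStronglyMeasurable S volume) (ε : ℝ) :
    AEStronglyMeasurable (smear Φ S q ε) volume := by
  have h2 : AEStronglyMeasurable
      (fun p : E3 × E3 => S p.2 * Φ (q + (ε / 2) • (p.2 + p.1)) (p.2 - p.1))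
      (volume.prod volume) :=
    hS.comp_snd.mul (hΦ.comp (by fun_prop : Continuous fun p : E3 × E3 =>
      (q + (ε / 2) • (p.2 + p.1), p.2 - p.1))).aestronglyMeasurable
  exact h2.integral_prod_right'

lemma integrable_norm_mul_japanese {F : E3 → ℂ} (hF : MemLp F 2 volume) {r : ℝ} (hr : 3 < r)
    (x : E3) : Integrable (fun z => ‖F z‖ * japanese (z - x) ^ (-r)) volume := by
  have h := (integrable_mul_of_memLp hF (memLp_comp_add (memLp_japanese hr) (-x))).norm
  refine h.congr (Eventually.of_forall fun z => ?_)
  simp only [norm_mul, Complex.norm_real, ← sub_eq_add_neg]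
  rw [Real.norm_of_nonneg (Real.rpow_nonneg (japanese_pos _).le _)]

-- Peetre's inequality moves the weight from `x` to `z` at the price of one power of `⟨z - x⟩`,
-- turning the decay `-6` into `-5`. The majorant is independent of `ε`, which enters only through
-- the first argument of `Φ`.
include hP in
lemma norm_weighted_smear_le (hs0 : 0 ≤ s) (hs1 : s ≤ 1) (hS : MemZ s S) (hP0 : 0 ≤ P) (ε : ℝ)
    (x : E3) :
    ‖weighted s (smear Φ S q ε) x‖ ≤ 2 * P * bracketConv (weighted s S) x := by
  have hjs := Real.rpow_nonneg (japanese_pos x).le s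
  rw [norm_weighted, smear, bracketConv, ← integral_const_mul]
  have h1 : ‖∫ z, S z * Φ (q + (ε / 2) • (z + x)) (z - x)‖ ≤
      ∫ z, P * (‖S z‖ * japanese (z - x) ^ (-6 : ℝ)) := by
    refine norm_integral_le_of_norm_le
      ((integrable_norm_mul_japanese (hS.memLp hs0) (by norm_num) x).const_mul P)
      (Eventually.of_forall fun z => ?_)
    rw [norm_mul]
    calc _ ≤ ‖S z‖ * (P * japanese (z - x) ^ (-6 : ℝ)) :=
          mul_le_mul_of_nonneg_left (hP _ _) (norm_nonneg _)
      _ = _ := by ring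
  refine (mul_le_mul_of_nonneg_left h1 hjs).trans ?_
  rw [← integral_const_mul]
  refine integral_mono
    (((integrable_norm_mul_japanese (hS.memLp hs0) (by norm_num) x).const_mul P).const_mul _)
    ((integrable_norm_mul_japanese hS (by norm_num) x).const_mul _) fun z => ?_
  have hd := japanese_pos (z - x)
  have h2 := japanese_rpow_le hs0 hs1 x z
  have h3 : japanese (z - x) ^ (-5 : ℝ) = japanese (z - x) * japanese (z - x) ^ (-6 : ℝ) := by
    rw [show (-5 : ℝ) = 1 + -6 by norm_num, Real.rpow_add hd, Real.rpow_one]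
  have h6 := Real.rpow_nonneg hd.le (-6 : ℝ)
  simp only [norm_weighted, h3]
  calc japanese x ^ s * (P * (‖S z‖ * japanese (z - x) ^ (-6 : ℝ)))
      ≤ 2 * (japanese z ^ s * japanese (z - x)) * (P * (‖S z‖ * japanese (z - x) ^ (-6 : ℝ))) :=
        mul_le_mul_of_nonneg_right h2 (by positivity)
    _ = _ := by ring

include hΦ hP in
lemma memZ_smear (hs0 : 0 ≤ s) (hs1 : s ≤ 1) (hS : MemZ s S) (hP0 : 0 ≤ P) (ε : ℝ) :
    MemZ s (smear Φ S q ε) ∧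
      normZ s (smear Φ S q ε) ≤ 2 * P * (bracketConst * normZ s S) := by
  obtain ⟨h1, h2⟩ := memLp_bracketConv hS
  have hb : ∀ x, ‖weighted s (smear Φ S q ε) x‖ ≤
      2 * P * ‖(bracketConv (weighted s S) x : ℂ)‖ := fun x => by
    rw [Complex.norm_real, Real.norm_of_nonneg (bracketConv_nonneg _ _)]
    exact norm_weighted_smear_le hP q hs0 hs1 hS hP0 ε x
  have hm := aestronglyMeasurable_weighted
    (aestronglyMeasurable_smear hΦ q hS.aestronglyMeasurable ε) s
  refine ⟨h1.of_le_mul hm (Eventually.of_forall hb), ?_⟩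
  have h3 := eLpNorm_le_mul_eLpNorm_of_ae_le_mul (p := 2) (Eventually.of_forall hb) (μ := volume)
  refine le_trans ?_ (mul_le_mul_of_nonneg_left h2 (by positivity))
  have h4 := ENNReal.toReal_mono (ENNReal.mul_ne_top ENNReal.ofReal_ne_top h1.2.ne) h3
  rwa [ENNReal.toReal_mul, ENNReal.toReal_ofReal (by positivity)] at h4

include hΦ hP in
lemma tendsto_smear (hs0 : 0 ≤ s) (hS : MemZ s S) (x : E3) :
    Tendsto (fun ε => smear Φ S q ε x) (𝓝[>] 0) (𝓝 (smear Φ S q 0 x)) := by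
  have hc : ∀ z, Continuous fun ε : ℝ => Φ (q + (ε / 2) • (z + x)) (z - x) := fun z =>
    hΦ.comp (by fun_prop : Continuous fun ε : ℝ => (q + (ε / 2) • (z + x), z - x))
  refine tendsto_integral_filter_of_dominated_convergence
    (fun z => P * (‖S z‖ * japanese (z - x) ^ (-6 : ℝ))) (Eventually.of_forall fun ε => ?_)
    (Eventually.of_forall fun ε => Eventually.of_forall fun z => ?_)
    ((integrable_norm_mul_japanese (hS.memLp hs0) (by norm_num) x).const_mul P)
    (Eventually.of_forall fun z => ?_)
  · exact hS.aestronglyMeasurable.mul (hΦ.comp (by fun_prop : Continuous fun z : E3 =>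
      (q + (ε / 2) • (z + x), z - x))).aestronglyMeasurable
  · rw [norm_mul]
    calc _ ≤ ‖S z‖ * (P * japanese (z - x) ^ (-6 : ℝ)) :=
          mul_le_mul_of_nonneg_left (hP _ _) (norm_nonneg _)
      _ = _ := by ring
  · exact (((hc z).tendsto 0).mono_left nhdsWithin_le_nhds).const_mul _

-- Pointwise convergence is upgraded by the majorant `2P · bracketConv`, common to all `ε`; the
-- difference of two values of `smear` is under twice that, hence `4P`.
include hΦ hP in
lemma tendsto_normZ_smear_sub (hs0 : 0 ≤ s) (hs1 : s ≤ 1) (hS : MemZ s S) (hP0 : 0 ≤ P) :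
    Tendsto (fun ε => normZ s (fun x => smear Φ S q ε x + -1 * smear Φ S q 0 x)) (𝓝[>] 0) (𝓝 0) := by
  obtain ⟨h1, -⟩ := memLp_bracketConv hS
  have hb := norm_weighted_smear_le hP q hs0 hs1 hS hP0
  have e : ∀ ε x, weighted s (fun x => smear Φ S q ε x + -1 * smear Φ S q 0 x) x =
      weighted s (smear Φ S q ε) x - weighted s (smear Φ S q 0) x := fun ε x => by
    simp only [weighted]; ring
  have hm := fun ε => aestronglyMeasurable_weighted
    (aestronglyMeasurable_smear hΦ q hS.aestronglyMeasurable ε) s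
  refine tendsto_nrm_of_dominated (G := fun x => ((4 * P : ℝ) : ℂ) * bracketConv (weighted s S) x)
    (Eventually.of_forall fun ε => ?_) (h1.const_mul _)
    (Eventually.of_forall fun ε => Eventually.of_forall fun x => ?_)
    (Eventually.of_forall fun x => ?_)
  · rw [show weighted s (fun x => smear Φ S q ε x + -1 * smear Φ S q 0 x) = _ from funext (e ε)]
    exact (hm ε).sub (hm 0)
  · rw [e, norm_mul, Complex.norm_real, Complex.norm_real, Real.norm_of_nonneg (by positivity),
      Real.norm_of_nonneg (bracketConv_nonneg _ _)]
    refine (norm_sub_le _ _).trans ?_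
    linarith [hb ε x, hb 0 x]
  · have h2 := (tendsto_smear hΦ hP q hs0 hS x).const_mul ((japanese x ^ s : ℝ) : ℂ)
    have h3 := h2.sub_const (((japanese x ^ s : ℝ) : ℂ) * smear Φ S q 0 x)
    rw [sub_self] at h3
    exact h3.congr fun ε => (e ε x).symm

end Smear

/-- At `ε = 0` the smeared function is an inverse Fourier transform. -/
lemma smear_partialHat_zero (ψ : 𝓢(E3 × E3, ℂ)) {S : E3 → ℂ} (hS : MemLp S 2 volume) (q : E3) :
    smear (partialHat ψ) S q 0 =
      fun x => (2 * Real.pi : ℂ) ^ 3 * invHat (fun ξ => hatL2 S ξ * ψ (q, ξ)) x := by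
  ext x
  have hc : Continuous fun ξ => Complex.exp (Complex.I * (⟪x, ξ⟫ : ℝ)) := by fun_prop
  -- The Fourier transform of `φ` at `z` is that of `ψ(q, ·)` at `z - x`: the phase of the inverse
  -- transform at `x` is a translation.
  set φ : E3 → ℂ := fun ξ => Complex.exp (Complex.I * (⟪x, ξ⟫ : ℝ)) * ψ (q, ξ) with hφ
  have hφm : AEStronglyMeasurable φ volume :=
    (hc.mul (by fun_prop : Continuous fun ξ => ψ (q, ξ))).aestronglyMeasurable
  have hn : ∀ ξ, ‖φ ξ‖ = ‖slice ψ q ξ‖ := fun ξ => by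
    rw [hφ, norm_mul, norm_exp_I_mul, one_mul, coe_slice]
  have h2 : MemLp φ 2 volume :=
    ((slice ψ q).memLp 2 volume).of_le hφm (Eventually.of_forall fun ξ => (hn ξ).le)
  have h1 : Integrable φ volume :=
    ((slice ψ q).integrable (μ := volume)).mono hφm (Eventually.of_forall fun ξ => (hn ξ).le)
  have h := integral_hatL2_mul_integrable hS h2 h1
  rw [invHat, ← mul_assoc, ← mul_pow, mul_inv_cancel₀ (by simp [Real.pi_ne_zero]), one_pow, one_mul,
    smear]
  calc _ = ∫ z, S z * hat φ z := by
        refine integral_congr_ae (Eventually.of_forall fun z => ?_)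
        simp only [zero_div, zero_smul, add_zero, partialHat, hat]
        congr 1
        refine integral_congr_ae (Eventually.of_forall fun ξ => ?_)
        simp only [hφ]
        rw [← mul_assoc, ← Complex.exp_add, inner_sub_left]
        congr 2
        push_cast
        ring
    _ = _ := by
        rw [← h]
        refine integral_congr_ae (Eventually.of_forall fun ξ => ?_)
        simp only [hφ]
        ring

lemma memLp_hatL2_mul_slice (ψ : 𝓢(E3 × E3, ℂ)) (S : E3 → ℂ) (q : E3) :
    MemLp (fun ξ => hatL2 S ξ * ψ (q, ξ)) 2 volume ∧
      Integrable (fun ξ => hatL2 S ξ * ψ (q, ξ)) volume := by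
  refine ⟨?_, integrable_mul_of_memLp (memLp_hatL2 S) ((slice ψ q).memLp 2 volume)⟩
  refine (memLp_hatL2 S).of_le_mul (c := SchwartzMap.seminorm ℂ 0 0 (slice ψ q))
    ((memLp_hatL2 S).1.mul (slice ψ q).continuous.aestronglyMeasurable)
    (Eventually.of_forall fun ξ => ?_)
  rw [norm_mul, mul_comm]
  exact mul_le_mul_of_nonneg_right (SchwartzMap.norm_le_seminorm ℂ (slice ψ q) ξ) (norm_nonneg _)

/-! ### Pairing a Wigner transform with a Schwartz function -/

lemma ae_comp_add {p : E3 → Prop} (h : ∀ᵐ x, p x) (b : E3) : ∀ᵐ x : E3, p (x + b) :=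
  (measurePreserving_add_right volume b).quasiMeasurePreserving.ae h

lemma ae_comp_affine {p : E3 → Prop} (h : ∀ᵐ x, p x) {c : ℝ} (hc : c ≠ 0) (b : E3) :
    ∀ᵐ x : E3, p (b + c • x) := by
  have := ae_comp_smul (ae_comp_add h b) hc
  simpa only [add_comm] using this

lemma memLp_comp_affine {f : E3 → ℂ} (hf : MemLp f 2 volume) {c : ℝ} (hc : c ≠ 0) (b : E3) :
    MemLp (fun x => f (b + c • x)) 2 volume := by
  have := memLp_comp_smul (memLp_comp_add hf b) hc
  simpa only [add_comm] using this

lemma nrm_comp_add {f : E3 → ℂ} (hf : AEStronglyMeasurable f volume) (b : E3) :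
    nrm (fun x => f (x + b)) = nrm f := by
  have := eLpNorm_comp_measurePreserving (p := 2) hf (measurePreserving_add_right volume b)
  rw [nrm, nrm, ← this]
  rfl

lemma nrm_comp_affine {f : E3 → ℂ} (hf : MemLp f 2 volume) {c : ℝ} (hc : c ≠ 0) (b : E3) :
    nrm (fun x => f (b + c • x)) = nrm (fun x => f (c • x)) := by
  rw [← nrm_comp_add (memLp_comp_smul hf hc).1 (c⁻¹ • b)]
  congr 1
  ext x
  rw [smul_add, smul_smul, mul_inv_cancel₀ hc, one_smul, add_comm]

lemma sub_eq_add_neg_smul (x y : E3) (c : ℝ) : x - c • y = x + (-c) • y := by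
  rw [neg_smul, sub_eq_add_neg]

/-- The maps `y ↦ x ± (ε/2) y` preserve null sets, so the equality holds at every `(x, ξ)`. It
allows `u` and `v` to be taken Borel, which makes the integrands below jointly measurable. -/
lemma wigner_congr {ε : ℝ} (hε : ε ≠ 0) {u u' v v' : E3 → ℂ} (hu : u =ᵐ[volume] u')
    (hv : v =ᵐ[volume] v') : wigner ε u v = wigner ε u' v' := by
  ext x ξ
  rw [wigner, wigner]
  congr 1
  have h2 : ε / 2 ≠ 0 := by positivity
  refine integral_congr_ae ?_
  filter_upwards [ae_comp_affine hu h2 x, ae_comp_affine hv (neg_ne_zero.2 h2) x] with y h3 h4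
  rw [sub_eq_add_neg_smul, h3, h4]

lemma integrable_schwartz_prod (ψ : 𝓢(E3 × E3, ℂ)) : Integrable ψ volume := by
  have : (volume : Measure (E3 × E3)).IsAddHaarMeasure := by
    rw [Measure.volume_eq_prod]; infer_instance
  exact ψ.integrable

lemma wigner_mul_eq (ε : ℝ) (u v : E3 → ℂ) (ψ : 𝓢(E3 × E3, ℂ)) (p : E3 × E3) :
    wigner ε u v p.1 p.2 * ψ p = (2 * Real.pi : ℂ)⁻¹ ^ 3 *
      ∫ y, Complex.exp (-Complex.I * (⟪y, p.2⟫ : ℝ)) *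
        (u (p.1 + (ε / 2) • y) * conj (v (p.1 - (ε / 2) • y))) * ψ p := by
  rw [wigner, integral_mul_const, mul_assoc]

section WignerPairing

variable {ε : ℝ} (hε : ε ≠ 0) {u v : E3 → ℂ} (hu : MemLp u 2 volume) (hv : MemLp v 2 volume)
  (hum : Measurable u) (hvm : Measurable v) (ψ : 𝓢(E3 × E3, ℂ))

include hε hu hv hum hvm

/-- By Cauchy–Schwarz the integral in `y` of `|u v|` is bounded by a constant independent of `x`,
because translations preserve `L²` norms; `ψ` provides integrability in `(x, ξ)`. -/
lemma integrable_wigner_kernel :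
    Integrable (fun r : (E3 × E3) × E3 => Complex.exp (-Complex.I * (⟪r.2, r.1.2⟫ : ℝ)) *
      (u (r.1.1 + (ε / 2) • r.2) * conj (v (r.1.1 - (ε / 2) • r.2))) * ψ r.1)
      (volume.prod volume) := by
  have h2 : ε / 2 ≠ 0 := by positivity
  have hm : AEStronglyMeasurable (fun r : (E3 × E3) × E3 =>
      Complex.exp (-Complex.I * (⟪r.2, r.1.2⟫ : ℝ)) *
      (u (r.1.1 + (ε / 2) • r.2) * conj (v (r.1.1 - (ε / 2) • r.2))) * ψ r.1)
      (volume.prod volume) := by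
    refine AEStronglyMeasurable.mul (AEStronglyMeasurable.mul ?_ (AEStronglyMeasurable.mul ?_ ?_)) ?_
    · exact (by fun_prop : Continuous fun r : (E3 × E3) × E3 =>
        Complex.exp (-Complex.I * (⟪r.2, r.1.2⟫ : ℝ))).aestronglyMeasurable
    · exact (hum.comp (by fun_prop)).aestronglyMeasurable
    · exact (Complex.continuous_conj.measurable.comp (hvm.comp (by fun_prop))).aestronglyMeasurable
    · exact (ψ.continuous.comp continuous_fst).aestronglyMeasurable
  have hM : ∀ x, MemLp (fun y => u (x + (ε / 2) • y)) 2 volume := fun x => memLp_comp_affine hu h2 x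
  have hN : ∀ x, MemLp (fun y => conj (v (x - (ε / 2) • y))) 2 volume := fun x => by
    simp only [sub_eq_add_neg_smul]
    exact memLp_conj (memLp_comp_affine hv (neg_ne_zero.2 h2) x)
  have hnorm : ∀ (p : E3 × E3) (y : E3), ‖Complex.exp (-Complex.I * (⟪y, p.2⟫ : ℝ)) *
      (u (p.1 + (ε / 2) • y) * conj (v (p.1 - (ε / 2) • y))) * ψ p‖ =
      ‖u (p.1 + (ε / 2) • y) * conj (v (p.1 - (ε / 2) • y))‖ * ‖ψ p‖ := fun p y => by
    rw [norm_mul, norm_mul, norm_exp_neg_I_mul, one_mul]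
  refine (integrable_prod_iff hm).2 ⟨Eventually.of_forall fun p => ?_, ?_⟩
  · refine (integrable_mul_of_memLp (hM p.1) (hN p.1)).bdd_mul (c := 1) ?_ ?_ |>.mul_const (ψ p)
    · exact (by fun_prop : Continuous fun y : E3 =>
        Complex.exp (-Complex.I * (⟪y, p.2⟫ : ℝ))).aestronglyMeasurable
    · exact Eventually.of_forall fun y => (norm_exp_neg_I_mul _).le
  · refine ((integrable_schwartz_prod ψ).norm.const_mul
      (nrm (fun y => u ((ε / 2) • y)) * nrm (fun y => v ((-(ε / 2)) • y)))).mono'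
      hm.norm.integral_prod_right' (Eventually.of_forall fun p => ?_)
    rw [Real.norm_of_nonneg (integral_nonneg fun y => norm_nonneg _)]
    simp only [hnorm]
    rw [integral_mul_const]
    refine mul_le_mul_of_nonneg_right ?_ (norm_nonneg _)
    refine (integral_norm_mul_le (hM p.1) (hN p.1)).trans_eq ?_
    rw [nrm_comp_affine hu h2, nrm_conj (fun y => v (p.1 - (ε / 2) • y))]
    simp only [sub_eq_add_neg_smul]
    rw [nrm_comp_affine hv (neg_ne_zero.2 h2)]

lemma integrable_wigner_mul_of_measurable :
    Integrable (fun p : E3 × E3 => wigner ε u v p.1 p.2 * ψ p) volume := by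
  simp only [wigner_mul_eq ε u v ψ]
  exact (integrable_wigner_kernel hε hu hv hum hvm ψ).integral_prod_left.const_mul _

lemma bracket_wigner_eq_integral : bracket (wigner ε u v) ψ = (2 * Real.pi : ℂ)⁻¹ ^ 3 *
    ∫ y, ∫ x, u (x + (ε / 2) • y) * conj (v (x - (ε / 2) • y)) * partialHat ψ x y := by
  have hT := integrable_wigner_kernel hε hu hv hum hvm ψ
  rw [bracket]
  simp only [wigner_mul_eq ε u v ψ]
  rw [integral_const_mul]
  congr 1
  rw [integral_integral_swap hT]
  refine integral_congr_ae ?_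
  filter_upwards [hT.prod_left_ae] with y hy
  rw [Measure.volume_eq_prod, integral_prod _ hy]
  refine integral_congr_ae (Eventually.of_forall fun x => ?_)
  simp only [partialHat, hat]
  rw [← integral_const_mul]
  refine integral_congr_ae (Eventually.of_forall fun ξ => ?_)
  simp only
  ring

/-- Replacing `x` by `q + ε x + (ε/2) y` puts `v` at `q + ε x`, free of `y`, and `u` at `q + ε (x +
y)`; then `z = x + y` becomes the variable of the inner integral. -/
lemma bracket_wigner_of_measurable (hε0 : 0 < ε) (q : E3) :
    bracket (wigner ε u v) ψ = (2 * Real.pi : ℂ)⁻¹ ^ 3 * ((ε : ℂ) ^ 3 *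
      ∫ x, conj (v (q + ε • x)) *
        ∫ z, u (q + ε • z) * partialHat ψ (q + (ε / 2) • (z + x)) (z - x)) := by
  rw [bracket_wigner_eq_integral hε hu hv hum hvm ψ]
  congr 1
  set B : E3 → E3 → ℂ := fun y x =>
    u (q + ε • (x + y)) * conj (v (q + ε • x)) * partialHat ψ (q + ε • x + (ε / 2) • y) y with hB
  have h1 : ∀ y, ∫ x, u (x + (ε / 2) • y) * conj (v (x - (ε / 2) • y)) * partialHat ψ x y =
      (ε : ℂ) ^ 3 * ∫ x, B y x := fun y => by
    set A : E3 → ℂ := fun x => u (x + (ε / 2) • y) * conj (v (x - (ε / 2) • y)) * partialHat ψ x y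
      with hA
    have e1 := integral_comp_smul_E3 (fun x => A (x + (q + (ε / 2) • y))) hε0
    rw [integral_add_right_eq_self A] at e1
    have hεC : (ε : ℂ) ≠ 0 := by exact_mod_cast hε
    have e2 : ∀ x, A (ε • x + (q + (ε / 2) • y)) = B y x := fun x => by
      have a1 : ε • x + (q + (ε / 2) • y) + (ε / 2) • y = q + ε • (x + y) := by module
      have a2 : ε • x + (q + (ε / 2) • y) - (ε / 2) • y = q + ε • x := by module
      have a3 : ε • x + (q + (ε / 2) • y) = q + ε • x + (ε / 2) • y := by module
      simp only [hA, hB]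
      rw [a1, a2, a3]
    simp only [e2] at e1
    rw [e1]
    field_simp
  simp only [h1]
  rw [integral_const_mul]
  congr 1
  have hU : MemLp (fun x => u (q + ε • x)) 2 volume := memLp_comp_affine hu hε q
  have hV : MemLp (fun x => conj (v (q + ε • x))) 2 volume := memLp_conj (memLp_comp_affine hv hε q)
  have hUy : ∀ y, MemLp (fun x => u (q + ε • (x + y))) 2 volume := fun y => memLp_comp_add hU y
  have hBm : AEStronglyMeasurable (Function.uncurry B) (volume.prod volume) := by
    refine AEStronglyMeasurable.mul (AEStronglyMeasurable.mul ?_ ?_) ?_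
    · exact (hum.comp (by fun_prop)).aestronglyMeasurable
    · exact (Complex.continuous_conj.measurable.comp (hvm.comp (by fun_prop))).aestronglyMeasurable
    · exact ((continuous_partialHat ψ).comp (by fun_prop : Continuous fun p : E3 × E3 =>
        (q + ε • p.2 + (ε / 2) • p.1, p.1))).aestronglyMeasurable
  obtain ⟨F, C, hC0, hC⟩ := exists_norm_partialHat_le
  set P := C * (F.sup (schwartzSeminormFamily ℂ (E3 × E3) ℂ)) ψ with hP
  have hP0 : 0 ≤ P := mul_nonneg hC0 (apply_nonneg _ _)
  have hBle : ∀ y x, ‖B y x‖ ≤ ‖u (q + ε • (x + y)) * conj (v (q + ε • x))‖ *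
      (P * japanese y ^ (-6 : ℝ)) := fun y x => by
    rw [hB, norm_mul]
    exact mul_le_mul_of_nonneg_left (hC ψ _ _) (norm_nonneg _)
  have hUV : ∀ y, Integrable (fun x => u (q + ε • (x + y)) * conj (v (q + ε • x))) volume :=
    fun y => integrable_mul_of_memLp (hUy y) hV
  have hBi : Integrable (Function.uncurry B) (volume.prod volume) := by
    have hy : ∀ᵐ y, Integrable (fun x => B y x) volume := by
      filter_upwards [hBm.prodMk_left] with y hy
      exact ((hUV y).norm.mul_const _).mono' hy (Eventually.of_forall (hBle y))
    refine (integrable_prod_iff hBm).2 ⟨hy, ?_⟩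
    refine ((integrable_japanese (r := 6) (by norm_num)).const_mul
      (nrm (fun x => u (q + ε • x)) * nrm (fun x => conj (v (q + ε • x))) * P)).mono'
      hBm.norm.integral_prod_right' ?_
    filter_upwards [hy] with y hy
    rw [Real.norm_of_nonneg (integral_nonneg fun x => norm_nonneg _)]
    have hj := Real.rpow_nonneg (japanese_pos y).le (-6)
    calc ∫ x, ‖B y x‖
        ≤ ∫ x, ‖u (q + ε • (x + y)) * conj (v (q + ε • x))‖ * (P * japanese y ^ (-6 : ℝ)) :=
          integral_mono hy.norm ((hUV y).norm.mul_const _) (hBle y)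
      _ = (∫ x, ‖u (q + ε • (x + y)) * conj (v (q + ε • x))‖) * (P * japanese y ^ (-6 : ℝ)) :=
          integral_mul_const _ _
      _ ≤ (nrm (fun x => u (q + ε • x)) * nrm (fun x => conj (v (q + ε • x)))) *
          (P * japanese y ^ (-6 : ℝ)) := by
          refine mul_le_mul_of_nonneg_right ?_ (by positivity)
          have := integral_norm_mul_le (hUy y) hV
          rwa [nrm_comp_add hU.1 y] at this
      _ = _ := by ring
  rw [integral_integral_swap hBi]
  refine integral_congr_ae (Eventually.of_forall fun x => ?_)
  simp only
  rw [← integral_sub_right_eq_self _ x, ← integral_const_mul]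
  refine integral_congr_ae (Eventually.of_forall fun z => ?_)
  have a1 : q + ε • x + (ε / 2) • (z - x) = q + (ε / 2) • (z + x) := by module
  simp only [hB]
  rw [a1, add_sub_cancel]
  ring

end WignerPairing

lemma exists_measurable_rep {f : E3 → ℂ} (hf : MemLp f 2 volume) :
    ∃ g, Measurable g ∧ f =ᵐ[volume] g ∧ MemLp g 2 volume :=
  ⟨_, hf.1.stronglyMeasurable_mk.measurable, hf.1.ae_eq_mk, hf.ae_eq hf.1.ae_eq_mk⟩

lemma integrable_wigner_mul {ε : ℝ} (hε : ε ≠ 0) {u v : E3 → ℂ} (hu : MemLp u 2 volume)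
    (hv : MemLp v 2 volume) (ψ : 𝓢(E3 × E3, ℂ)) :
    Integrable (fun p : E3 × E3 => wigner ε u v p.1 p.2 * ψ p) volume := by
  obtain ⟨u', hum, hu', hu2⟩ := exists_measurable_rep hu
  obtain ⟨v', hvm, hv', hv2⟩ := exists_measurable_rep hv
  rw [wigner_congr hε hu' hv']
  exact integrable_wigner_mul_of_measurable hε hu2 hv2 hum hvm ψ

lemma bracket_wigner {ε : ℝ} (hε : 0 < ε) {u v : E3 → ℂ} (hu : MemLp u 2 volume)
    (hv : MemLp v 2 volume) (ψ : 𝓢(E3 × E3, ℂ)) (q : E3) :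
    bracket (wigner ε u v) ψ = (2 * Real.pi : ℂ)⁻¹ ^ 3 * ((ε : ℂ) ^ 3 *
      ∫ x, conj (v (q + ε • x)) *
        ∫ z, u (q + ε • z) * partialHat ψ (q + (ε / 2) • (z + x)) (z - x)) := by
  obtain ⟨u', hum, hu', hu2⟩ := exists_measurable_rep hu
  obtain ⟨v', hvm, hv', hv2⟩ := exists_measurable_rep hv
  rw [wigner_congr hε.ne' hu' hv', bracket_wigner_of_measurable hε.ne' hu2 hv2 hum hvm ψ hε q]
  congr 2
  refine integral_congr_ae ?_
  filter_upwards [ae_comp_affine hv' hε.ne' q] with x hx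
  rw [hx]
  congr 1
  refine integral_congr_ae ?_
  filter_upwards [ae_comp_affine hu' hε.ne' q] with z hz
  rw [hz]

lemma scaledSource_eq (ε : ℝ) (S : E3 → ℂ) (q : E3) :
    scaledSource ε S q = fun x => ((ε : ℂ)⁻¹ ^ 3) * S (ε⁻¹ • x + (-(ε⁻¹ • q))) := by
  ext x
  rw [scaledSource, smul_sub, sub_eq_add_neg]
  push_cast
  rfl

lemma memLp_scaledSource {ε : ℝ} (hε : ε ≠ 0) {S : E3 → ℂ} (hS : MemLp S 2 volume) (q : E3) :
    MemLp (scaledSource ε S q) 2 volume := by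
  rw [scaledSource_eq]
  exact (memLp_comp_smul (memLp_comp_add hS _) (inv_ne_zero hε)).const_mul _

/-- The pairing of the Wigner transform in the variables rescaled about the source. -/
lemma mul_bracket_wigner_scaledSource {ε : ℝ} (hε : 0 < ε) {S v : E3 → ℂ} (hS : MemLp S 2 volume)
    (hv : MemLp v 2 volume) (ψ : 𝓢(E3 × E3, ℂ)) (q : E3) :
    (ε : ℂ) * bracket (wigner ε (scaledSource ε S q) v) ψ = (2 * Real.pi : ℂ)⁻¹ ^ 3 *
      ∫ x, conj ((ε : ℂ) * v (ε • x + q)) * smear (partialHat ψ) S q ε x := by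
  have hεC : (ε : ℂ) ≠ 0 := by exact_mod_cast hε.ne'
  rw [bracket_wigner hε (memLp_scaledSource hε.ne' hS q) hv ψ q, mul_left_comm]
  congr 1
  rw [← integral_const_mul, ← integral_const_mul]
  refine integral_congr_ae (Eventually.of_forall fun x => ?_)
  simp only [smear]
  -- The `ε^{-3}` of the source cancels the Jacobian `ε³`; the remaining `ε` goes into the rescaled
  -- solution.
  have h : ∀ z, scaledSource ε S q (q + ε • z) * partialHat ψ (q + (ε / 2) • (z + x)) (z - x) =
      (ε : ℂ)⁻¹ ^ 3 * (S z * partialHat ψ (q + (ε / 2) • (z + x)) (z - x)) := fun z => by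
    rw [scaledSource, add_sub_cancel_left, smul_smul, inv_mul_cancel₀ hε.ne', one_smul]
    push_cast
    ring
  simp only [h]
  rw [integral_const_mul, map_mul, Complex.conj_ofReal, add_comm q]
  field_simp

/-! ### The rescaled solution on the Fourier side -/

lemma hatL2_scaledSource {ε : ℝ} (hε : 0 < ε) {S : E3 → ℂ} (hS : MemLp S 2 volume) (q : E3) :
    hatL2 (scaledSource ε S q) =ᵐ[volume]
      fun η => Complex.exp (-Complex.I * (⟪ε⁻¹ • q, ε • η⟫ : ℝ)) * hatL2 S (ε • η) := by
  have hεC : (ε : ℂ) ≠ 0 := by exact_mod_cast hε.ne'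
  have h := hatL2_comp_affine hS (inv_pos.2 hε) (-(ε⁻¹ • q))
  rw [scaledSource_eq]
  filter_upwards [h, hatL2_const_mul ((ε : ℂ)⁻¹ ^ 3) (memLp_comp_smul
    (memLp_comp_add hS (-(ε⁻¹ • q))) (inv_ne_zero hε.ne'))] with η hη hη'
  rw [hη', hη, inv_inv, inner_neg_left]
  push_cast
  rw [inv_inv, ← mul_assoc, ← mul_assoc, ← mul_pow, inv_mul_cancel₀ hεC, one_pow, one_mul, neg_mul,
    mul_neg]

/-- The rescaled solution `ε v(q + ε y)` has an explicit Fourier transform. -/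
lemma hatL2_rescaled {ε α : ℝ} (hε : 0 < ε) (hα : 0 < α) {S T v : E3 → ℂ} (hS : MemLp S 2 volume)
    (hT : MemLp T 2 volume) (hv : MemLp v 2 volume) (q q' : E3)
    (h : IsWeakHelmholtz (α / ε) (1 / ε ^ 2)
      (fun x => scaledSource ε S q x + scaledSource ε T q' x) v) :
    hatL2 (fun y => (ε : ℂ) * v (ε • y + q)) =ᵐ[volume] fun ξ =>
      -(resMult (ε * α) 0 ξ * hatL2 S ξ + resMult (ε * α) (ε⁻¹ • (q' - q)) ξ * hatL2 T ξ) := by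
  have hεC : (ε : ℂ) ≠ 0 := by exact_mod_cast hε.ne'
  have hs := memLp_scaledSource hε.ne' hS q
  have ht := memLp_scaledSource hε.ne' hT q'
  have h1 := hatL2_of_isWeakHelmholtz hv (hs.add ht) h
  have h2 := hatL2_add hs ht
  have h3 := hatL2_const_mul (ε : ℂ) (memLp_comp_smul (memLp_comp_add hv q) hε.ne')
  have hi := inv_ne_zero hε.ne'
  filter_upwards [ae_comp_smul h1 hi, ae_comp_smul h2 hi,
    ae_comp_smul (hatL2_scaledSource hε hS q) hi, ae_comp_smul (hatL2_scaledSource hε hT q') hi,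
    hatL2_comp_affine hv hε q, h3] with ξ e1 e2 e3 e4 e5 e6
  rw [e6, e5]
  have hp : ∀ x : E3, ⟪ε⁻¹ • x, ε • ε⁻¹ • ξ⟫ = ⟪ε⁻¹ • x, ξ⟫ := fun x => by
    rw [smul_smul, mul_inv_cancel₀ hε.ne', one_smul]
  rw [hp, smul_smul, mul_inv_cancel₀ hε.ne', one_smul] at e3 e4
  have e7 := e1.trans (e2.trans (congrArg₂ (· + ·) e3 e4))
  have hq : ⟪q, ε⁻¹ • ξ⟫ = ⟪ε⁻¹ • q, ξ⟫ := by rw [inner_smul_right, real_inner_smul_left]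
  have hn : ‖ε⁻¹ • ξ‖ ^ 2 = ε⁻¹ ^ 2 * ‖ξ‖ ^ 2 := by
    rw [norm_smul, mul_pow, Real.norm_of_nonneg (inv_pos.2 hε).le]
  have hsym := symb_ne_zero (mul_pos hε hα) ξ
  -- At the frequency `ξ/ε` the symbol `-iα/ε - ‖ξ‖²/ε² + 1/ε²` equals `-symb (ε α) ξ / ε²`: the
  -- effective absorption is `δ = ε α`.
  have e8 : -(symb (ε * α) ξ) * hatL2 v (ε⁻¹ • ξ) = (ε : ℂ) ^ 2 *
      (Complex.exp (-Complex.I * (⟪ε⁻¹ • q, ξ⟫ : ℝ)) * hatL2 S ξ +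
        Complex.exp (-Complex.I * (⟪ε⁻¹ • q', ξ⟫ : ℝ)) * hatL2 T ξ) := by
    rw [← e7, hn, symb]
    push_cast
    field_simp
    ring
  have e9 : hatL2 v (ε⁻¹ • ξ) = -((ε : ℂ) ^ 2 *
      (Complex.exp (-Complex.I * (⟪ε⁻¹ • q, ξ⟫ : ℝ)) * hatL2 S ξ +
        Complex.exp (-Complex.I * (⟪ε⁻¹ • q', ξ⟫ : ℝ)) * hatL2 T ξ)) / symb (ε * α) ξ := by
    rw [eq_div_iff hsym, ← e8]
    ring
  rw [e9, hq, resMult, resMult]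
  -- Centering at `q` removes the phase of the source at `q` and leaves only the relative position
  -- `(q' - q)/ε` of the other one.
  have x1 : Complex.exp (Complex.I * (⟪ε⁻¹ • q, ξ⟫ : ℝ)) *
      Complex.exp (-Complex.I * (⟪ε⁻¹ • q, ξ⟫ : ℝ)) = 1 := by
    rw [← Complex.exp_add]; simp
  have x2 : Complex.exp (Complex.I * (⟪ε⁻¹ • q, ξ⟫ : ℝ)) *
      Complex.exp (-Complex.I * (⟪ε⁻¹ • q', ξ⟫ : ℝ)) =
      Complex.exp (-Complex.I * (⟪ε⁻¹ • (q' - q), ξ⟫ : ℝ)) := by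
    rw [← Complex.exp_add, smul_sub, inner_sub_left]
    congr 1
    push_cast
    ring
  rw [← x2, inner_zero_left, Complex.ofReal_zero, mul_zero, Complex.exp_zero, ← x1]
  field_simp

lemma integral_conj_rescaled_mul {ε α : ℝ} (hε : 0 < ε) (hα : 0 < α) {S T v g : E3 → ℂ}
    (hS : MemLp S 2 volume) (hT : MemLp T 2 volume) (hv : MemLp v 2 volume) (hg : MemLp g 2 volume)
    (q q' : E3) (h : IsWeakHelmholtz (α / ε) (1 / ε ^ 2)
      (fun x => scaledSource ε S q x + scaledSource ε T q' x) v) :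
    ∫ y, conj ((ε : ℂ) * v (ε • y + q)) * g y = -(2 * Real.pi : ℂ)⁻¹ ^ 3 *
      conj (multForm (resMult (ε * α) 0) S g + multForm (resMult (ε * α) (ε⁻¹ • (q' - q))) T g) := by
  have hw : MemLp (fun y => (ε : ℂ) * v (ε • y + q)) 2 volume :=
    (memLp_comp_smul (memLp_comp_add hv q) hε.ne').const_mul _
  have hδ := mul_pos hε hα
  have h1 := integral_hatL2_mul_conj hw hg
  have h2 : ∫ ξ, hatL2 (fun y => (ε : ℂ) * v (ε • y + q)) ξ * conj (hatL2 g ξ) =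
      -(multForm (resMult (ε * α) 0) S g + multForm (resMult (ε * α) (ε⁻¹ • (q' - q))) T g) := by
    rw [multForm, multForm, ← integral_add ((bddMult_resMult hδ _).integrable _ _)
      ((bddMult_resMult hδ _).integrable _ _), ← integral_neg]
    refine integral_congr_ae ?_
    filter_upwards [hatL2_rescaled hε hα hS hT hv q q' h] with ξ hξ
    rw [hξ]
    ring
  have h3 : ∫ y, conj ((ε : ℂ) * v (ε • y + q)) * g y =
      conj (∫ y, (ε : ℂ) * v (ε • y + q) * conj (g y)) := by
    rw [← integral_conj]
    simp only [map_mul, Complex.conj_conj]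
  rw [h2] at h1
  have h4 : ∫ y, (ε : ℂ) * v (ε • y + q) * conj (g y) = -(2 * Real.pi : ℂ)⁻¹ ^ 3 *
      (multForm (resMult (ε * α) 0) S g + multForm (resMult (ε * α) (ε⁻¹ • (q' - q))) T g) := by
    rw [neg_mul, ← mul_neg, h1, ← mul_assoc, ← mul_pow, inv_mul_cancel₀ (by simp [Real.pi_ne_zero]),
      one_pow, one_mul]
  rw [h3, h4, map_mul]
  congr 1
  simp [Complex.conj_ofNat]

/-! ### The limit of the source terms -/

lemma bracket_const_mul (c : ℂ) (W : E3 → E3 → ℂ) (ψ : 𝓢(E3 × E3, ℂ)) :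
    bracket (fun x ξ => c * W x ξ) ψ = c * bracket W ψ := by
  rw [bracket, bracket, ← integral_const_mul]
  simp only [mul_assoc]

lemma mul_bracket_wigner_eq_multForm {ε α : ℝ} (hε : 0 < ε) (hα : 0 < α) {S T v : E3 → ℂ}
    {s : ℝ} (hs0 : 0 ≤ s) (hs1 : s ≤ 1) (hS : MemZ s S) (hT : MemZ s T) (hv : MemLp v 2 volume)
    (q q' : E3) (h : IsWeakHelmholtz (α / ε) (1 / ε ^ 2)
      (fun x => scaledSource ε S q x + scaledSource ε T q' x) v) (ψ : 𝓢(E3 × E3, ℂ)) :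
    (ε : ℂ) * bracket (wigner ε (scaledSource ε S q) v) ψ =
      (2 * Real.pi : ℂ)⁻¹ ^ 3 * (-(2 * Real.pi : ℂ)⁻¹ ^ 3 *
        conj (multForm (resMult (ε * α) 0) S (smear (partialHat ψ) S q ε) +
          multForm (resMult (ε * α) (ε⁻¹ • (q' - q))) T (smear (partialHat ψ) S q ε))) := by
  obtain ⟨F, C, hC0, hC⟩ := exists_norm_partialHat_le
  have hg := (memZ_smear (continuous_partialHat ψ) (hC ψ) q hs0 hs1 hS
    (mul_nonneg hC0 (apply_nonneg _ _)) ε).1.memLp hs0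
  rw [mul_bracket_wigner_scaledSource hε (hS.memLp hs0) hv,
    integral_conj_rescaled_mul hε hα (hS.memLp hs0) (hT.memLp hs0) hv hg q q' h]

section TwoSources

variable {s : ℝ} (hs : 1 / 2 < s) (hs1 : s ≤ 1) {S T : E3 → ℂ} (hS : MemZ s S) (hT : MemZ s T)
  {q q' : E3} {α : ℝ → ℝ} (hα : ∀ ε : ℝ, 0 < ε → 0 < α ε) {v : ℝ → E3 → ℂ}
  (hv : ∀ ε : ℝ, 0 < ε → MemLp (v ε) 2 volume)
  (h : ∀ ε : ℝ, 0 < ε → IsWeakHelmholtz (α ε / ε) (1 / ε ^ 2)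
    (fun x => scaledSource ε S q x + scaledSource ε T q' x) (v ε))

-- `ψ` enters only through the seminorm that controls its partial transform, and the resolvent
-- estimate holds for all `δ > 0` and all translations, so one constant serves every `ε > 0`.
include hs hs1 hS hT hα hv h in
lemma boundedTempered_wigner_source :
    BoundedTempered (fun ε x ξ => (ε : ℂ) * wigner ε (scaledSource ε S q) (v ε) x ξ) := by
  have hs0 : 0 ≤ s := by linarith
  constructor
  · intro ε hε ψ
    have := (integrable_wigner_mul hε.ne' (memLp_scaledSource hε.ne' (hS.memLp hs0) q) (hv ε hε)
      ψ).const_mul (ε : ℂ)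
    simpa only [mul_assoc] using this
  obtain ⟨F, C, hC0, hC⟩ := exists_norm_partialHat_le
  obtain ⟨K, hK0, hK⟩ := exists_norm_resForm_le hs
  set A : ℝ := (2 * Real.pi)⁻¹ ^ 3 * ((2 * Real.pi)⁻¹ ^ 3 *
    (K * ((normZ s S + normZ s T) * (2 * C * (bracketConst * normZ s S))))) with hA
  refine ⟨F, A, fun ε hε ψ => ?_⟩
  set P := (F.sup (schwartzSeminormFamily ℂ (E3 × E3) ℂ)) ψ with hP
  have hP0 : 0 ≤ P := apply_nonneg _ _
  obtain ⟨hgZ, hgn⟩ := memZ_smear (continuous_partialHat ψ) (hC ψ) q hs0 hs1 hS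
    (mul_nonneg hC0 hP0) ε
  have hδ := mul_pos hε (hα ε hε)
  have hpi : ‖(2 * Real.pi : ℂ)⁻¹ ^ 3‖ = (2 * Real.pi)⁻¹ ^ 3 := by
    rw [norm_pow, norm_inv, norm_mul, Complex.norm_real, Real.norm_of_nonneg Real.pi_pos.le]
    simp
  rw [bracket_const_mul, mul_bracket_wigner_eq_multForm hε (hα ε hε) hs0 hs1 hS hT (hv ε hε) q q'
    (h ε hε), norm_mul, norm_mul, norm_neg, hpi, RCLike.norm_conj, hA]
  simp only [mul_assoc]
  refine mul_le_mul_of_nonneg_left (mul_le_mul_of_nonneg_left ?_ (by positivity)) (by positivity)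
  refine (norm_add_le _ _).trans ((add_le_add (hK hδ _ hS hgZ) (hK hδ _ hT hgZ)).trans ?_)
  have hsum : 0 ≤ normZ s S + normZ s T := add_nonneg (nrm_nonneg _) (nrm_nonneg _)
  calc _ = K * ((normZ s S + normZ s T) * normZ s (smear (partialHat ψ) S q ε)) := by ring
    _ ≤ K * ((normZ s S + normZ s T) * (2 * (C * P) * (bracketConst * normZ s S))) := by gcongr
    _ = _ := by ring

-- The test function may be frozen at `ε = 0`: the error is the uniform resolvent bound times the
-- weighted norm of the difference, which tends to `0`.
include hs hs1 hS in
lemma tendsto_multForm_smear {R : E3 → ℂ} (hR : MemZ s R) {δ : ℝ → ℝ}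
    (hδ : ∀ᶠ ε in 𝓝[>] 0, 0 < δ ε) {a : ℝ → E3} (ψ : 𝓢(E3 × E3, ℂ)) {L : ℂ}
    (hL : Tendsto (fun ε => multForm (resMult (δ ε) (a ε)) R (smear (partialHat ψ) S q 0))
      (𝓝[>] 0) (𝓝 L)) :
    Tendsto (fun ε => multForm (resMult (δ ε) (a ε)) R (smear (partialHat ψ) S q ε))
      (𝓝[>] 0) (𝓝 L) := by
  have hs0 : 0 ≤ s := by linarith
  obtain ⟨F, C, hC0, hC⟩ := exists_norm_partialHat_le
  obtain ⟨K, hK0, hK⟩ := exists_norm_resForm_le hs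
  have hP0 := mul_nonneg hC0
    (apply_nonneg (F.sup (schwartzSeminormFamily ℂ (E3 × E3) ℂ)) ψ)
  have hgZ := fun ε => (memZ_smear (continuous_partialHat ψ) (hC ψ) q hs0 hs1 hS hP0 ε).1
  set d : ℝ → E3 → ℂ := fun ε x => smear (partialHat ψ) S q ε x + -1 * smear (partialHat ψ) S q 0 x
    with hd
  have hdZ : ∀ ε, MemZ s (d ε) := fun ε => (hgZ ε).add ((hgZ 0).const_mul (-1))
  have hlim : Tendsto (fun ε => multForm (resMult (δ ε) (a ε)) R (d ε)) (𝓝[>] 0) (𝓝 0) := by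
    have h1 := tendsto_normZ_smear_sub (continuous_partialHat ψ) (hC ψ) q hs0 hs1 hS hP0
    have h2 := (h1.const_mul (normZ s R)).const_mul K
    rw [mul_zero, mul_zero] at h2
    refine squeeze_zero_norm' ?_ h2
    filter_upwards [hδ] with ε hε
    exact hK hε _ hR (hdZ ε)
  have hsum := hL.add hlim
  rw [add_zero] at hsum
  refine hsum.congr' ?_
  filter_upwards [hδ] with ε hε
  rw [← multForm_add_right (bddMult_resMult hε _) R ((hgZ 0).memLp hs0) ((hdZ ε).memLp hs0)]
  congr 1
  ext x
  simp only [hd]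
  ring

-- For the source at `q` itself, the limit along `δ = ε α ε → 0⁺` is limiting absorption. For the
-- other source the translation `(q' - q)/ε` tends to infinity, because `q ≠ q'`, and the form tends
-- to `0`.
include hs hs1 hS hT hα hv h in
lemma tendsto_wigner_source (hα0 : Tendsto α (𝓝[>] 0) (𝓝 0)) (hq : q ≠ q') {w : E3 → ℂ}
    (hw : IsAbsorptionLimit s S w) (ψ : 𝓢(E3 × E3, ℂ)) :
    ∃ I : ℂ, IsFourierIntegral S w (fun ξ => hatL2 S ξ * ψ (q, ξ)) I ∧
      Tendsto (fun ε : ℝ => (ε : ℂ) * bracket (wigner ε (scaledSource ε S q) (v ε)) ψ)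
        (𝓝[>] 0) (𝓝 (1 / (2 * Real.pi : ℂ) ^ 3 * I)) := by
  have hs0 : 0 ≤ s := by linarith
  obtain ⟨F, C, hC0, hC⟩ := exists_norm_partialHat_le
  have hgZ := (memZ_smear (continuous_partialHat ψ) (hC ψ) q hs0 hs1 hS
    (mul_nonneg hC0 (apply_nonneg _ _)) 0).1
  have hpi : (2 * Real.pi : ℂ) ^ 3 ≠ 0 := by simp [Real.pi_ne_zero]
  obtain ⟨hg2, hg1⟩ := memLp_hatL2_mul_slice ψ S q
  have hzero := smear_partialHat_zero ψ (hS.memLp hs0) q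
  have hiZ : MemZ s (invHat fun ξ => hatL2 S ξ * ψ (q, ξ)) := by
    have h1 := hgZ.const_mul ((2 * Real.pi : ℂ) ^ 3)⁻¹
    rw [hzero] at h1
    refine (congrArg (MemZ s) (funext fun x => ?_)).mp h1
    rw [← mul_assoc, inv_mul_cancel₀ hpi, one_mul]
  refine ⟨_, hw.isFourierIntegral hs hg2 hg1 hiZ, ?_⟩
  have hε0 : Tendsto (fun ε : ℝ => ε) (𝓝[>] 0) (𝓝 0) := nhdsWithin_le_nhds
  have hδ0 : ∀ᶠ ε in 𝓝[>] (0 : ℝ), 0 < ε * α ε := by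
    filter_upwards [self_mem_nhdsWithin] with ε hε using mul_pos hε (hα ε hε)
  have hδ : Tendsto (fun ε => ε * α ε) (𝓝[>] 0) (𝓝 0) := by simpa using hε0.mul hα0
  have hδ' : Tendsto (fun ε => ε * α ε) (𝓝[>] 0) (𝓝[>] 0) :=
    tendsto_nhdsWithin_iff.2 ⟨hδ, hδ0⟩
  have ha : Tendsto (fun ε : ℝ => ε⁻¹ • (q' - q)) (𝓝[>] 0) (cocompact E3) := by
    rw [← Metric.cobounded_eq_cocompact, ← tendsto_norm_atTop_iff_cobounded]
    have hpos : 0 < ‖q' - q‖ := norm_pos_iff.2 (sub_ne_zero.2 hq.symm)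
    refine (tendsto_inv_nhdsGT_zero.atTop_mul_const hpos).congr' ?_
    filter_upwards [self_mem_nhdsWithin] with ε hε
    rw [norm_smul, Real.norm_of_nonneg (inv_nonneg.2 (le_of_lt hε))]
  have hmain := tendsto_multForm_smear hs hs1 hS (q := q) hS hδ0 ψ
    ((hw.tendsto _ hgZ).comp hδ')
  have hcross := tendsto_multForm_smear hs hs1 hS (q := q) hT hδ0 ψ
    (tendsto_resForm_cocompact hs hT hgZ hδ hδ0 ha)
  have hlim := (((Complex.continuous_conj.tendsto _).comp (hmain.add hcross)).const_mul
    (-(2 * Real.pi : ℂ)⁻¹ ^ 3)).const_mul ((2 * Real.pi : ℂ)⁻¹ ^ 3)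
  -- The two factors `(2π)^{-3}` come from the Wigner transform and from Parseval; they meet one
  -- `(2π)³` from the definition of `w` as a limit and one from `smear` at `ε = 0`.
  have e : (2 * Real.pi : ℂ)⁻¹ ^ 3 * (-(2 * Real.pi : ℂ)⁻¹ ^ 3 *
      conj (-(2 * Real.pi : ℂ) ^ 3 * (∫ x, w x * conj (smear (partialHat ψ) S q 0 x)) + 0)) =
      1 / (2 * Real.pi : ℂ) ^ 3 * ((2 * Real.pi : ℂ) ^ 3 *
        ∫ x, conj (w x) * invHat (fun ξ => hatL2 S ξ * ψ (q, ξ)) x) := by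
    rw [add_zero, map_mul, ← integral_conj, hzero, map_neg]
    have e1 : conj ((2 * Real.pi : ℂ) ^ 3) = (2 * Real.pi : ℂ) ^ 3 := by simp [Complex.conj_ofNat]
    simp only [map_mul, Complex.conj_conj, e1]
    rw [show ∀ f g : E3 → ℂ, ∫ x, f x * ((2 * Real.pi : ℂ) ^ 3 * g x) =
      (2 * Real.pi : ℂ) ^ 3 * ∫ x, f x * g x from fun f g => by
        rw [← integral_const_mul]; simp only [mul_left_comm]]
    rw [inv_pow]
    field_simp
  rw [e] at hlim
  refine hlim.congr' ?_
  filter_upwards [self_mem_nhdsWithin] with ε hε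
  exact (mul_bracket_wigner_eq_multForm hε (hα ε hε) hs0 hs1 hS hT (hv ε hε) q q' (h ε hε) ψ).symm

end TwoSources

end HelmholtzTwoSources

end

/-! ### The main theorem -/

open HelmholtzTwoSources in
theorem proposition4p3
    (S₀ S₁ : E3 → ℂ) (q₁ : E3) (hq₁ : q₁ ≠ 0)
    (α : ℝ → ℝ) (γ N : ℝ)
    (hα_pos : ∀ ε : ℝ, 0 < ε → 0 < α ε)
    (hα_lim : Tendsto α (𝓝[>] 0) (𝓝 0))
    (hγ : 0 < γ)
    (hα_lower : ∀ᶠ ε : ℝ in 𝓝[>] 0, ε ^ γ ≤ α ε)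
    (hS₀ : MemB S₀) (hS₁ : MemB S₁)
    (hN : 1 / 2 + 3 * γ / (γ + 1) < N)
    (hS₀N : MemLp (fun x => ((japanese x ^ N : ℝ) : ℂ) * S₀ x) 2 volume)
    (hS₁N : MemLp (fun x => ((japanese x ^ N : ℝ) : ℂ) * S₁ x) 2 volume)
    (u : ℝ → E3 → ℂ)
    (hu_L2 : ∀ ε : ℝ, 0 < ε → MemLp (u ε) 2 volume)
    (hu : ∀ ε : ℝ, 0 < ε →
      IsWeakHelmholtz (α ε / ε) (1 / ε ^ 2)
        (fun x => scaledSource ε S₀ 0 x + scaledSource ε S₁ q₁ x) (u ε)) :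
    BoundedTempered (fun ε x ξ => (ε : ℂ) * wigner ε (scaledSource ε S₀ 0) (u ε) x ξ) ∧
    BoundedTempered (fun ε x ξ => (ε : ℂ) * wigner ε (scaledSource ε S₁ q₁) (u ε) x ξ) ∧
    ∃ w₀ w₁ : E3 → ℂ, IsOutgoingSolution S₀ w₀ ∧ IsOutgoingSolution S₁ w₁ ∧
      ∀ ψ : 𝓢(E3 × E3, ℂ), ∃ I₀ I₁ : ℂ,
        IsFourierIntegral S₀ w₀ (fun ξ => hatL2 S₀ ξ * ψ (0, ξ)) I₀ ∧
        IsFourierIntegral S₁ w₁ (fun ξ => hatL2 S₁ ξ * ψ (q₁, ξ)) I₁ ∧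
        Tendsto (fun ε : ℝ =>
            (ε : ℂ) * bracket (wigner ε (scaledSource ε S₀ 0) (u ε)) ψ)
          (𝓝[>] 0) (𝓝 (1 / (2 * Real.pi : ℂ) ^ 3 * I₀)) ∧
        Tendsto (fun ε : ℝ =>
            (ε : ℂ) * bracket (wigner ε (scaledSource ε S₁ q₁) (u ε)) ψ)
          (𝓝[>] 0) (𝓝 (1 / (2 * Real.pi : ℂ) ^ 3 * I₁)) := by
  -- The resolvent estimate needs `s > 1/2`, Peetre's inequality is used with `s ≤ 1`, and `s ≤ N`
  -- lets the sources belong to the weighted space.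
  obtain ⟨s, hs, hs1, hsN⟩ : ∃ s : ℝ, 1 / 2 < s ∧ s ≤ 1 ∧ s ≤ N := by
    have : 0 < 3 * γ / (γ + 1) := by positivity
    exact ⟨min 1 N, lt_min (by norm_num) (by linarith), min_le_left _ _, min_le_right _ _⟩
  have hZ₀ : MemZ s S₀ := MemZ.mono hsN hS₀N
  have hZ₁ : MemZ s S₁ := MemZ.mono hsN hS₁N
  -- The two sources play symmetric roles, so the second limit is the first with the sum of sources
  -- reversed.
  have hu' : ∀ ε : ℝ, 0 < ε → IsWeakHelmholtz (α ε / ε) (1 / ε ^ 2)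
      (fun x => scaledSource ε S₁ q₁ x + scaledSource ε S₀ 0 x) (u ε) := by
    simpa only [add_comm] using hu
  obtain ⟨w₀, hw₀⟩ := exists_absorptionLimit hs hZ₀
  obtain ⟨w₁, hw₁⟩ := exists_absorptionLimit hs hZ₁
  refine ⟨boundedTempered_wigner_source hs hs1 hZ₀ hZ₁ hα_pos hu_L2 hu,
    boundedTempered_wigner_source hs hs1 hZ₁ hZ₀ hα_pos hu_L2 hu', w₀, w₁,
    hw₀.isOutgoingSolution hs (by linarith) hZ₀, hw₁.isOutgoingSolution hs (by linarith) hZ₁,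
    fun ψ => ?_⟩
  obtain ⟨I₀, h1, h2⟩ := tendsto_wigner_source hs hs1 hZ₀ hZ₁ hα_pos hu_L2 hu hα_lim hq₁.symm hw₀ ψ
  obtain ⟨I₁, h3, h4⟩ := tendsto_wigner_source hs hs1 hZ₁ hZ₀ hα_pos hu_L2 hu' hα_lim hq₁ hw₁ ψ
  exact ⟨I₀, I₁, h1, h3, h2, h4⟩
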